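/- Let $X\in\mathbb{R}^p$ ($p\ge 1$) be a covariate vector, $W\in\{0,1\}$ a treatment, $Y(0),Y(1)$ integrable potential outcomes, and $Y=Y(W)$. Assume unconfoundedness $\{Y(1),Y(0)\}\perp W\mid X$ and overlap: there is $c>0$ with $c<\Pr(W=1\mid X)<1-c$ almost surely. Let $(X_i,W_i,Y_i)$, $i=1,2,\dots$, be i.i.d. copies of $(X,W,Y)$, and fix an integer $M\ge 1$. Put $\tau(X)=E[Y(1)-Y(0)\mid X]$ and, for a measurable policy $\pi:\mathbb{R}^p\to\{0,1\}$, $A(\pi)=E[\{2\pi(X)-1\}\tau(X)]$. For a sample of size $n$, let $V=\{n^{-1}\sum_{i=1}^n(X_i-\bar X)(X_i-\bar X)^\top\}^{-1}$ with $\bar X=n^{-1}\sum_{i=1}^n X_i$, let $\Vert x\Vert=(x^\top Vx)^{1/2}$, and let $$\mathcal J_M(i)=\Big\{j: W_j=1-W_i,\ \sum_{k:W_k=1-W_i} I\{\Vert X_k-X_i\Vert\le\Vert X_j-X_i\Vert\}\le M\Big\}.$$ For $w\in\{0,1\}$ let $\hat Y_i(w)=Y_i$ if $W_i=w$ and $\hat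 Y_i(w)=M^{-1}\sum_{j\in\mathcal J_M(i)}Y_j$ otherwise, and let $$\hat A_{match}(\pi)=\frac1n\sum_{i=1}^n\{2\pi(X_i)-1\}\{\hat Y_i(1)-\hat Y_i(0)\}.$$ Assume that: (1) $X$ is continuously distributed on a convex and compact support $\mathcal X_0\subset\mathbb R^p$, with a density that is bounded above, and bounded away from zero on $\mathcal X_0$; (2) for $w=0,1$, the functions $x\mapsto E[Y\mid X=x,W=w]$ and $x\mapsto \mathrm{Var}[Y\mid X=x,W=w]$ are Lipschitz in $\mathcal X_0$, and $E[Y^4\mid X=x,W=w]$ is bounded uniformly in $x\in\mathcal X_0$. Then for every measurable policy $\pi$, as $n\to\infty$, $$\hat A_{match}(\pi)-A(\pi)=O_p\big(n^{-1/\max\{2,p\}}\big).$$ In particular, if $p\le 2$, then $\hat A_{match}(\pi)-A(\pi)=O_p(n^{-1/2})$, that is, $\hat A_{match}(\pi)$ is $\sqrt n$-consistent. -/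

import Mathlib

open MeasureTheory ProbabilityTheory Filter
open scoped NNReal ENNReal

noncomputable section

/-- The space `ℝ^p` of covariates, with its Euclidean norm and Lebesgue measure. -/
abbrev Cov (p : ℕ) : Type := EuclideanSpace ℝ (Fin p)

/-- A (deterministic) policy: a decision rule from covariates to treatments `{0, 1}`. -/
abbrev Policy (p : ℕ) : Type := Cov p → Fin 2

/-- The sign `2 π(x) - 1 ∈ {-1, 1}`. -/
def policySign {p : ℕ} (π : Policy p) (x : Cov p) : ℝ := 2 * ((π x : ℕ) : ℝ) - 1

section Population

variable {Ω : Type*} [MeasurableSpace Ω] {p : ℕ}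

/-- The outcome `Y = Y(W)` determined by the potential outcomes `Y(0), Y(1)` and the
treatment `W` (consistency). -/
def outcome (W : Ω → Fin 2) (Ypot : Fin 2 → Ω → ℝ) (ω : Ω) : ℝ := Ypot (W ω) ω

/-- The σ-algebra generated by `X`. -/
abbrev sigmaX (X : Ω → Cov p) : MeasurableSpace Ω :=
  MeasurableSpace.comap X inferInstance

/-- The σ-algebra generated by `(X, W)`. -/
abbrev sigmaXW (X : Ω → Cov p) (W : Ω → Fin 2) : MeasurableSpace Ω :=
  MeasurableSpace.comap (fun ω => (X ω, W ω)) inferInstance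

/-- The conditional average treatment effect `τ(X) = E[Y(1) - Y(0) | X]`. -/
def cate (P : Measure Ω) (X : Ω → Cov p) (Ypot : Fin 2 → Ω → ℝ) : Ω → ℝ :=
  P[Ypot 1 - Ypot 0 | sigmaX X]

/-- The advantage function `A(π) = E[(2 π(X) - 1) τ(X)]`. -/
def advantage (P : Measure Ω) (X : Ω → Cov p) (Ypot : Fin 2 → Ω → ℝ) (π : Policy p) : ℝ :=
  ∫ ω, policySign π (X ω) * cate P X Ypot ω ∂P

/-- The potential outcome model: random variables `X, W, Y(0), Y(1)` with integrable potential
outcomes, unconfoundedness `{Y(1), Y(0)} ⊥ W | X`, and overlap `c < Pr(W = 1 | X) < 1 - c`. -/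
structure IsCausalModel [StandardBorelSpace Ω] (P : Measure Ω) [IsFiniteMeasure P]
    (X : Ω → Cov p) (W : Ω → Fin 2) (Ypot : Fin 2 → Ω → ℝ) : Prop where
  measurable_X : Measurable X
  measurable_W : Measurable W
  measurable_Ypot : ∀ w, Measurable (Ypot w)
  integrable_Ypot : ∀ w, Integrable (Ypot w) P
  unconfounded : CondIndepFun (sigmaX X) measurable_X.comap_le
    (fun ω => (Ypot 1 ω, Ypot 0 ω)) W P
  overlap : ∃ c : ℝ, 0 < c ∧
    ∀ᵐ ω ∂P, c < (P⟦W ⁻¹' {1} | sigmaX X⟧) ω ∧ (P⟦W ⁻¹' {1} | sigmaX X⟧) ω < 1 - c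

/-- The covariate `X` is continuously distributed on the convex and compact support `X₀`, with a
Lebesgue density that is bounded above, and bounded away from zero on `X₀`. -/
structure HasRegularCovariate (P : Measure Ω) (X : Ω → Cov p) (X₀ : Set (Cov p)) : Prop where
  convex : Convex ℝ X₀
  isCompact : IsCompact X₀
  density : ∃ f : Cov p → ℝ≥0∞, Measurable f ∧ P.map X = volume.withDensity f ∧
    (∀ x, x ∉ X₀ → f x = 0) ∧
    ∃ a b : ℝ≥0, 0 < a ∧ ∀ x ∈ X₀, (a : ℝ≥0∞) ≤ f x ∧ f x ≤ (b : ℝ≥0∞)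

/-- The conditional mean `μ(x, w) = E[Y | X = x, W = w]` and the conditional variance
`σ²(x, w) = Var[Y | X = x, W = w]` have versions that are Lipschitz in `x ∈ X₀` for `w = 0, 1`,
and `E[Y⁴ | X = x, W = w]` is bounded. The clause `MemLp Y 4 P` says that `Y⁴` is integrable, so
that the conditional moments are genuine ones. -/
structure HasRegularOutcome (P : Measure Ω) (X : Ω → Cov p) (W : Ω → Fin 2) (Y : Ω → ℝ)
    (X₀ : Set (Cov p)) : Prop where
  lipschitz_mean : ∃ μ : Cov p → Fin 2 → ℝ,
    P[Y | sigmaXW X W] =ᵐ[P] (fun ω => μ (X ω) (W ω)) ∧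
    ∀ w, ∃ L : ℝ≥0, LipschitzOnWith L (fun x => μ x w) X₀
  lipschitz_variance : ∃ σ2 : Cov p → Fin 2 → ℝ,
    condVar (sigmaXW X W) Y P =ᵐ[P] (fun ω => σ2 (X ω) (W ω)) ∧
    ∀ w, ∃ L : ℝ≥0, LipschitzOnWith L (fun x => σ2 x w) X₀
  memLp_four : MemLp Y 4 P
  bounded_fourth : ∃ C : ℝ, ∀ᵐ ω ∂P, (P[fun ω' => Y ω' ^ 4 | sigmaXW X W]) ω ≤ C

end Population

/-- `(Xs i, Ws i, Ys i)`, `i = 0, 1, 2, …`, are independent copies of `(X, W, Y)`. -/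
structure IsIIDSample {Ω₀ Ω : Type*} [MeasurableSpace Ω₀] [MeasurableSpace Ω] {p : ℕ}
    (P₀ : Measure Ω₀) (X : Ω₀ → Cov p) (W : Ω₀ → Fin 2) (Y : Ω₀ → ℝ)
    (P : Measure Ω) (Xs : ℕ → Ω → Cov p) (Ws : ℕ → Ω → Fin 2) (Ys : ℕ → Ω → ℝ) : Prop where
  indep : iIndepFun (fun i ω => (Xs i ω, Ws i ω, Ys i ω)) P
  identDistrib : ∀ i,
    IdentDistrib (fun ω => (Xs i ω, Ws i ω, Ys i ω)) (fun ω => (X ω, W ω, Y ω)) P P₀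

section Estimator

variable {p n : ℕ}

/-- The sample mean `n⁻¹ ∑ X_i`. -/
def sampleMean (X : Fin n → Cov p) : Cov p := (n : ℝ)⁻¹ • ∑ i, X i

/-- The sample covariance matrix `n⁻¹ ∑ (X_i - X̄)(X_i - X̄)ᵀ`. -/
def sampleCov (X : Fin n → Cov p) : Matrix (Fin p) (Fin p) ℝ :=
  (n : ℝ)⁻¹ • ∑ i, Matrix.vecMulVec (X i - sampleMean X).ofLp (X i - sampleMean X).ofLp

/-- The matrix `V_maha` of the Mahalanobis metric: the inverse of the sample covariance. -/
def mahalanobis (X : Fin n → Cov p) : Matrix (Fin p) (Fin p) ℝ := (sampleCov X)⁻¹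

/-- The norm `(xᵀ V x)^{1/2}` of a positive definite matrix `V`. -/
def matrixNorm (V : Matrix (Fin p) (Fin p) ℝ) (x : Cov p) : ℝ :=
  Real.sqrt (x.ofLp ⬝ᵥ V.mulVec x.ofLp)

/-- The matched set `J_M(i)`: the units `j` with `W_j = 1 - W_i` such that at most `M` units `k`
with `W_k = 1 - W_i` satisfy `‖X_k - X_i‖ ≤ ‖X_j - X_i‖`, in the norm of the matrix `V`. -/
def matchedSet (V : Matrix (Fin p) (Fin p) ℝ) (M : ℕ) (X : Fin n → Cov p) (W : Fin n → Fin 2)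
    (i : Fin n) : Finset (Fin n) :=
  {j | W j = 1 - W i ∧
    ({k | W k = 1 - W i ∧
      matrixNorm V (X k - X i) ≤ matrixNorm V (X j - X i)} : Finset (Fin n)).card ≤ M}

/-- The imputed potential outcome `Ŷ_i(w)`, with matching in the Mahalanobis metric. -/
def imputed (M : ℕ) (X : Fin n → Cov p) (W : Fin n → Fin 2) (Y : Fin n → ℝ)
    (i : Fin n) (w : Fin 2) : ℝ :=
  if W i = w then Y i
  else (1 / (M : ℝ)) * ∑ j ∈ matchedSet (mahalanobis X) M X W i, Y j

/-- The matching estimator `Â_match(π) = n⁻¹ ∑ (2 π(X_i) - 1) (Ŷ_i(1) - Ŷ_i(0))`. -/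
def matchingEstimator (M : ℕ) (X : Fin n → Cov p) (W : Fin n → Fin 2) (Y : Fin n → ℝ)
    (π : Policy p) : ℝ :=
  (1 / (n : ℝ)) * ∑ i, policySign π (X i) * (imputed M X W Y i 1 - imputed M X W Y i 0)

end Estimator

/-- `U_n = O_p(r_n)` as `n → ∞`: for each `ε > 0` there is a constant `C` such that
`Pr(|U_n| > C r_n) ≤ ε` for all large `n`. -/
def IsBigOInProb {Ω : Type*} [MeasurableSpace Ω] (P : Measure Ω) (U : ℕ → Ω → ℝ) (r : ℕ → ℝ) :
    Prop :=
  ∀ ε : ℝ, 0 < ε → ∃ C : ℝ, 0 < C ∧ ∀ᶠ n in atTop, P.real {ω | C * r n < |U n ω|} ≤ ε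

end

/-! Let `m w` denote the regression function of the outcome in arm `w`, extended to a Lipschitz
function on the whole space. Unconfoundedness and overlap identify `τ(X)` with `m 1 X - m 0 X`
(`IsCausalModel.condExp_potential_eq`), so everything depends only on the law `Q` of `(X, W, Y)`,
whose relevant properties are collected in `IsRegularLaw`. When every matched set has exactly `M`
elements, the error of the estimator splits into three terms (`matchingEstimator_eq`).

The first is a centred average of the bounded variables `(2π(X) - 1)(m 1 X - m 0 X)`, of order
`n^(-1/2)` by Chebyshev.

The second is the matching discrepancy. By the Lipschitz condition it is at most a constant times
the distance to the matches. The `p`-th power of that distance has mean of order `1/n`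
(`lintegral_matchingRadius_le`): a ball around a point of a convex support contains, in each arm,
mass proportional to its volume, so nearest-neighbour distances have exponential tails on the scale
of the `p`-th power. Jensen's inequality for `t ↦ t^p` then yields the order `n^(-1/p)`.

The third is a sum of residuals whose weights depend only on covariates and treatments. Residuals of
distinct units are orthogonal even after weighting, so the second moment is controlled by the sum of
squared weights (`lintegral_sq_sum_residual_le`). Apart from a term linear in `n`, that sum counts
pairs `(i, i')` sharing a match. Such a pair lies within a multiple of a matching radius that
ignores one of its two members, an event of probability of order `1/n` (`measure_close_pair_le`).
There are fewer than `n^2` pairs, so the sum is of order `n` and the term of order `n^(-1/2)`.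

Two difficulties come from the Mahalanobis metric, which depends on the whole sample. First,
distances: with probability tending to one the eigenvalues of the sample covariance lie between two
positive constants, so the random metric is comparable with the Euclidean one and matching distances
are bounded by purely Euclidean radii (`edist_pow_le_matchingRadius`). Secondly, ties, which would
leave a matched set with fewer than `M` elements: with all points but `X i` frozen, the covariance
is a rank-one update of a fixed matrix, and a tie forces `X i` onto the zero set of a quadratic
polynomial with nonzero linear part, which is Lebesgue null (`ae_no_tie`). -/

noncomputable section

/-! ### Product measures: resampling one coordinate, and averages of independent copies. -/

section Resampling

variable {ι E : Type*} [Fintype ι] [DecidableEq ι] [MeasurableSpace E]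

/-- Replacing one coordinate of a product measure by an independent copy preserves the law. -/
theorem measurePreserving_update_pi (Q : Measure E) [IsProbabilityMeasure Q] (i : ι) :
    MeasurePreserving (fun q : (ι → E) × E => Function.update q.1 i q.2)
      ((Measure.pi fun _ : ι => Q).prod Q) (Measure.pi fun _ : ι => Q) := by
  have hm : Measurable (fun q : (ι → E) × E => Function.update q.1 i q.2) := by
    rw [measurable_pi_iff]
    intro j
    by_cases h : j = i
    · subst h; simpa using measurable_snd
    · simp only [Function.update_of_ne h]
      exact (measurable_pi_apply j).comp measurable_fst
  refine ⟨hm, (Measure.pi_eq fun s hs => ?_).symm⟩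
  rw [Measure.map_apply hm (MeasurableSet.univ_pi hs)]
  have : (fun q : (ι → E) × E => Function.update q.1 i q.2) ⁻¹' (Set.univ.pi s) =
      (Set.univ.pi (Function.update s i Set.univ)) ×ˢ (s i) := by
    ext q
    simp only [Set.mem_preimage, Set.mem_pi, Set.mem_univ, true_imp_iff, Set.mem_prod]
    constructor
    · intro h
      refine ⟨fun j => ?_, by simpa using h i⟩
      by_cases hj : j = i
      · subst hj; simp
      · simpa [Function.update_of_ne hj] using h j
    · rintro ⟨h1, h2⟩ j
      by_cases hj : j = i
      · subst hj; simpa using h2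
      · simpa [Function.update_of_ne hj] using h1 j
  rw [this, Measure.prod_prod, Measure.pi_pi, ← Finset.prod_erase_mul _ _ (Finset.mem_univ i),
    ← Finset.prod_erase_mul (a := i) _ (fun j => Q (s j)) (Finset.mem_univ i)]
  simp only [Function.update_self, measure_univ, mul_one]
  congr 1
  refine Finset.prod_congr rfl fun j hj => ?_
  rw [Function.update_of_ne (Finset.ne_of_mem_erase hj)]

theorem lintegral_pi_eq_lintegral_update (Q : Measure E) [IsProbabilityMeasure Q] (i : ι)
    {F : (ι → E) → ℝ≥0∞} (hF : Measurable F) :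
    ∫⁻ z, F z ∂(Measure.pi fun _ : ι => Q) =
      ∫⁻ z, ∫⁻ y, F (Function.update z i y) ∂Q ∂(Measure.pi fun _ : ι => Q) := by
  have h := measurePreserving_update_pi (ι := ι) Q i
  rw [← h.lintegral_comp hF]
  exact lintegral_prod _ (hF.comp h.measurable).aemeasurable

/-- With the fresh copy in the outer integral, unit `i` can be held fixed while the rest of the
sample is random. -/
theorem lintegral_pi_eq_lintegral_update_symm (Q : Measure E) [IsProbabilityMeasure Q] (i : ι)
    {F : (ι → E) → ℝ≥0∞} (hF : Measurable F) :
    ∫⁻ z, F z ∂(Measure.pi fun _ : ι => Q) =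
      ∫⁻ y, ∫⁻ z, F (Function.update z i y) ∂(Measure.pi fun _ : ι => Q) ∂Q := by
  have h := measurePreserving_update_pi (ι := ι) Q i
  rw [← h.lintegral_comp hF]
  exact lintegral_prod_symm _ (hF.comp h.measurable).aemeasurable

theorem integral_pi_eq_integral_update (Q : Measure E) [IsProbabilityMeasure Q] (i : ι)
    {F : (ι → E) → ℝ} (hF : Integrable F (Measure.pi fun _ : ι => Q)) :
    ∫ z, F z ∂(Measure.pi fun _ : ι => Q) =
      ∫ z, ∫ y, F (Function.update z i y) ∂Q ∂(Measure.pi fun _ : ι => Q) := by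
  have h := measurePreserving_update_pi (ι := ι) Q i
  have h1 := integral_prod _ (h.integrable_comp_of_integrable hF)
  refine Eq.trans ?_ h1
  simp only [Function.comp_apply]
  rw [← integral_map (f := F) h.measurable.aemeasurable
    (by rw [h.map_eq]; exact hF.aestronglyMeasurable), h.map_eq]

theorem measure_pi_eq_lintegral_update (Q : Measure E) [IsProbabilityMeasure Q] (i : ι)
    {s : Set (ι → E)} (hs : MeasurableSet s) :
    (Measure.pi fun _ : ι => Q) s =
      ∫⁻ z, Q {y | Function.update z i y ∈ s} ∂(Measure.pi fun _ : ι => Q) := by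
  have h := measurePreserving_update_pi (ι := ι) Q i
  rw [← h.measure_preimage hs.nullMeasurableSet,
    Measure.prod_apply (h.measurable hs)]
  rfl

end Resampling

theorem ae_pi_of_ae {ι E : Type*} [Fintype ι] [MeasurableSpace E] {Q : Measure E} [IsProbabilityMeasure Q] {r : E → Prop}
    (h : ∀ᵐ y ∂Q, r y) : ∀ᵐ z ∂(Measure.pi fun _ : ι => Q), ∀ i, r (z i) := by
  rw [ae_all_iff]
  exact fun i => (measurePreserving_eval (fun _ : ι => Q) i).quasiMeasurePreserving.ae h

/-- Chebyshev's inequality for the average of independent copies of an a.s. bounded function. -/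
theorem measure_pi_average_deviation_le {E : Type*} [MeasurableSpace E] (Q : Measure E)
    [IsProbabilityMeasure Q] {f : E → ℝ} (hf : Measurable f) {B : ℝ} (hB : ∀ᵐ y ∂Q, |f y| ≤ B)
    {n : ℕ} (hn : 0 < n) {t : ℝ} (ht : 0 < t) :
    (Measure.pi fun _ : Fin n => Q) {z | t ≤ |(n : ℝ)⁻¹ * ∑ i, f (z i) - ∫ y, f y ∂Q|} ≤
      ENNReal.ofReal (B ^ 2 / (n * t ^ 2)) := by
  have hLp : MemLp f 2 Q := MemLp.of_bound hf.aestronglyMeasurable B (by simpa using hB)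
  have hn' : (0 : ℝ) < n := by exact_mod_cast hn
  set μ := Measure.pi fun _ : Fin n => Q
  have hLpi : ∀ i : Fin n, MemLp (fun z : Fin n → E => f (z i)) 2 μ := fun i =>
    hLp.comp_measurePreserving (measurePreserving_eval (fun _ : Fin n => Q) i)
  set S : (Fin n → E) → ℝ := ∑ i, fun z => f (z i) with hS
  have hSLp : MemLp S 2 μ := by
    rw [hS]; exact memLp_finsetSum' _ fun i _ => hLpi i
  have hvar : Var[S; μ] = n * Var[f; Q] := by
    rw [hS, variance_sum_pi (μ := fun _ : Fin n => Q) (X := fun _ => f) (fun _ => hLp)]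
    simp
  have hmean : ∫ z, S z ∂μ = n * ∫ y, f y ∂Q := by
    have : ∀ i : Fin n, ∫ z, f (z i) ∂μ = ∫ y, f y ∂Q := fun i => by
      have h := measurePreserving_eval (fun _ : Fin n => Q) i
      conv_rhs => rw [← h.map_eq]
      rw [integral_map h.measurable.aemeasurable hf.aestronglyMeasurable]
    simp only [hS, Finset.sum_apply]
    rw [integral_finsetSum _ fun i _ => (hLpi i).integrable (by norm_num)]
    simp [this]
  have hvB : Var[f; Q] ≤ B ^ 2 := by
    refine (variance_le_expectation_sq hf.aestronglyMeasurable).trans ?_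
    have : ∫ y, (f ^ 2) y ∂Q ≤ ∫ _, B ^ 2 ∂Q := by
      refine integral_mono_ae hLp.integrable_sq (integrable_const _) ?_
      filter_upwards [hB] with y hy
      simpa using sq_le_sq' (abs_le.1 hy).1 (abs_le.1 hy).2
    simpa using this
  have hc := meas_ge_le_variance_div_sq hSLp (c := n * t) (by positivity)
  refine le_trans (measure_mono ?_) (hc.trans (ENNReal.ofReal_le_ofReal ?_))
  · intro z hz
    simp only [Set.mem_ofPred_eq] at hz ⊢
    rw [hmean]
    have : S z - n * ∫ y, f y ∂Q = n * ((n : ℝ)⁻¹ * ∑ i, f (z i) - ∫ y, f y ∂Q) := by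
      simp only [hS, Finset.sum_apply]; field_simp
    rw [this, abs_mul, abs_of_pos hn']
    gcongr
  · rw [hvar]
    calc n * Var[f; Q] / (n * t) ^ 2 = Var[f; Q] / (n * t ^ 2) := by field_simp
      _ ≤ _ := by gcongr

/-! ### Null sets: zeros of quadratic polynomials. -/

section QuadraticZeros

variable {p : ℕ}

/-- A measurable set meeting almost every line of a fixed direction in a null set is null. -/
theorem volume_eq_zero_of_lines {Z : Set (Cov p)} (hZ : MeasurableSet Z) (d : Cov p)
    (h : ∀ᵐ y : Cov p, volume {t : ℝ | y + t • d ∈ Z} = 0) : volume Z = 0 := by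
  have hm : Measurable fun q : Cov p × ℝ => q.1 + q.2 • d := by fun_prop
  -- Fubini in both orders. Each slice at fixed `t` is a translate of `Z`, and the unit interval has
  -- mass one, so the double integral equals the volume of `Z`.
  have h1 : (volume.prod (volume.restrict (Set.Icc (0 : ℝ) 1)))
      ((fun q : Cov p × ℝ => q.1 + q.2 • d) ⁻¹' Z) = 0 := by
    rw [Measure.measure_prod_null (hm hZ)]
    filter_upwards [h] with y hy
    exact le_antisymm ((Measure.restrict_apply_le _ _).trans hy.le) bot_le
  rw [Measure.prod_apply_symm (hm hZ)] at h1
  have h2 : ∀ t : ℝ, volume ((fun y : Cov p => (y, t)) ⁻¹'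
      ((fun q : Cov p × ℝ => q.1 + q.2 • d) ⁻¹' Z)) = volume Z := fun t => by
    have := measure_preimage_add_right volume (t • d) Z
    exact this
  simpa [h2] using h1

theorem volume_quadratic_roots {a b c : ℝ} (h : a ≠ 0 ∨ b ≠ 0) :
    volume {t : ℝ | c + t * b + t ^ 2 * a = 0} = 0 := by
  have hne : (Polynomial.C a * Polynomial.X ^ 2 + Polynomial.C b * Polynomial.X +
      Polynomial.C c) ≠ 0 := by
    intro h0
    have h2 := congrArg (fun q => Polynomial.coeff q 2) h0
    have h1 := congrArg (fun q => Polynomial.coeff q 1) h0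
    simp [Polynomial.coeff_C] at h1 h2
    tauto
  refine Set.Finite.measure_zero (Set.Finite.subset (Polynomial.finite_setOfPred_isRoot hne) ?_) _
  intro t ht
  simp only [Set.mem_ofPred_eq, Polynomial.IsRoot.def, Polynomial.eval_add, Polynomial.eval_mul,
    Polynomial.eval_C, Polynomial.eval_pow, Polynomial.eval_X] at ht ⊢
  linarith

theorem volume_linear_level_set (β : Cov p →ₗ[ℝ] ℝ) (hβ : β ≠ 0) (α : ℝ) :
    volume {y : Cov p | α + β y = 0} = 0 := by
  obtain ⟨d, hd⟩ : ∃ d, β d ≠ 0 := by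
    by_contra! h
    exact hβ (LinearMap.ext h)
  have hc : Continuous β := β.continuous_of_finiteDimensional
  refine volume_eq_zero_of_lines (d := d) ?_ (Eventually.of_forall fun y => ?_)
  · exact (isClosed_eq (by fun_prop) continuous_const).measurableSet
  · have : {t : ℝ | y + t • d ∈ {y : Cov p | α + β y = 0}} =
        {t : ℝ | (α + β y) + t * β d + t ^ 2 * 0 = 0} := by
      ext t; simp [add_assoc]
    rw [this]
    exact volume_quadratic_roots (Or.inr hd)

/-- The zero set of a quadratic polynomial with nonzero linear part is null. -/
theorem volume_quadratic_zeros (α : ℝ) (β : Cov p →ₗ[ℝ] ℝ) (hβ : β ≠ 0)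
    (γ : Cov p →ₗ[ℝ] Cov p →ₗ[ℝ] ℝ) :
    volume {y : Cov p | α + β y + γ y y = 0} = 0 := by
  obtain ⟨d, hd⟩ : ∃ d, β d ≠ 0 := by
    by_contra! h
    exact hβ (LinearMap.ext h)
  have hc : Continuous β := β.continuous_of_finiteDimensional
  have hγ : Continuous fun y => γ y y := by
    have h1 : Continuous ((LinearMap.toContinuousLinearMap :
        (Cov p →ₗ[ℝ] ℝ) ≃ₗ[ℝ] (Cov p →L[ℝ] ℝ)).toLinearMap ∘ₗ γ) :=
      LinearMap.continuous_of_finiteDimensional _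
    exact h1.clm_apply continuous_id
  have hmeas : MeasurableSet {y : Cov p | α + β y + γ y y = 0} :=
    (isClosed_eq ((continuous_const.add hc).add hγ) continuous_const).measurableSet
  have hline : ∀ y, {t : ℝ | y + t • d ∈ {y : Cov p | α + β y + γ y y = 0}} =
      {t : ℝ | (α + β y + γ y y) + t * (β d + γ y d + γ d y) + t ^ 2 * γ d d = 0} := fun y => by
    ext t
    simp only [Set.mem_ofPred_eq, map_add, map_smul, LinearMap.add_apply, LinearMap.smul_apply,
      smul_eq_mul]
    constructor <;> intro h <;> linarith
  refine volume_eq_zero_of_lines (d := d) hmeas ?_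
  -- If the coefficient of `t^2` vanishes, the coefficient of `t` is an affine function of `y` with
  -- constant term `β d ≠ 0`; its zero set is null, and off it each line meets the set in finitely
  -- many points.
  by_cases hdd : γ d d = 0
  · set L : Cov p →ₗ[ℝ] ℝ := γ.flip d + γ d
    have hL : volume {y : Cov p | β d + L y = 0} = 0 := by
      by_cases h0 : L = 0
      · simp [h0, hd]
      · exact volume_linear_level_set L h0 _
    have : ∀ᵐ y : Cov p, y ∉ {y : Cov p | β d + L y = 0} := measure_eq_zero_iff_ae_notMem.1 hL
    filter_upwards [this] with y hy
    refine (congrArg volume (hline y)).trans ?_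
    refine volume_quadratic_roots (Or.inr ?_)
    simpa [L, add_assoc] using hy
  · exact Eventually.of_forall fun y => by
      exact (congrArg volume (hline y)).trans <| volume_quadratic_roots (Or.inl hdd)

end QuadraticZeros

/-! ### Combinatorics of ranks in a finite set. -/

section Ranks

variable {α : Type*} (O : Finset α) (f : α → ℝ) (M : ℕ)

/-- The element of largest value among those of rank at most `M` has all the others in its sublevel
set, and that sublevel set has at most `M` elements. Ties do no harm here. -/
theorem card_filter_rank_le :
    (O.filter fun j => (O.filter fun k => f k ≤ f j).card ≤ M).card ≤ M := by
  rcases (O.filter fun j => (O.filter fun k => f k ≤ f j).card ≤ M).eq_empty_or_nonempty with h | h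
  · simp [h]
  · obtain ⟨j, hj, hmax⟩ := Finset.exists_max_image _ f h
    refine le_trans (Finset.card_le_card fun k hk => ?_) (Finset.mem_filter.1 hj).2
    exact Finset.mem_filter.2 ⟨(Finset.mem_filter.1 hk).1, hmax k hk⟩

/-- Without ties the rank is a bijection from `O` onto `{1, …, |O|}`. -/
theorem card_filter_rank_eq [DecidableEq α] (hf : Set.InjOn f O) (hM : M ≤ O.card) :
    (O.filter fun j => (O.filter fun k => f k ≤ f j).card ≤ M).card = M := by
  set r : α → ℕ := fun j => (O.filter fun k => f k ≤ f j).card with hr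
  have hlt : ∀ i ∈ O, ∀ j ∈ O, f i < f j → r i < r j := fun i hi j hj hij => by
    refine Finset.card_lt_card ⟨fun k hk => ?_, fun h => ?_⟩
    · rw [Finset.mem_filter] at hk ⊢
      exact ⟨hk.1, hk.2.trans hij.le⟩
    · have := h (Finset.mem_filter.2 ⟨hj, le_rfl⟩)
      exact absurd (Finset.mem_filter.1 this).2 (not_le.2 hij)
  have hinj : Set.InjOn r O := fun i hi j hj hij => by
    by_contra hne
    rcases lt_or_gt_of_ne fun h => hne (hf hi hj h) with h | h
    · exact absurd hij (hlt i hi j hj h).ne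
    · exact absurd hij (hlt j hj i hi h).ne'
  have himg : O.image r = Finset.Icc 1 O.card := by
    refine Finset.eq_of_subset_of_card_le ?_ ?_
    · intro x hx
      obtain ⟨j, hj, rfl⟩ := Finset.mem_image.1 hx
      refine Finset.mem_Icc.2 ⟨Finset.card_pos.2 ⟨j, Finset.mem_filter.2 ⟨hj, le_rfl⟩⟩, ?_⟩
      exact Finset.card_le_card (Finset.filter_subset _ _)
    · rw [Finset.card_image_of_injOn hinj]; simp
  have h1 : ((O.filter fun j => r j ≤ M).image r) = Finset.Icc 1 M := by
    have : (O.filter fun j => r j ≤ M).image r = (O.image r).filter (· ≤ M) := by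
      ext x
      simp only [Finset.mem_image, Finset.mem_filter]
      constructor
      · rintro ⟨j, ⟨h1, h2⟩, rfl⟩; exact ⟨⟨j, h1, rfl⟩, h2⟩
      · rintro ⟨⟨j, h1, rfl⟩, h2⟩; exact ⟨j, ⟨h1, h2⟩, rfl⟩
    rw [this, himg]
    ext x
    simp only [Finset.mem_filter, Finset.mem_Icc]
    omega
  have h2 := Finset.card_image_of_injOn (s := O.filter fun j => r j ≤ M)
    (hinj.mono fun x hx => (Finset.mem_filter.1 hx).1)
  rw [h1] at h2
  simpa using h2.symm

/-- Otherwise `j` together with `K` would give more than `M` elements in the sublevel set of `j`.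
Any `M` candidates thus certify a bound on the distance of every match. -/
theorem exists_le_of_rank_le [DecidableEq α] {j : α} (hjO : j ∈ O)
    (hj : (O.filter fun k => f k ≤ f j).card ≤ M) {K : Finset α} (hK : K ⊆ O) (hKM : M ≤ K.card) :
    ∃ k ∈ K, f j ≤ f k := by
  by_contra! h
  have hjK : j ∉ K := fun hj' => lt_irrefl _ (h j hj')
  have : insert j K ⊆ O.filter fun k => f k ≤ f j := by
    intro k hk
    rcases Finset.mem_insert.1 hk with rfl | hk
    · exact Finset.mem_filter.2 ⟨hjO, le_rfl⟩
    · exact Finset.mem_filter.2 ⟨hK hk, (h k hk).le⟩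
  have := (Finset.card_le_card this).trans hj
  rw [Finset.card_insert_of_notMem hjK] at this
  omega

end Ranks

/-! ### Matched sets and Euclidean bounds for the matching distance. -/

section MatchedSet

variable {p n : ℕ} (V : Matrix (Fin p) (Fin p) ℝ) (M : ℕ) (X : Fin n → Cov p) (W : Fin n → Fin 2)

/-- The units in the treatment arm opposite to that of unit `i`. -/
def oppositeArm (W : Fin n → Fin 2) (i : Fin n) : Finset (Fin n) := {j | W j = 1 - W i}

theorem mem_oppositeArm {W : Fin n → Fin 2} {i j : Fin n} :
    j ∈ oppositeArm W i ↔ W j = 1 - W i := by simp [oppositeArm]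

theorem matchedSet_eq (i : Fin n) :
    matchedSet V M X W i = (oppositeArm W i).filter fun j =>
      ((oppositeArm W i).filter fun k =>
        matrixNorm V (X k - X i) ≤ matrixNorm V (X j - X i)).card ≤ M := by
  ext j
  simp [matchedSet, oppositeArm, Finset.filter_filter]

theorem matchedSet_subset (i : Fin n) : matchedSet V M X W i ⊆ oppositeArm W i := by
  rw [matchedSet_eq]; exact Finset.filter_subset _ _

theorem card_matchedSet_le (i : Fin n) : (matchedSet V M X W i).card ≤ M := by
  rw [matchedSet_eq]
  exact card_filter_rank_le _ (fun k => matrixNorm V (X k - X i)) M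

theorem card_matchedSet_eq (i : Fin n) (hM : M ≤ (oppositeArm W i).card)
    (h : ∀ j ∈ oppositeArm W i, ∀ k ∈ oppositeArm W i, j ≠ k →
      matrixNorm V (X j - X i) ≠ matrixNorm V (X k - X i)) :
    (matchedSet V M X W i).card = M := by
  rw [matchedSet_eq]
  refine card_filter_rank_eq _ (fun k => matrixNorm V (X k - X i)) M (fun j hj k hk hjk => ?_) hM
  by_contra hne
  exact h j hj k hk hne hjk

/-- Units with index congruent to `b` modulo `M`. -/
def residueBlock (n M : ℕ) (b : Fin M) : Finset (Fin n) := {k | k.val % M = b.val}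

theorem le_card_residueBlock (b : Fin M) : n / M ≤ (residueBlock n M b).card := by
  have hM : 0 < M := b.pos
  have hlt : ∀ t ∈ Finset.range (n / M), t * M + b.val < n := fun t ht => by
    have h1 : t + 1 ≤ n / M := Finset.mem_range.1 ht
    have h2 := (Nat.le_div_iff_mul_le hM).1 h1
    have := b.isLt
    nlinarith
  rcases Nat.eq_zero_or_pos n with rfl | hn
  · simp
  have : NeZero n := ⟨hn.ne'⟩
  calc n / M = (Finset.range (n / M)).card := by simp
    _ ≤ _ := by
      refine Finset.card_le_card_of_injOn (fun t => Fin.ofNat n (t * M + b.val)) ?_ ?_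
      · intro t ht
        simp only [residueBlock, Finset.coe_filter, Finset.mem_univ, true_and, Set.mem_ofPred_eq,
          Fin.val_ofNat]
        rw [Nat.mod_eq_of_lt (hlt t ht), Nat.add_mod, Nat.mul_mod_left, Nat.zero_add, Nat.mod_mod,
          Nat.mod_eq_of_lt b.isLt]
      · intro t ht s hs hts
        have := congrArg Fin.val hts
        simp only [Fin.val_ofNat] at this
        rw [Nat.mod_eq_of_lt (hlt t ht), Nat.mod_eq_of_lt (hlt s hs)] at this
        exact Nat.eq_of_mul_eq_mul_right hM (by omega)

/-- The `p`-th power of the Euclidean distance from unit `i` to the nearest unit of `I` in the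
opposite arm, truncated at `R ^ p`. -/
def nearestRadius (R : ℝ≥0∞) (X : Fin n → Cov p) (W : Fin n → Fin 2) (I : Finset (Fin n))
    (i : Fin n) : ℝ≥0∞ :=
  min (R ^ p) (I.inf fun k => if W k = 1 - W i then edist (X k) (X i) ^ p else ⊤)

/-- A bound for the `p`-th power of the distance from unit `i` to its `M` nearest units of the
opposite arm, computed without using unit `i'`. -/
def matchingRadius (R : ℝ≥0∞) (M : ℕ) (X : Fin n → Cov p) (W : Fin n → Fin 2) (i i' : Fin n) :
    ℝ≥0∞ :=
  ∑ b : Fin M, nearestRadius R X W (residueBlock n M b \ {i, i'}) i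

/-- The nearest opposite-arm units of the `M` disjoint residue blocks are `M` distinct candidates,
so a match is no farther in the matrix norm than one of them. Passing to the Euclidean norm costs
the factor `κ`, and the sum of the block radii dominates each one of them. Since each radius
concerns a single nearest neighbour, order statistics are avoided. -/
theorem edist_pow_le_matchingRadius {R κ : ℝ≥0} (hκ : 1 ≤ κ)
    (hR : ∀ i j, edist (X i) (X j) ≤ R)
    (hV : ∀ a b : Cov p, matrixNorm V a ≤ matrixNorm V b → ‖a‖ₑ ≤ κ * ‖b‖ₑ)
    {i j : Fin n} (hj : j ∈ matchedSet V M X W i) (i' : Fin n) :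
    edist (X j) (X i) ^ p ≤ (κ : ℝ≥0∞) ^ p * matchingRadius R M X W i i' := by
  have hκ' : (1 : ℝ≥0∞) ≤ (κ : ℝ≥0∞) ^ p := one_le_pow₀ (by exact_mod_cast hκ)
  have hle : ∀ b : Fin M, nearestRadius R X W (residueBlock n M b \ {i, i'}) i ≤
      matchingRadius R M X W i i' := fun b =>
    Finset.single_le_sum (f := fun b : Fin M =>
      nearestRadius R X W (residueBlock n M b \ {i, i'}) i) (fun _ _ => zero_le)
      (Finset.mem_univ b)
  set cost : Fin n → ℝ≥0∞ := fun k => if W k = 1 - W i then edist (X k) (X i) ^ p else ⊤ with hcost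
  -- If some block reaches the truncation level, in particular if it offers no opposite-arm unit and
  -- its infimum is `⊤`, then the radius is at least `R ^ p` and the bound on all distances
  -- suffices.
  by_cases hb : ∃ b : Fin M, (R : ℝ≥0∞) ^ p ≤ (residueBlock n M b \ {i, i'}).inf cost
  · obtain ⟨b, hb⟩ := hb
    have h1 : (R : ℝ≥0∞) ^ p ≤ matchingRadius R M X W i i' := by
      refine le_trans ?_ (hle b)
      simp only [nearestRadius, le_min_iff, le_refl, true_and]
      exact hb
    calc edist (X j) (X i) ^ p ≤ (R : ℝ≥0∞) ^ p := by gcongr; exact hR j i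
      _ ≤ 1 * matchingRadius R M X W i i' := by simpa using h1
      _ ≤ _ := by gcongr
  · push Not at hb
    have hk : ∀ b : Fin M, ∃ k ∈ residueBlock n M b, W k = 1 - W i ∧
        edist (X k) (X i) ^ p ≤ matchingRadius R M X W i i' := fun b => by
      have hne : (residueBlock n M b \ {i, i'}).Nonempty := by
        by_contra hne
        have h1 := hb b
        rw [Finset.not_nonempty_iff_eq_empty.1 hne] at h1
        simp at h1
      obtain ⟨k, hk, hk'⟩ := Finset.exists_mem_eq_inf _ hne cost
      have h1 := hb b
      rw [hk'] at h1
      have hW : W k = 1 - W i := by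
        by_contra h
        simp [hcost, h] at h1
      refine ⟨k, (Finset.mem_sdiff.1 hk).1, hW, ?_⟩
      refine le_trans ?_ (hle b)
      have h2 : edist (X k) (X i) ^ p = (residueBlock n M b \ {i, i'}).inf cost := by
        rw [hk']; simp [hcost, hW]
      simp only [nearestRadius]
      change _ ≤ min _ ((residueBlock n M b \ {i, i'}).inf cost)
      rw [h2, min_eq_right (hb b).le]
    choose k hkb hkW hkT using hk
    have hinj : Function.Injective k := fun b c hbc => by
      have h1 := hkb b
      have h2 := hkb c
      rw [hbc] at h1
      simp only [residueBlock, Finset.mem_filter, Finset.mem_univ, true_and] at h1 h2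
      exact Fin.ext (h1.symm.trans h2)
    rw [matchedSet_eq] at hj
    obtain ⟨hjO, hjr⟩ := Finset.mem_filter.1 hj
    obtain ⟨l, hl, hjl⟩ := exists_le_of_rank_le _ (fun k => matrixNorm V (X k - X i)) M hjO hjr
      (K := Finset.univ.image k) (by
        intro l hl
        obtain ⟨b, -, rfl⟩ := Finset.mem_image.1 hl
        exact mem_oppositeArm.2 (hkW b)) (by
        rw [Finset.card_image_of_injective _ hinj]; simp)
    obtain ⟨b, -, rfl⟩ := Finset.mem_image.1 hl
    calc edist (X j) (X i) ^ p = ‖X j - X i‖ₑ ^ p := by rw [edist_eq_enorm_sub]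
      _ ≤ (κ * ‖X (k b) - X i‖ₑ) ^ p := by gcongr; exact hV _ _ hjl
      _ = (κ : ℝ≥0∞) ^ p * edist (X (k b)) (X i) ^ p := by rw [mul_pow, edist_eq_enorm_sub]
      _ ≤ _ := by gcongr; exact hkT b

end MatchedSet

/-! ### Comparison of the Mahalanobis and Euclidean norms. -/

section Covariance

open Matrix

variable {p n : ℕ}

theorem dotProduct_ofLp (x y : Cov p) : x.ofLp ⬝ᵥ y.ofLp = inner ℝ x y := by
  simp [PiLp.inner_apply, dotProduct, mul_comm]

theorem isUnit_det_of_coercive {S : Matrix (Fin p) (Fin p) ℝ} {l : ℝ} (hl : 0 < l)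
    (h : ∀ v : Cov p, l * ‖v‖ ^ 2 ≤ v.ofLp ⬝ᵥ S *ᵥ v.ofLp) : IsUnit S.det := by
  rw [← Matrix.isUnit_iff_isUnit_det, ← Matrix.mulVec_injective_iff_isUnit]
  intro a b hab
  have h0 : S *ᵥ (a - b) = 0 := by rw [mulVec_sub, sub_eq_zero]; exact hab
  have h1 := h (WithLp.toLp 2 (a - b))
  simp only [h0, dotProduct_zero] at h1
  have h2 : ‖WithLp.toLp 2 (a - b)‖ = 0 := by
    by_contra hne
    have : 0 < ‖WithLp.toLp 2 (a - b)‖ := lt_of_le_of_ne (norm_nonneg _) (Ne.symm hne)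
    have : 0 < l * ‖WithLp.toLp 2 (a - b)‖ ^ 2 := by positivity
    linarith
  have h3 := norm_eq_zero.1 h2
  have h4 : a - b = 0 := by simpa using congrArg WithLp.ofLp h3
  exact sub_eq_zero.1 h4

theorem matrixNorm_inv_sq {S : Matrix (Fin p) (Fin p) ℝ} {l : ℝ} (hl : 0 < l)
    (h : ∀ v : Cov p, l * ‖v‖ ^ 2 ≤ v.ofLp ⬝ᵥ S *ᵥ v.ofLp) (u : Cov p) :
    matrixNorm S⁻¹ u ^ 2 = u.ofLp ⬝ᵥ S⁻¹ *ᵥ u.ofLp := by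
  have hu := isUnit_det_of_coercive hl h
  have h1 := h (WithLp.toLp 2 (S⁻¹ *ᵥ u.ofLp))
  simp only [Matrix.mulVec_mulVec, Matrix.mul_nonsing_inv _ hu, Matrix.one_mulVec] at h1
  rw [matrixNorm, Real.sq_sqrt]
  rw [dotProduct_comm]
  exact le_trans (by positivity) h1

/-- With `v = S⁻¹ u` the squared norm is `⟨u, v⟩ = vᵀ S v`, so bounds on `S` transfer to its inverse
without diagonalisation. -/
theorem matrixNorm_inv_bounds {S : Matrix (Fin p) (Fin p) ℝ} {l L : ℝ} (hl : 0 < l) (hL : 0 < L)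
    (h : ∀ v : Cov p, l * ‖v‖ ^ 2 ≤ v.ofLp ⬝ᵥ S *ᵥ v.ofLp)
    (h' : ∀ v : Cov p, ‖WithLp.toLp 2 (S *ᵥ v.ofLp)‖ ≤ L * ‖v‖) (u : Cov p) :
    matrixNorm S⁻¹ u ^ 2 ≤ ‖u‖ ^ 2 / l ∧ l / L ^ 2 * ‖u‖ ^ 2 ≤ matrixNorm S⁻¹ u ^ 2 := by
  have hu := isUnit_det_of_coercive hl h
  set v : Cov p := WithLp.toLp 2 (S⁻¹ *ᵥ u.ofLp) with hv
  have hSv : S *ᵥ v.ofLp = u.ofLp := by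
    simp [hv, Matrix.mulVec_mulVec, Matrix.mul_nonsing_inv _ hu]
  have hq : u.ofLp ⬝ᵥ S⁻¹ *ᵥ u.ofLp = inner ℝ u v := by
    rw [← dotProduct_ofLp]
  have h1 : l * ‖v‖ ^ 2 ≤ inner ℝ u v := by
    have := h v
    rwa [hSv, dotProduct_ofLp, real_inner_comm] at this
  have h2 : ‖u‖ ≤ L * ‖v‖ := by
    have := h' v
    rwa [hSv] at this
  have h3 : (inner ℝ u v : ℝ) ≤ ‖u‖ * ‖v‖ := real_inner_le_norm u v
  have hsq : matrixNorm S⁻¹ u ^ 2 = inner ℝ u v := (matrixNorm_inv_sq hl h u).trans hq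
  have hun := norm_nonneg u
  have hvn := norm_nonneg v
  rw [hsq]
  constructor
  · have h4 : l * ‖v‖ ≤ ‖u‖ := by
      by_contra hc
      push Not at hc
      have hvp : 0 < ‖v‖ := by
        by_contra hv0
        have : ‖v‖ = 0 := le_antisymm (not_lt.1 hv0) hvn
        rw [this, mul_zero] at hc
        linarith
      nlinarith
    rw [le_div_iff₀ hl]
    nlinarith
  · have h5 : ‖u‖ ^ 2 ≤ L ^ 2 * ‖v‖ ^ 2 := by
      rw [← mul_pow]; exact pow_le_pow_left₀ hun h2 2
    calc l / L ^ 2 * ‖u‖ ^ 2 ≤ l / L ^ 2 * (L ^ 2 * ‖v‖ ^ 2) := by gcongr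
      _ = l * ‖v‖ ^ 2 := by field_simp
      _ ≤ _ := h1

theorem enorm_le_of_matrixNorm_inv_le {S : Matrix (Fin p) (Fin p) ℝ} {l L : ℝ≥0} (hl : 0 < l)
    (hL : 0 < L) (h : ∀ v : Cov p, l * ‖v‖ ^ 2 ≤ v.ofLp ⬝ᵥ S *ᵥ v.ofLp)
    (h' : ∀ v : Cov p, ‖WithLp.toLp 2 (S *ᵥ v.ofLp)‖ ≤ L * ‖v‖) (a b : Cov p)
    (hab : matrixNorm S⁻¹ a ≤ matrixNorm S⁻¹ b) : ‖a‖ₑ ≤ (L / l : ℝ≥0) * ‖b‖ₑ := by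
  have hl' : (0 : ℝ) < l := hl
  have hL' : (0 : ℝ) < L := hL
  have h1 := (matrixNorm_inv_bounds hl' hL' h h' a).2
  have h2 := (matrixNorm_inv_bounds hl' hL' h h' b).1
  have h3 : matrixNorm S⁻¹ a ^ 2 ≤ matrixNorm S⁻¹ b ^ 2 :=
    pow_le_pow_left₀ (Real.sqrt_nonneg _) hab 2
  have h4 : ‖a‖ ^ 2 ≤ (L / l * ‖b‖) ^ 2 := by
    have h5 : (l : ℝ) / L ^ 2 * ‖a‖ ^ 2 ≤ ‖b‖ ^ 2 / l := h1.trans (h3.trans h2)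
    rw [div_mul_eq_mul_div, div_le_div_iff₀ (by positivity) hl'] at h5
    rw [mul_pow, div_pow, div_mul_eq_mul_div, le_div_iff₀ (by positivity)]
    linarith
  have h6 : ‖a‖ ≤ L / l * ‖b‖ := le_of_sq_le_sq h4 (by positivity)
  rw [← ofReal_norm, ← ofReal_norm, ← ENNReal.ofReal_coe_nnreal, ← ENNReal.ofReal_mul (by positivity)]
  exact ENNReal.ofReal_le_ofReal (by simpa using h6)

theorem sampleCov_mulVec (X : Fin n → Cov p) (v : Cov p) :
    sampleCov X *ᵥ v.ofLp =
      ((n : ℝ)⁻¹ • ∑ i, (inner ℝ (X i - sampleMean X) v : ℝ) • (X i - sampleMean X)).ofLp := by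
  rw [sampleCov, Matrix.smul_mulVec, Matrix.sum_mulVec]
  simp only [WithLp.ofLp_smul, WithLp.ofLp_sum]
  congr 1
  refine Finset.sum_congr rfl fun i _ => ?_
  rw [Matrix.vecMulVec_mulVec, ← dotProduct_ofLp]
  ext a
  simp [mul_comm]

theorem norm_sub_sampleMean_le {X : Fin n → Cov p} {R : ℝ} (hR : ∀ i j, ‖X i - X j‖ ≤ R)
    (i : Fin n) : ‖X i - sampleMean X‖ ≤ R := by
  have hn : (0 : ℝ) < n := by exact_mod_cast i.pos
  have : X i - sampleMean X = (n : ℝ)⁻¹ • ∑ j, (X i - X j) := by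
    rw [sampleMean, Finset.sum_sub_distrib, smul_sub]
    simp [← Nat.cast_smul_eq_nsmul ℝ, smul_smul, hn.ne']
  rw [this, norm_smul, Real.norm_of_nonneg (by positivity)]
  calc (n : ℝ)⁻¹ * ‖∑ j, (X i - X j)‖ ≤ (n : ℝ)⁻¹ * ∑ j : Fin n, R := by
        gcongr
        exact (norm_sum_le _ _).trans (Finset.sum_le_sum fun j _ => hR i j)
    _ = R := by simp [hn.ne']

/-- Each centred point has norm at most `R`, being an average of differences, so each rank-one term
has operator norm at most `R ^ 2`. -/
theorem norm_sampleCov_mulVec_le {X : Fin n → Cov p} {R : ℝ} (hR : ∀ i j, ‖X i - X j‖ ≤ R)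
    (v : Cov p) : ‖WithLp.toLp 2 (sampleCov X *ᵥ v.ofLp)‖ ≤ R ^ 2 * ‖v‖ := by
  rw [sampleCov_mulVec]
  simp only [WithLp.toLp_ofLp]
  rcases Nat.eq_zero_or_pos n with rfl | hn
  · simp; positivity
  have hn : (0 : ℝ) < n := by exact_mod_cast hn
  rw [norm_smul, Real.norm_of_nonneg (by positivity)]
  calc (n : ℝ)⁻¹ * ‖∑ i, (inner ℝ (X i - sampleMean X) v : ℝ) • (X i - sampleMean X)‖
      ≤ (n : ℝ)⁻¹ * ∑ j : Fin n, R ^ 2 * ‖v‖ := by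
        gcongr
        refine (norm_sum_le _ _).trans (Finset.sum_le_sum fun j _ => ?_)
        have h1 := norm_sub_sampleMean_le hR j
        have h2 := norm_inner_le_norm (𝕜 := ℝ) (X j - sampleMean X) v
        have h0 := norm_nonneg (X j - sampleMean X)
        rw [norm_smul]
        calc _ ≤ (‖X j - sampleMean X‖ * ‖v‖) * ‖X j - sampleMean X‖ := by gcongr
          _ ≤ (R * ‖v‖) * R := by
            have : 0 ≤ R * ‖v‖ := mul_nonneg (h0.trans h1) (norm_nonneg v)
            gcongr
          _ = _ := by ring
    _ = R ^ 2 * ‖v‖ := by simp [hn.ne']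

end Covariance

/-! ### Measurability of the inverse matrix and of the norm it defines. -/

section MatrixMeasurability

variable {Ω : Type*} [MeasurableSpace Ω] {p : ℕ}

theorem measurable_matrix_det {A : Ω → Matrix (Fin p) (Fin p) ℝ}
    (hA : ∀ a b, Measurable fun ω => A ω a b) : Measurable fun ω => (A ω).det := by
  simp only [Matrix.det_apply']
  fun_prop

/-- Cramer's rule, with the convention that the inverse of a zero determinant is zero; hence no
invertibility is needed. -/
theorem measurable_matrix_inv {A : Ω → Matrix (Fin p) (Fin p) ℝ}
    (hA : ∀ a b, Measurable fun ω => A ω a b) (a b : Fin p) :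
    Measurable fun ω => (A ω)⁻¹ a b := by
  simp only [Matrix.inv_def, Ring.inverse_eq_inv', Matrix.smul_apply, smul_eq_mul,
    Matrix.adjugate_apply]
  refine (measurable_matrix_det hA).inv.mul (measurable_matrix_det fun c d => ?_)
  by_cases h : c = b
  · subst h; simp
  · simpa [Matrix.updateRow_ne h] using hA c d

theorem measurable_dotProduct_inv_mulVec {A : Ω → Matrix (Fin p) (Fin p) ℝ}
    (hA : ∀ a b, Measurable fun ω => A ω a b) {u v : Ω → Cov p} (hu : Measurable u)
    (hv : Measurable v) : Measurable fun ω => (u ω).ofLp ⬝ᵥ (A ω)⁻¹.mulVec (v ω).ofLp := by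
  have h := measurable_matrix_inv hA
  have hu' : ∀ a, Measurable fun ω => (u ω).ofLp a := fun a => by fun_prop
  have hv' : ∀ a, Measurable fun ω => (v ω).ofLp a := fun a => by fun_prop
  simp only [dotProduct, Matrix.mulVec]
  exact Finset.measurable_fun_sum _ fun a _ => (hu' a).mul <|
    Finset.measurable_fun_sum _ fun b _ => (h a b).mul (hv' b)

theorem measurable_matrixNorm_inv {A : Ω → Matrix (Fin p) (Fin p) ℝ}
    (hA : ∀ a b, Measurable fun ω => A ω a b) {u : Ω → Cov p} (hu : Measurable u) :
    Measurable fun ω => matrixNorm (A ω)⁻¹ (u ω) :=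
  (measurable_dotProduct_inv_mulVec hA hu hu).sqrt

theorem measurable_sampleCov {n : ℕ} {X : Ω → Fin n → Cov p} (hX : ∀ i, Measurable fun ω => X ω i)
    (a b : Fin p) : Measurable fun ω => sampleCov (X ω) a b := by
  simp only [sampleCov, sampleMean, Matrix.smul_apply, Matrix.sum_apply, Matrix.vecMulVec_apply,
    WithLp.ofLp_sub, Pi.sub_apply, WithLp.ofLp_smul, Pi.smul_apply, WithLp.ofLp_sum,
    Finset.sum_apply]
  fun_prop

end MatrixMeasurability

/-! ### Almost sure absence of ties in the Mahalanobis distance. -/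

section Ties

open Matrix

variable {p n : ℕ}

/-- The mean of all sample points except `X i`. -/
def othersMean (X : Fin n → Cov p) (i : Fin n) : Cov p :=
  ((n : ℝ) - 1)⁻¹ • ∑ l ∈ Finset.univ.erase i, X l

/-- The scatter matrix of all sample points except `X i`. -/
def othersScatter (X : Fin n → Cov p) (i : Fin n) : Matrix (Fin p) (Fin p) ℝ :=
  ∑ l ∈ Finset.univ.erase i, vecMulVec (X l - othersMean X i).ofLp (X l - othersMean X i).ofLp

theorem othersMean_update (X : Fin n → Cov p) (i : Fin n) (y : Cov p) :
    othersMean (Function.update X i y) i = othersMean X i := by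
  unfold othersMean
  congr 1
  refine Finset.sum_congr rfl fun l hl => ?_
  rw [Function.update_of_ne (Finset.ne_of_mem_erase hl)]

theorem othersScatter_update (X : Fin n → Cov p) (i : Fin n) (y : Cov p) :
    othersScatter (Function.update X i y) i = othersScatter X i := by
  unfold othersScatter
  refine Finset.sum_congr rfl fun l hl => ?_
  rw [Function.update_of_ne (Finset.ne_of_mem_erase hl), othersMean_update]

theorem sum_centered_mul_centered {ι : Type*} (s : Finset ι) (f g : ι → ℝ) {c : ℝ}
    (hc : c = s.card) (hc0 : c ≠ 0) :
    ∑ l ∈ s, (f l - c⁻¹ * ∑ k ∈ s, f k) * (g l - c⁻¹ * ∑ k ∈ s, g k) =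
      ∑ l ∈ s, f l * g l - c⁻¹ * (∑ k ∈ s, f k) * ∑ k ∈ s, g k := by
  simp only [sub_mul, mul_sub, Finset.sum_sub_distrib, ← Finset.sum_mul, ← Finset.mul_sum,
    Finset.sum_const, nsmul_eq_mul, ← hc]
  field_simp
  ring

/-- This isolates the dependence on `X i`: the mean and scatter of the other points do not involve
it, so only a rank-one term moves. -/
theorem smul_sampleCov_eq (X : Fin n → Cov p) (i : Fin n) (hn : 2 ≤ n) :
    (n : ℝ) • sampleCov X = othersScatter X i + (((n : ℝ) - 1) / n) •
      vecMulVec (X i - othersMean X i).ofLp (X i - othersMean X i).ofLp := by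
  have hn0 : (n : ℝ) ≠ 0 := by positivity
  have hn2 : (2 : ℝ) ≤ n := by exact_mod_cast hn
  have hn1 : (n : ℝ) - 1 ≠ 0 := by linarith
  have hcard : (n : ℝ) - 1 = (Finset.univ.erase i).card := by
    rw [Finset.card_erase_of_mem (Finset.mem_univ i)]
    simp [Nat.cast_sub (by omega : 1 ≤ n)]
  ext a b
  have h1 := sum_centered_mul_centered Finset.univ (fun l => X l a) (fun l => X l b)
    (c := (n : ℝ)) (by simp) hn0
  have h2 := sum_centered_mul_centered (Finset.univ.erase i) (fun l => X l a) (fun l => X l b)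
    hcard hn1
  simp only [sampleCov, sampleMean, othersScatter, othersMean, Matrix.smul_apply, Matrix.add_apply,
    Matrix.sum_apply, Matrix.vecMulVec_apply,
    WithLp.ofLp_sub, Pi.sub_apply, WithLp.ofLp_smul, Pi.smul_apply, WithLp.ofLp_sum,
    Finset.sum_apply, smul_eq_mul]
  rw [h1, h2, ← Finset.add_sum_erase _ _ (Finset.mem_univ i),
    ← Finset.add_sum_erase _ (fun l => X l a) (Finset.mem_univ i),
    ← Finset.add_sum_erase _ (fun l => X l b) (Finset.mem_univ i)]
  field_simp
  ring

theorem norm_sub_othersMean_le {X : Fin n → Cov p} {R : ℝ} (hR : ∀ i j, ‖X i - X j‖ ≤ R)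
    (i : Fin n) (hn : 2 ≤ n) : ‖X i - othersMean X i‖ ≤ R := by
  have hn2 : (2 : ℝ) ≤ n := by exact_mod_cast hn
  have hn1 : 0 < (n : ℝ) - 1 := by linarith
  have hcard : ((Finset.univ.erase i).card : ℝ) = (n : ℝ) - 1 := by
    rw [Finset.card_erase_of_mem (Finset.mem_univ i)]
    simp [Nat.cast_sub (by omega : 1 ≤ n)]
  have : X i - othersMean X i = ((n : ℝ) - 1)⁻¹ • ∑ j ∈ Finset.univ.erase i, (X i - X j) := by
    rw [othersMean, Finset.sum_sub_distrib, smul_sub, Finset.sum_const,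
      ← Nat.cast_smul_eq_nsmul ℝ, smul_smul, hcard, inv_mul_cancel₀ hn1.ne', one_smul]
  rw [this, norm_smul, Real.norm_of_nonneg (by positivity)]
  calc ((n : ℝ) - 1)⁻¹ * ‖∑ j ∈ Finset.univ.erase i, (X i - X j)‖
      ≤ ((n : ℝ) - 1)⁻¹ * ∑ j ∈ Finset.univ.erase i, R := by
        gcongr
        exact (norm_sum_le _ _).trans (Finset.sum_le_sum fun j _ => hR i j)
    _ = R := by rw [Finset.sum_const, nsmul_eq_mul, hcard]; field_simp

/-- The rank-one term removed from `n` times the sample covariance contributes at most `R ^ 2 * ‖v‖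
^ 2`. For `n * l > R ^ 2` the scatter of the others is therefore still invertible. -/
theorem othersScatter_coercive {X : Fin n → Cov p} {R l : ℝ} (hR : ∀ i j, ‖X i - X j‖ ≤ R)
    (hS : ∀ v : Cov p, l * ‖v‖ ^ 2 ≤ v.ofLp ⬝ᵥ sampleCov X *ᵥ v.ofLp) (i : Fin n) (hn : 2 ≤ n)
    (v : Cov p) :
    (n * l - R ^ 2) * ‖v‖ ^ 2 ≤ v.ofLp ⬝ᵥ othersScatter X i *ᵥ v.ofLp := by
  have hn2 : (2 : ℝ) ≤ n := by exact_mod_cast hn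
  have h1 := congrArg (fun S => v.ofLp ⬝ᵥ S *ᵥ v.ofLp) (smul_sampleCov_eq X i hn)
  simp only [Matrix.smul_mulVec, Matrix.add_mulVec, dotProduct_smul, dotProduct_add,
    Matrix.vecMulVec_mulVec, smul_eq_mul] at h1
  have h2 : MulOpposite.op ((X i - othersMean X i).ofLp ⬝ᵥ v.ofLp) •
      (v.ofLp ⬝ᵥ (X i - othersMean X i).ofLp) = (inner ℝ (X i - othersMean X i) v : ℝ) ^ 2 := by
    rw [← dotProduct_ofLp, dotProduct_comm v.ofLp, sq]
    simp
  rw [h2] at h1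
  have h3 : (inner ℝ (X i - othersMean X i) v : ℝ) ^ 2 ≤ R ^ 2 * ‖v‖ ^ 2 := by
    rw [← mul_pow, ← sq_abs (inner ℝ _ _)]
    refine pow_le_pow_left₀ (abs_nonneg _) ((abs_real_inner_le_norm _ _).trans ?_) 2
    gcongr
    exact norm_sub_othersMean_le hR i hn
  have h4 : ((n : ℝ) - 1) / n ≤ 1 := by rw [div_le_one (by linarith)]; linarith
  have h5 : ((n : ℝ) - 1) / n * (inner ℝ (X i - othersMean X i) v : ℝ) ^ 2 ≤ R ^ 2 * ‖v‖ ^ 2 :=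
    (mul_le_of_le_one_left (sq_nonneg _) h4).trans h3
  have h6 := mul_le_mul_of_nonneg_left (hS v) (by linarith : (0 : ℝ) ≤ n)
  nlinarith

/-- The linear and constant parts of the tie polynomial are governed by `u' = A⁻¹ u`. -/
theorem tie_polynomial_eq_zero {S A : Matrix (Fin p) (Fin p) ℝ} {c : ℝ} {y u w : Cov p}
    (hS : IsUnit S.det) (hA : IsUnit A.det)
    (hSA : S = A + c • vecMulVec y.ofLp y.ofLp)
    (htie : (w - (2 : ℝ) • y).ofLp ⬝ᵥ S⁻¹ *ᵥ u.ofLp = 0) :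
    w.ofLp ⬝ᵥ A⁻¹ *ᵥ u.ofLp + -2 * (y.ofLp ⬝ᵥ A⁻¹ *ᵥ u.ofLp) +
      c * ((w.ofLp ⬝ᵥ A⁻¹ *ᵥ u.ofLp) * (y.ofLp ⬝ᵥ A⁻¹ *ᵥ y.ofLp) -
        (y.ofLp ⬝ᵥ A⁻¹ *ᵥ u.ofLp) * (w.ofLp ⬝ᵥ A⁻¹ *ᵥ y.ofLp)) = 0 := by
  set r := S⁻¹ *ᵥ u.ofLp with hr
  -- The rank-one system is solved in the spirit of Sherman–Morrison, keeping `t = y ⬝ᵥ r` as an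
  -- unknown scalar. Pairing the solution with `y` and with `w` gives two relations in `t`;
  -- eliminating `t` leaves a polynomial identity free of denominators such as `1 + c * q`.
  have h1 : A *ᵥ r + (c * (y.ofLp ⬝ᵥ r)) • y.ofLp = u.ofLp := by
    have : S *ᵥ r = u.ofLp := by
      rw [hr, Matrix.mulVec_mulVec, Matrix.mul_nonsing_inv _ hS, Matrix.one_mulVec]
    rw [hSA, Matrix.add_mulVec, Matrix.smul_mulVec, Matrix.vecMulVec_mulVec] at this
    rw [← this]
    congr 1
    ext a
    simp
    ring
  have h2 : r = A⁻¹ *ᵥ u.ofLp - (c * (y.ofLp ⬝ᵥ r)) • A⁻¹ *ᵥ y.ofLp := by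
    rw [← Matrix.mulVec_smul, ← Matrix.mulVec_sub, ← h1, add_sub_cancel_right,
      Matrix.mulVec_mulVec, Matrix.nonsing_inv_mul _ hA, Matrix.one_mulVec]
  set t := y.ofLp ⬝ᵥ r
  have hy : t = y.ofLp ⬝ᵥ A⁻¹ *ᵥ u.ofLp - c * t * (y.ofLp ⬝ᵥ A⁻¹ *ᵥ y.ofLp) := by
    have := congrArg (fun q => y.ofLp ⬝ᵥ q) h2
    simpa [dotProduct_sub, dotProduct_smul] using this
  have hw : w.ofLp ⬝ᵥ r = w.ofLp ⬝ᵥ A⁻¹ *ᵥ u.ofLp - c * t * (w.ofLp ⬝ᵥ A⁻¹ *ᵥ y.ofLp) := by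
    have := congrArg (fun q => w.ofLp ⬝ᵥ q) h2
    simpa [dotProduct_sub, dotProduct_smul] using this
  have h3 : w.ofLp ⬝ᵥ r = 2 * t := by
    simp only [WithLp.ofLp_sub, WithLp.ofLp_smul, sub_dotProduct, smul_dotProduct,
      smul_eq_mul] at htie
    linarith
  set α := w.ofLp ⬝ᵥ A⁻¹ *ᵥ u.ofLp
  set a := y.ofLp ⬝ᵥ A⁻¹ *ᵥ u.ofLp
  set q := y.ofLp ⬝ᵥ A⁻¹ *ᵥ y.ofLp
  set b := w.ofLp ⬝ᵥ A⁻¹ *ᵥ y.ofLp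
  have e1 : a = t + c * t * q := by linarith
  have e2 : α = 2 * t + c * t * b := by linarith
  rw [e1, e2]
  ring

/-- The linear part is `y ↦ -2 yᵀ A⁻¹ u`, which is nonzero at `y = A⁻¹ u`; the terms multiplied by
`c` are homogeneous of degree two. -/
theorem volume_tie_polynomial_zeros {A : Matrix (Fin p) (Fin p) ℝ} (hA : IsUnit A.det) (c : ℝ)
    {u : Cov p} (hu : u ≠ 0) (w : Cov p) :
    volume {y : Cov p | w.ofLp ⬝ᵥ A⁻¹ *ᵥ u.ofLp + -2 * (y.ofLp ⬝ᵥ A⁻¹ *ᵥ u.ofLp) +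
      c * ((w.ofLp ⬝ᵥ A⁻¹ *ᵥ u.ofLp) * (y.ofLp ⬝ᵥ A⁻¹ *ᵥ y.ofLp) -
        (y.ofLp ⬝ᵥ A⁻¹ *ᵥ u.ofLp) * (w.ofLp ⬝ᵥ A⁻¹ *ᵥ y.ofLp)) = 0} = 0 := by
  have hAu : A⁻¹ *ᵥ u.ofLp ≠ 0 := fun h => hu <| by
    have : A *ᵥ (A⁻¹ *ᵥ u.ofLp) = u.ofLp := by
      rw [Matrix.mulVec_mulVec, Matrix.mul_nonsing_inv _ hA, Matrix.one_mulVec]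
    rw [h, Matrix.mulVec_zero] at this
    exact (WithLp.ofLp_injective 2 this).symm
  let β : Cov p →ₗ[ℝ] ℝ :=
    { toFun := fun y => -2 * (y.ofLp ⬝ᵥ A⁻¹ *ᵥ u.ofLp)
      map_add' := fun x y => by simp only [WithLp.ofLp_add, add_dotProduct]; ring
      map_smul' := fun r y => by
        simp only [WithLp.ofLp_smul, smul_dotProduct, smul_eq_mul, RingHom.id_apply]; ring }
  let γ : Cov p →ₗ[ℝ] Cov p →ₗ[ℝ] ℝ := LinearMap.mk₂ ℝ
    (fun y y' => c * ((w.ofLp ⬝ᵥ A⁻¹ *ᵥ u.ofLp) * (y.ofLp ⬝ᵥ A⁻¹ *ᵥ y'.ofLp) -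
        (y.ofLp ⬝ᵥ A⁻¹ *ᵥ u.ofLp) * (w.ofLp ⬝ᵥ A⁻¹ *ᵥ y'.ofLp)))
    (fun x y z => by simp only [WithLp.ofLp_add, add_dotProduct]; ring)
    (fun r y z => by simp only [WithLp.ofLp_smul, smul_dotProduct, smul_eq_mul]; ring)
    (fun x y z => by simp only [WithLp.ofLp_add, Matrix.mulVec_add, dotProduct_add]; ring)
    (fun r y z => by
      simp only [WithLp.ofLp_smul, Matrix.mulVec_smul, dotProduct_smul, smul_eq_mul]; ring)
  refine volume_quadratic_zeros (w.ofLp ⬝ᵥ A⁻¹ *ᵥ u.ofLp) β ?_ γ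
  intro h
  have h1 := LinearMap.congr_fun h (WithLp.toLp 2 (A⁻¹ *ᵥ u.ofLp))
  have h2 : (A⁻¹ *ᵥ u.ofLp) ⬝ᵥ (A⁻¹ *ᵥ u.ofLp) = 0 := by
    have : -2 * ((A⁻¹ *ᵥ u.ofLp) ⬝ᵥ (A⁻¹ *ᵥ u.ofLp)) = 0 := h1
    linarith
  exact hAu (dotProduct_self_eq_zero.1 h2)

theorem measurable_othersMean (i : Fin n) : Measurable fun X : Fin n → Cov p => othersMean X i := by
  unfold othersMean
  fun_prop

theorem measurable_othersScatter (i : Fin n) (a b : Fin p) :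
    Measurable fun X : Fin n → Cov p => othersScatter X i a b := by
  have := measurable_othersMean (p := p) i
  simp only [othersScatter, Matrix.sum_apply, Matrix.vecMulVec_apply, WithLp.ofLp_sub,
    Pi.sub_apply]
  fun_prop

theorem transpose_sampleCov (X : Fin n → Cov p) : (sampleCov X)ᵀ = sampleCov X := by
  ext a b
  simp [sampleCov, Matrix.sum_apply, Matrix.vecMulVec_apply, mul_comm]

variable {E : Type*} [MeasurableSpace E] (Q : Measure E) [IsProbabilityMeasure Q] {ξ : E → Cov p}

theorem ae_ne_of_null (hξ : Measurable ξ)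
    (hQ : ∀ B : Set (Cov p), MeasurableSet B → volume B = 0 → Q (ξ ⁻¹' B) = 0) (hp : 1 ≤ p)
    {j k : Fin n} (hjk : j ≠ k) :
    ∀ᵐ z ∂(Measure.pi fun _ : Fin n => Q), ξ (z j) ≠ ξ (z k) := by
  have : Nonempty (Fin p) := ⟨⟨0, hp⟩⟩
  have hm : MeasurableSet {z : Fin n → E | ξ (z j) = ξ (z k)} :=
    measurableSet_eq_fun (hξ.comp (measurable_pi_apply j)) (hξ.comp (measurable_pi_apply k))
  rw [ae_iff]
  simp only [ne_eq, not_not]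
  rw [measure_pi_eq_lintegral_update Q j hm]
  refine (lintegral_congr fun z => ?_).trans lintegral_zero
  have : {y | Function.update z j y ∈ {z : Fin n → E | ξ (z j) = ξ (z k)}} =
      ξ ⁻¹' {ξ (z k)} := by
    ext y
    simp [Function.update_of_ne hjk.symm]
  rw [this]
  exact hQ _ (measurableSet_singleton _) (by simp)

/-- The metric itself varies with `X i`, so a tie is not simply membership of a fixed bisector. The
rank-one form of the covariance makes the tie equation quadratic in `X i` once the other points are
frozen. -/
theorem ae_no_tie (hξ : Measurable ξ)
    (hQ : ∀ B : Set (Cov p), MeasurableSet B → volume B = 0 → Q (ξ ⁻¹' B) = 0) (hp : 1 ≤ p)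
    {R l : ℝ} (hl : 0 < l) (hn : R ^ 2 < n * l) {i j k : Fin n} (hjk : j ≠ k) (hij : i ≠ j)
    (hik : i ≠ k) :
    ∀ᵐ z ∂(Measure.pi fun _ : Fin n => Q), (∀ i j, ‖ξ (z i) - ξ (z j)‖ ≤ R) →
      (∀ v : Cov p, l * ‖v‖ ^ 2 ≤ v.ofLp ⬝ᵥ sampleCov (fun i => ξ (z i)) *ᵥ v.ofLp) →
      matrixNorm (mahalanobis fun i => ξ (z i)) (ξ (z j) - ξ (z i)) ≠
        matrixNorm (mahalanobis fun i => ξ (z i)) (ξ (z k) - ξ (z i)) := by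
  have hn2 : 2 ≤ n := by
    have h1 := i.isLt
    have h2 := j.isLt
    have h3 : i.val ≠ j.val := fun h => hij (Fin.ext h)
    omega
  set x : (Fin n → E) → Fin n → Cov p := fun z i => ξ (z i) with hx
  have hxm : ∀ i, Measurable fun z => x z i := fun i => hξ.comp (measurable_pi_apply i)
  have hxm' : Measurable x := measurable_pi_iff.2 hxm
  set c : ℝ := ((n : ℝ) - 1) / n
  set pol : (Fin n → E) → Cov p → ℝ := fun z y =>
    let A := othersScatter (x z) i
    let u := x z j - x z k
    let w := x z j + x z k - (2 : ℝ) • othersMean (x z) i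
    w.ofLp ⬝ᵥ A⁻¹ *ᵥ u.ofLp + -2 * (y.ofLp ⬝ᵥ A⁻¹ *ᵥ u.ofLp) +
      c * ((w.ofLp ⬝ᵥ A⁻¹ *ᵥ u.ofLp) * (y.ofLp ⬝ᵥ A⁻¹ *ᵥ y.ofLp) -
        (y.ofLp ⬝ᵥ A⁻¹ *ᵥ u.ofLp) * (w.ofLp ⬝ᵥ A⁻¹ *ᵥ y.ofLp)) with hpol
  -- Here `X i` enters only as the last argument of `pol`, the other data being leave-one-out
  -- quantities. Each fibre over the remaining points is therefore empty or a translate of the zero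
  -- set of one fixed polynomial.
  set Bad : Set (Fin n → E) := {z | x z j ≠ x z k ∧ (othersScatter (x z) i).det ≠ 0 ∧
    pol z (x z i - othersMean (x z) i) = 0} with hBad
  have hAm : ∀ a b, Measurable fun z => othersScatter (x z) i a b := fun a b =>
    (measurable_othersScatter i a b).comp hxm'
  have hmm : Measurable fun z => othersMean (x z) i := (measurable_othersMean i).comp hxm'
  have hBm : MeasurableSet Bad := by
    refine ((measurableSet_eq_fun (hxm j) (hxm k)).compl).inter
      (((measurableSet_eq_fun (measurable_matrix_det hAm) measurable_const).compl).inter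
      (measurableSet_eq_fun ?_ measurable_const))
    have hu : Measurable fun z => x z j - x z k := (hxm j).sub (hxm k)
    have hw : Measurable fun z => x z j + x z k - (2 : ℝ) • othersMean (x z) i :=
      ((hxm j).add (hxm k)).sub (hmm.const_smul (2 : ℝ))
    have hy : Measurable fun z => x z i - othersMean (x z) i := (hxm i).sub hmm
    exact ((measurable_dotProduct_inv_mulVec hAm hw hu).add
      ((measurable_dotProduct_inv_mulVec hAm hy hu).const_mul _)).add
      ((((measurable_dotProduct_inv_mulVec hAm hw hu).mul
        (measurable_dotProduct_inv_mulVec hAm hy hy)).sub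
        ((measurable_dotProduct_inv_mulVec hAm hy hu).mul
        (measurable_dotProduct_inv_mulVec hAm hw hy))).const_mul _)
  have hBad0 : (Measure.pi fun _ : Fin n => Q) Bad = 0 := by
    rw [measure_pi_eq_lintegral_update Q i hBm]
    refine (lintegral_congr fun z => ?_).trans lintegral_zero
    have hupd : ∀ y, x (Function.update z i y) = Function.update (x z) i (ξ y) := fun y => by
      ext1 l
      by_cases h : l = i
      · subst h; simp [hx]
      · simp [hx, Function.update_of_ne h]
    have hset : {y | Function.update z i y ∈ Bad} = ξ ⁻¹' {s | x z j ≠ x z k ∧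
        (othersScatter (x z) i).det ≠ 0 ∧ pol z (s - othersMean (x z) i) = 0} := by
      ext y
      simp only [hBad, hpol, Set.mem_ofPred_eq, Set.mem_preimage, hupd, othersScatter_update,
        othersMean_update, Function.update_of_ne hij.symm, Function.update_of_ne hik.symm,
        Function.update_self]
    rw [hset]
    by_cases hjk' : x z j = x z k
    · simp [hjk']
    by_cases hdet : (othersScatter (x z) i).det = 0
    · simp [hdet]
    simp only [ne_eq, hjk', hdet, not_false_eq_true, true_and]
    have hpm : Measurable (pol z) := by
      have hc : ∀ a b, Measurable fun _ : Cov p => othersScatter (x z) i a b :=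
        fun a b => measurable_const
      exact (measurable_const.add
        ((measurable_dotProduct_inv_mulVec hc measurable_id measurable_const).const_mul _)).add
        (((measurable_const.mul
          (measurable_dotProduct_inv_mulVec hc measurable_id measurable_id)).sub
        ((measurable_dotProduct_inv_mulVec hc measurable_id measurable_const).mul
        (measurable_dotProduct_inv_mulVec hc measurable_const measurable_id))).const_mul _)
    refine hQ _ ?_ ?_
    · exact measurableSet_eq_fun (hpm.comp (measurable_id.sub_const _)) measurable_const
    · have h0 := volume_tie_polynomial_zeros (A := othersScatter (x z) i)
        (isUnit_iff_ne_zero.2 hdet) c (sub_ne_zero.2 hjk')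
        (x z j + x z k - (2 : ℝ) • othersMean (x z) i)
      have h1 := measure_preimage_add_right volume (-othersMean (x z) i) {y | pol z y = 0}
      simp only [← sub_eq_add_neg] at h1
      exact h1.trans h0
  filter_upwards [measure_eq_zero_iff_ae_notMem.1 hBad0, ae_ne_of_null Q hξ hQ hp hjk]
    with z hz hne hR hS heq
  have hAunit : IsUnit (othersScatter (x z) i).det :=
    isUnit_det_of_coercive (sub_pos.2 hn) (othersScatter_coercive hR hS i hn2)
  have hSunit : IsUnit (sampleCov (x z)).det := isUnit_det_of_coercive hl hS
  refine hz ⟨hne, isUnit_iff_ne_zero.1 hAunit, ?_⟩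
  have hn0 : (n : ℝ) ≠ 0 := by positivity
  have hsq : (x z j - x z i).ofLp ⬝ᵥ (sampleCov (x z))⁻¹ *ᵥ (x z j - x z i).ofLp =
      (x z k - x z i).ofLp ⬝ᵥ (sampleCov (x z))⁻¹ *ᵥ (x z k - x z i).ofLp := by
    rw [← matrixNorm_inv_sq hl hS, ← matrixNorm_inv_sq hl hS]
    exact congrArg (· ^ 2) heq
  have hsym : ∀ a b : Fin p → ℝ, a ⬝ᵥ (sampleCov (x z))⁻¹ *ᵥ b = b ⬝ᵥ (sampleCov (x z))⁻¹ *ᵥ a := by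
    intro a b
    rw [Matrix.dotProduct_mulVec, ← Matrix.mulVec_transpose, Matrix.transpose_nonsing_inv,
      transpose_sampleCov, dotProduct_comm]
  have hSunit' : IsUnit ((n : ℝ) • sampleCov (x z)).det := by
    rw [Matrix.det_smul]
    exact ((isUnit_iff_ne_zero.2 hn0).pow _).mul hSunit
  refine tie_polynomial_eq_zero hSunit' hAunit (smul_sampleCov_eq (x z) i hn2) ?_
  have hinv : ((n : ℝ) • sampleCov (x z))⁻¹ = (n : ℝ)⁻¹ • (sampleCov (x z))⁻¹ := by
    refine Matrix.inv_eq_left_inv ?_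
    rw [Matrix.smul_mul, Matrix.mul_smul, smul_smul, inv_mul_cancel₀ hn0, one_smul,
      Matrix.nonsing_inv_mul _ hSunit]
  -- For a symmetric form, equality of the values at `a = X j - X i` and `b = X k - X i` amounts to
  -- orthogonality of `a + b` and `a - b`; these are `w - 2y` and `u`.
  have hw : x z j + x z k - (2 : ℝ) • othersMean (x z) i -
      (2 : ℝ) • (x z i - othersMean (x z) i) = (x z j - x z i) + (x z k - x z i) := by
    module
  have hu : x z j - x z k = (x z j - x z i) - (x z k - x z i) := by module
  rw [hinv, hw, hu, Matrix.smul_mulVec, dotProduct_smul]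
  simp only [WithLp.ofLp_sub (p := 2) (x z j - x z i), WithLp.ofLp_add, Matrix.mulVec_sub,
    dotProduct_sub, add_dotProduct]
  rw [smul_eq_zero]
  right
  have h3 := hsym (x z j - x z i).ofLp (x z k - x z i).ofLp
  simp only [WithLp.ofLp_sub, Matrix.mulVec_sub, dotProduct_sub] at h3 hsq ⊢
  linarith

end Ties

/-- A law of `(X, W, Y)` with covariates regularly distributed on the compact convex set `X₀`,
overlap, Lipschitz regression functions `m w`, and bounded conditional variance. -/
structure IsRegularLaw {p : ℕ} (Q : Measure (Cov p × Fin 2 × ℝ)) (X₀ : Set (Cov p))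
    (m : Fin 2 → Cov p → ℝ) : Prop where
  convex : Convex ℝ X₀
  isCompact : IsCompact X₀
  mem : ∀ᵐ z ∂Q, z.1 ∈ X₀
  upper : ∃ b : ℝ≥0, ∀ B, MeasurableSet B → Q (Prod.fst ⁻¹' B) ≤ b * volume B
  lower : ∃ a : ℝ≥0, 0 < a ∧ ∀ w B, MeasurableSet B →
    a * volume (B ∩ X₀) ≤ Q {z | z.1 ∈ B ∧ z.2.1 = w}
  lipschitz : ∃ L : ℝ≥0, ∀ w, LipschitzWith L (m w)
  integrable_sq : Integrable (fun z => (z.2.2 - m z.2.1 z.1) ^ 2) Q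
  mean_zero : ∀ φ : Cov p × Fin 2 → ℝ, Measurable φ → (∃ C, ∀ x, |φ x| ≤ C) →
    ∫ z, (z.2.2 - m z.2.1 z.1) * φ (z.1, z.2.1) ∂Q = 0
  variance_le : ∃ C : ℝ≥0, ∀ φ : Cov p × Fin 2 → ℝ≥0∞, Measurable φ →
    ∫⁻ z, ENNReal.ofReal ((z.2.2 - m z.2.1 z.1) ^ 2) * φ (z.1, z.2.1) ∂Q ≤
      C * ∫⁻ z, φ (z.1, z.2.1) ∂Q

/-! ### Volumes of balls inside and around the support. -/

section Geometry

variable {p : ℕ}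

/-- Shrinking `X₀` towards `x` by the factor `r / R` keeps it inside `X₀` by convexity and puts it
inside the ball. The bound is uniform in `x`, boundary points included. -/
theorem volume_closedBall_inter_convex_ge {X₀ : Set (Cov p)} (hc : Convex ℝ X₀) {R r : ℝ}
    (hR : 0 < R) (hdiam : ∀ x ∈ X₀, ∀ y ∈ X₀, dist x y ≤ R) (hr : 0 ≤ r) (hrR : r ≤ R)
    {x : Cov p} (hx : x ∈ X₀) :
    ENNReal.ofReal ((r / R) ^ p) * volume X₀ ≤ volume (Metric.closedBall x r ∩ X₀) := by
  have h := Measure.addHaar_image_homothety volume x (r / R) X₀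
  have h0 : 0 ≤ r / R := by positivity
  rw [finrank_euclideanSpace_fin, abs_of_nonneg (by positivity)] at h
  rw [← h]
  refine measure_mono ?_
  rintro _ ⟨y, hy, rfl⟩
  refine ⟨?_, ?_⟩
  · rw [Metric.mem_closedBall, dist_homothety_center, Real.norm_of_nonneg h0]
    calc r / R * dist x y ≤ r / R * R := by gcongr; exact hdiam x hx y hy
      _ = r := by field_simp
  · have := hc.lineMap_mem hx hy ⟨h0, (div_le_one hR).2 hrR⟩
    rwa [← AffineMap.homothety_eq_lineMap] at this

theorem volume_edist_pow_le (hp : 1 ≤ p) (x : Cov p) {s : ℝ≥0∞} (hs : s ≠ ⊤) :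
    volume {y : Cov p | edist y x ^ p ≤ s} ≤ s * volume (Metric.ball (0 : Cov p) 1) := by
  have hp0 : p ≠ 0 := by omega
  set r : ℝ := s.toReal ^ (p : ℝ)⁻¹ with hr
  have hr0 : 0 ≤ r := Real.rpow_nonneg ENNReal.toReal_nonneg _
  have hrp : r ^ p = s.toReal := Real.rpow_inv_natCast_pow ENNReal.toReal_nonneg hp0
  have hs' : s = ENNReal.ofReal (r ^ p) := by rw [hrp, ENNReal.ofReal_toReal hs]
  have hsub : {y : Cov p | edist y x ^ p ≤ s} ⊆ Metric.closedBall x r := by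
    intro y hy
    simp only [Set.mem_ofPred_eq, hs', edist_dist, ← ENNReal.ofReal_pow dist_nonneg] at hy
    rw [ENNReal.ofReal_le_ofReal_iff (by positivity)] at hy
    exact le_of_pow_le_pow_left₀ hp0 hr0 hy
  refine (measure_mono hsub).trans ?_
  rw [Measure.addHaar_closedBall volume x hr0, finrank_euclideanSpace_fin, ← hs']

end Geometry

namespace IsRegularLaw

variable {p : ℕ} {Q : Measure (Cov p × Fin 2 × ℝ)} {X₀ : Set (Cov p)} {m : Fin 2 → Cov p → ℝ}

theorem null (h : IsRegularLaw Q X₀ m) {B : Set (Cov p)} (hB : MeasurableSet B)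
    (h0 : volume B = 0) : Q (Prod.fst ⁻¹' B) = 0 := by
  obtain ⟨b, hb⟩ := h.upper
  simpa [h0] using hb B hB

theorem exists_diameter (h : IsRegularLaw Q X₀ m) :
    ∃ R : ℝ≥0, 0 < R ∧ ∀ x ∈ X₀, ∀ y ∈ X₀, dist x y ≤ R := by
  obtain ⟨R, hR⟩ := Metric.isBounded_iff.1 h.isCompact.isBounded
  -- The maximum with one makes the diameter bound positive, as it is later a denominator.
  refine ⟨max 1 R.toNNReal, by positivity, fun x hx y hy => (hR hx hy).trans ?_⟩
  exact (Real.le_coe_toNNReal R).trans (by exact_mod_cast le_max_right _ _)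

variable [IsProbabilityMeasure Q]

theorem volume_pos (h : IsRegularLaw Q X₀ m) : 0 < volume X₀ := by
  obtain ⟨b, hb⟩ := h.upper
  have h1 : Q (Prod.fst ⁻¹' X₀) = 1 := by
    rw [← prob_compl_eq_zero_iff (measurable_fst h.isCompact.measurableSet)]
    exact h.mem
  by_contra h0
  have h2 := hb X₀ h.isCompact.measurableSet
  rw [le_antisymm (not_lt.1 h0) bot_le, h1] at h2
  simp at h2

/-- The volume bound on the radius scale `r = t^(1/p)` becomes linear in `t`. The range `t ≤ R ^ p`
is where the shrinking factor is at most one, which is why radii are truncated at `R ^ p`. -/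
theorem exists_ball_lower (h : IsRegularLaw Q X₀ m) (hp : 1 ≤ p) {R : ℝ≥0} (hR : 0 < R)
    (hdiam : ∀ x ∈ X₀, ∀ y ∈ X₀, dist x y ≤ R) :
    ∃ θ : ℝ, 0 < θ ∧ ∀ x ∈ X₀, ∀ w : Fin 2, ∀ t : ℝ, 0 ≤ t → t ≤ (R : ℝ) ^ p →
      θ * t ≤ Q.real {z | z.2.1 = w ∧ edist z.1 x ^ p ≤ ENNReal.ofReal t} := by
  obtain ⟨a, ha, hlow⟩ := h.lower
  have hR' : (0 : ℝ) < R := hR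
  have hv : 0 < volume.real X₀ :=
    ENNReal.toReal_pos h.volume_pos.ne' h.isCompact.measure_lt_top.ne
  refine ⟨a * volume.real X₀ / (R : ℝ) ^ p, by positivity, fun x hx w t ht htR => ?_⟩
  have hp0 : p ≠ 0 := by omega
  set r : ℝ := t ^ (p : ℝ)⁻¹ with hr
  have hr0 : 0 ≤ r := Real.rpow_nonneg ht _
  have hrp : r ^ p = t := Real.rpow_inv_natCast_pow ht hp0
  have hrR : r ≤ R := le_of_pow_le_pow_left₀ hp0 hR'.le (by rwa [hrp])
  have h1 := volume_closedBall_inter_convex_ge h.convex hR' hdiam hr0 hrR hx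
  have h2 := hlow w (Metric.closedBall x r) Metric.isClosed_closedBall.measurableSet
  have h3 : {z : Cov p × Fin 2 × ℝ | z.1 ∈ Metric.closedBall x r ∧ z.2.1 = w} ⊆
      {z | z.2.1 = w ∧ edist z.1 x ^ p ≤ ENNReal.ofReal t} := by
    rintro z ⟨hz1, hz2⟩
    refine ⟨hz2, ?_⟩
    rw [edist_dist, ← ENNReal.ofReal_pow dist_nonneg, ← hrp]
    exact ENNReal.ofReal_le_ofReal (pow_le_pow_left₀ dist_nonneg hz1 p)
  have h4 : a * (ENNReal.ofReal ((r / R) ^ p) * volume X₀) ≤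
      Q {z | z.2.1 = w ∧ edist z.1 x ^ p ≤ ENNReal.ofReal t} :=
    (mul_le_mul_right h1 _).trans (h2.trans (measure_mono h3))
  have h5 := ENNReal.toReal_mono (measure_ne_top _ _) h4
  rw [ENNReal.toReal_mul, ENNReal.toReal_mul, ENNReal.toReal_ofReal (by positivity), div_pow,
    hrp] at h5
  refine le_trans (le_of_eq ?_) h5
  simp only [ENNReal.coe_toReal, measureReal_def]
  ring

end IsRegularLaw

/-! ### Moments of the matching radius. -/

section Radius

variable {p n : ℕ}

/-- The covariates of a sample. -/
abbrev covariates (z : Fin n → Cov p × Fin 2 × ℝ) : Fin n → Cov p := fun i => (z i).1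

/-- The treatments of a sample. -/
abbrev treatments (z : Fin n → Cov p × Fin 2 × ℝ) : Fin n → Fin 2 := fun i => (z i).2.1

theorem measurable_finset_inf {Ω ι : Type*} [MeasurableSpace Ω] [Countable ι] (I : Finset ι)
    {f : ι → Ω → ℝ≥0∞} (hf : ∀ i, Measurable (f i)) :
    Measurable fun ω => I.inf fun i => f i ω := by
  simp only [Finset.inf_eq_iInf]
  exact Measurable.iInf fun i => Measurable.iInf fun _ => hf i

theorem measurable_nearestRadius (R : ℝ≥0∞) (I : Finset (Fin n)) (i : Fin n) :
    Measurable fun z : Fin n → Cov p × Fin 2 × ℝ =>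
      nearestRadius R (covariates z) (treatments z) I i := by
  unfold nearestRadius
  refine measurable_const.min (measurable_finset_inf I fun k => ?_)
  refine Measurable.ite ?_ (by fun_prop) measurable_const
  exact measurableSet_eq_fun (by fun_prop) ((measurable_of_finite fun w : Fin 2 => 1 - w).comp
    (by fun_prop : Measurable fun z : Fin n → Cov p × Fin 2 × ℝ => (z i).2.1))

theorem measurable_matchingRadius (R : ℝ≥0∞) (M : ℕ) (i i' : Fin n) :
    Measurable fun z : Fin n → Cov p × Fin 2 × ℝ =>
      matchingRadius R M (covariates z) (treatments z) i i' := by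
  unfold matchingRadius
  exact Finset.measurable_fun_sum _ fun b _ => measurable_nearestRadius R _ i

theorem lintegral_exp_neg_mul {c : ℝ} (hc : 0 < c) :
    ∫⁻ t in Set.Ioi (0 : ℝ), ENNReal.ofReal (Real.exp (-c * t)) = ENNReal.ofReal (1 / c) := by
  rw [← ofReal_integral_eq_lintegral_ofReal (integrableOn_exp_mul_Ioi (by linarith) 0)
    (Eventually.of_forall fun t => (Real.exp_pos _).le), integral_exp_mul_Ioi (by linarith)]
  simp [neg_div_neg_eq]

variable {Q : Measure (Cov p × Fin 2 × ℝ)} [IsProbabilityMeasure Q] {X₀ : Set (Cov p)}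
  {m : Fin 2 → Cov p → ℝ}

/-- Given unit `i`, the radius exceeds `t` only if all units of `I` avoid a set of probability at
least `θ * t`. Independence bounds this by `exp (-θ |I| t)`, whose integral over `t > 0` is `1 / (θ
|I|)`. -/
theorem lintegral_nearestRadius_le {θ : ℝ} (hθ : 0 < θ) {R : ℝ≥0}
    (hmem : ∀ᵐ z ∂Q, z.1 ∈ X₀)
    (hlow : ∀ x ∈ X₀, ∀ w : Fin 2, ∀ t : ℝ, 0 ≤ t → t ≤ (R : ℝ) ^ p →
      θ * t ≤ Q.real {z | z.2.1 = w ∧ edist z.1 x ^ p ≤ ENNReal.ofReal t})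
    {I : Finset (Fin n)} {i : Fin n} (hi : i ∉ I) (hI : 0 < I.card) :
    ∫⁻ z, nearestRadius R (covariates z) (treatments z) I i ∂(Measure.pi fun _ : Fin n => Q) ≤
      ENNReal.ofReal (1 / (θ * I.card)) := by
  set μ := Measure.pi fun _ : Fin n => Q
  rw [lintegral_pi_eq_lintegral_update_symm Q i (measurable_nearestRadius _ I i)]
  refine (lintegral_mono_ae (g := fun _ => ENNReal.ofReal (1 / (θ * I.card))) ?_).trans (by simp)
  filter_upwards [hmem] with y hy
  set g : (Fin n → Cov p × Fin 2 × ℝ) → ℝ≥0∞ := fun z => nearestRadius R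
    (covariates (Function.update z i y)) (treatments (Function.update z i y)) I i with hg
  have hgm : Measurable g :=
    (measurable_nearestRadius _ I i).comp
      ((measurePreserving_update_pi Q i).measurable.comp measurable_prodMk_right)
  have hgR : ∀ z, g z ≤ (R : ℝ≥0∞) ^ p := fun z => min_le_left _ _
  have hRtop : (R : ℝ≥0∞) ^ p ≠ ⊤ := by simp
  have hgtop : ∀ z, g z ≠ ⊤ := fun z => ne_top_of_le_ne_top hRtop (hgR z)
  have h1 : ∫⁻ z, g z ∂μ = ∫⁻ z, ENNReal.ofReal (g z).toReal ∂μ :=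
    lintegral_congr fun z => (ENNReal.ofReal_toReal (hgtop z)).symm
  change ∫⁻ z, g z ∂μ ≤ _
  rw [h1, lintegral_eq_lintegral_meas_lt μ (Eventually.of_forall fun z => ENNReal.toReal_nonneg)
    hgm.ennreal_toReal.aemeasurable]
  have hθI : 0 < θ * I.card := by have : (0 : ℝ) < I.card := by exact_mod_cast hI
                                  positivity
  rw [← lintegral_exp_neg_mul hθI]
  have hexp : Measurable fun t : ℝ => ENNReal.ofReal (Real.exp (-(θ * I.card) * t)) := by
    fun_prop
  refine setLIntegral_mono hexp fun t ht => ?_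
  have ht0 : (0 : ℝ) < t := ht
  -- Beyond the truncation level the tail is empty, so the mass bound is needed only in its range of
  -- validity.
  by_cases htR : t < (R : ℝ) ^ p
  swap
  · have : {z | t < (g z).toReal} = ∅ := by
      refine Set.eq_empty_of_forall_notMem fun z hz => htR (lt_of_lt_of_le hz ?_)
      have := ENNReal.toReal_mono hRtop (hgR z)
      simpa using this
    rw [this]; simp
  set s : Set (Cov p × Fin 2 × ℝ) :=
    {z | z.2.1 = 1 - y.2.1 ∧ edist z.1 y.1 ^ p ≤ ENNReal.ofReal t} with hs
  have hsm : MeasurableSet s :=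
    (measurable_snd.fst (measurableSet_singleton (1 - y.2.1))).inter
      (measurableSet_le (f := fun z : Cov p × Fin 2 × ℝ => edist z.1 y.1 ^ p) (by fun_prop)
        measurable_const)
  have hsub : {z | t < (g z).toReal} ⊆ ((I : Set (Fin n)).pi fun _ => sᶜ) := by
    intro z hz k hk
    have hki : k ≠ i := fun h => hi (h ▸ hk)
    have hz' : ENNReal.ofReal t < g z :=
      (ENNReal.ofReal_lt_iff_lt_toReal ht0.le (hgtop z)).2 hz
    rintro ⟨hk1, hk2⟩
    refine absurd (hz'.trans_le ?_) (lt_irrefl _)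
    refine (min_le_right _ _).trans ((Finset.inf_le hk).trans ?_)
    simp [covariates, treatments, Function.update_of_ne hki, hk1, hk2]
  have hQs : Q sᶜ ≤ ENNReal.ofReal (Real.exp (-θ * t)) := by
    rw [← ofReal_measureReal, probReal_compl_eq_one_sub hsm]
    refine ENNReal.ofReal_le_ofReal ?_
    have h2 := hlow y.1 hy (1 - y.2.1) t ht0.le htR.le
    have h3 := Real.add_one_le_exp (-θ * t)
    linarith
  calc μ {z | t < (g z).toReal} ≤ μ ((I : Set (Fin n)).pi fun _ => sᶜ) := measure_mono hsub
    _ = Q sᶜ ^ I.card := by rw [Measure.pi_pi_finset]; simp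
    _ ≤ ENNReal.ofReal (Real.exp (-θ * t)) ^ I.card := by gcongr
    _ = ENNReal.ofReal (Real.exp (-(θ * I.card) * t)) := by
      rw [← ENNReal.ofReal_pow (Real.exp_pos _).le, ← Real.exp_nat_mul]
      congr 2; ring

theorem lintegral_matchingRadius_le {θ : ℝ} (hθ : 0 < θ) {R : ℝ≥0}
    (hmem : ∀ᵐ z ∂Q, z.1 ∈ X₀)
    (hlow : ∀ x ∈ X₀, ∀ w : Fin 2, ∀ t : ℝ, 0 ≤ t → t ≤ (R : ℝ) ^ p →
      θ * t ≤ Q.real {z | z.2.1 = w ∧ edist z.1 x ^ p ≤ ENNReal.ofReal t})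
    {M : ℕ} (hM : 1 ≤ M) (hn : 6 * M ≤ n) (i i' : Fin n) :
    ∫⁻ z, matchingRadius R M (covariates z) (treatments z) i i'
      ∂(Measure.pi fun _ : Fin n => Q) ≤ ENNReal.ofReal (2 * M ^ 2 / θ / n) := by
  unfold matchingRadius
  rw [lintegral_finsetSum _ fun b _ => measurable_nearestRadius _ _ i]
  have hM' : (0 : ℝ) < M := by exact_mod_cast hM
  have hn' : (6 * M : ℝ) ≤ n := by exact_mod_cast hn
  have hn0 : (0 : ℝ) < n := by linarith
  -- A block has at least `⌊n / M⌋` units and loses at most two; with the rounding the loss is at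
  -- most three, which is at most `n / (2 M)` because `n ≥ 6 M`.
  have hb : ∀ b : Fin M, (n : ℝ) / (2 * M) ≤ (residueBlock n M b \ {i, i'}).card := fun b => by
    have h1 := le_card_residueBlock (n := n) M b
    have h2 := Finset.le_card_sdiff ({i, i'} : Finset (Fin n)) (residueBlock n M b)
    have h3 : ({i, i'} : Finset (Fin n)).card ≤ 2 := Finset.card_le_two
    have h4 : n / M ≤ (residueBlock n M b \ {i, i'}).card + 2 := by
      omega
    have h5 : n < M * (n / M + 1) := by
      have := Nat.lt_mul_div_succ n (show 0 < M by omega)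
      exact this
    have h6 : (n : ℝ) < M * ((residueBlock n M b \ {i, i'}).card + 3) := by
      have : n < M * ((residueBlock n M b \ {i, i'}).card + 3) :=
        h5.trans_le (Nat.mul_le_mul_left _ (by omega))
      exact_mod_cast this
    rw [div_le_iff₀ (by positivity)]
    nlinarith
  calc ∑ b : Fin M, ∫⁻ z, nearestRadius R (covariates z) (treatments z)
        (residueBlock n M b \ {i, i'}) i ∂(Measure.pi fun _ : Fin n => Q)
      ≤ ∑ _b : Fin M, ENNReal.ofReal (2 * M / θ / n) := by
        refine Finset.sum_le_sum fun b _ => ?_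
        have hpos : (0 : ℝ) < (residueBlock n M b \ {i, i'}).card :=
          lt_of_lt_of_le (by positivity) (hb b)
        refine (lintegral_nearestRadius_le hθ hmem hlow (by simp)
          (by exact_mod_cast hpos)).trans (ENNReal.ofReal_le_ofReal ?_)
        calc 1 / (θ * (residueBlock n M b \ {i, i'}).card) ≤ 1 / (θ * (n / (2 * M))) := by
              gcongr; exact hb b
          _ = 2 * M / θ / n := by field_simp
    _ = ENNReal.ofReal (2 * M ^ 2 / θ / n) := by
      rw [Finset.sum_const, Finset.card_univ, Fintype.card_fin, ← ENNReal.ofReal_nsmul]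
      congr 1
      simp
      field_simp

/-- The reason for deleting `i'` from the blocks: the radius is independent of unit `i'`, so the
probability that `X i'` falls within it is bounded by the volume of a ball. -/
theorem matchingRadius_update {R : ℝ≥0} {M : ℕ} (z : Fin n → Cov p × Fin 2 × ℝ) {i i' : Fin n}
    (h : i ≠ i') (y : Cov p × Fin 2 × ℝ) :
    matchingRadius R M (covariates (Function.update z i' y)) (treatments (Function.update z i' y))
      i i' = matchingRadius R M (covariates z) (treatments z) i i' := by
  unfold matchingRadius nearestRadius
  refine Finset.sum_congr rfl fun b _ => ?_
  congr 1
  refine Finset.inf_congr rfl fun k hk => ?_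
  have hk' : k ≠ i' := fun h => by simp [h] at hk
  simp [covariates, treatments, Function.update_of_ne hk', Function.update_of_ne h]

theorem matchingRadius_ne_top {R : ℝ≥0} {M : ℕ} (X : Fin n → Cov p) (W : Fin n → Fin 2)
    (i i' : Fin n) : matchingRadius R M X W i i' ≠ ⊤ := by
  unfold matchingRadius
  refine ENNReal.sum_ne_top.2 fun b _ => ne_top_of_le_ne_top ?_ (min_le_left _ _)
  simp

/-- Two sample points are rarely within matching distance of each other. -/
theorem measure_close_pair_le (hp : 1 ≤ p) {b : ℝ≥0}
    (hb : ∀ B, MeasurableSet B → Q (Prod.fst ⁻¹' B) ≤ b * volume B) {R : ℝ≥0} {M : ℕ}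
    {i i' : Fin n} (h : i ≠ i') (K : ℝ≥0) :
    (Measure.pi fun _ : Fin n => Q) {z | edist (z i').1 (z i).1 ^ p ≤
        K * matchingRadius R M (covariates z) (treatments z) i i'} ≤
      b * K * volume (Metric.ball (0 : Cov p) 1) *
        ∫⁻ z, matchingRadius R M (covariates z) (treatments z) i i'
          ∂(Measure.pi fun _ : Fin n => Q) := by
  have hm := measurable_matchingRadius (p := p) R M i i'
  have hset : MeasurableSet {z : Fin n → Cov p × Fin 2 × ℝ | edist (z i').1 (z i).1 ^ p ≤
        K * matchingRadius R M (covariates z) (treatments z) i i'} :=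
    measurableSet_le (by fun_prop) (hm.const_mul _)
  rw [measure_pi_eq_lintegral_update Q i' hset, ← lintegral_const_mul _ hm]
  refine lintegral_mono fun z => ?_
  have hs : (K : ℝ≥0∞) * matchingRadius R M (covariates z) (treatments z) i i' ≠ ⊤ :=
    ENNReal.mul_ne_top (by simp) (matchingRadius_ne_top _ _ _ _)
  have heq : {y : Cov p × Fin 2 × ℝ | Function.update z i' y ∈
      {z : Fin n → Cov p × Fin 2 × ℝ | edist (z i').1 (z i).1 ^ p ≤
        K * matchingRadius R M (covariates z) (treatments z) i i'}} =
      Prod.fst ⁻¹' {y : Cov p | edist y (z i).1 ^ p ≤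
        K * matchingRadius R M (covariates z) (treatments z) i i'} := by
    ext y
    simp [matchingRadius_update z h, Function.update_of_ne h]
  rw [heq]
  refine (hb _ (measurableSet_le (by fun_prop) measurable_const)).trans ?_
  refine (mul_le_mul_right (volume_edist_pow_le hp _ hs) _).trans (le_of_eq ?_)
  ring

end Radius

/-! ### Second moments of weighted sums of residuals. -/

section Noise

variable {p n : ℕ} {Q : Measure (Cov p × Fin 2 × ℝ)} {X₀ : Set (Cov p)}
  {m : Fin 2 → Cov p → ℝ}

/-- The covariate-treatment part of a sample. -/
def designPart (z : Fin n → Cov p × Fin 2 × ℝ) : Fin n → Cov p × Fin 2 :=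
  fun i => ((z i).1, (z i).2.1)

theorem measurable_designPart :
    Measurable (designPart : (Fin n → Cov p × Fin 2 × ℝ) → Fin n → Cov p × Fin 2) := by
  unfold designPart
  fun_prop

theorem designPart_update (z : Fin n → Cov p × Fin 2 × ℝ) (j : Fin n) (y : Cov p × Fin 2 × ℝ) :
    designPart (Function.update z j y) = Function.update (designPart z) j (y.1, y.2.1) := by
  ext1 i
  by_cases h : i = j
  · subst h; simp [designPart]
  · simp [designPart, Function.update_of_ne h]

/-- The regression residual `Y - m(W, X)`. -/
def regressionResidual (m : Fin 2 → Cov p → ℝ) (y : Cov p × Fin 2 × ℝ) : ℝ := y.2.2 - m y.2.1 y.1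

theorem measurable_regression (hm : ∀ w, Measurable (m w)) :
    Measurable fun y : Cov p × Fin 2 => m y.2 y.1 := by
  have : (fun y : Cov p × Fin 2 => m y.2 y.1) =
      fun y => if y.2 = 0 then m 0 y.1 else m 1 y.1 := by
    ext y
    split_ifs with h
    · rw [h]
    · rw [Fin.eq_one_of_ne_zero _ h]
  rw [this]
  exact Measurable.ite (measurable_snd (measurableSet_singleton 0))
    ((hm 0).comp measurable_fst) ((hm 1).comp measurable_fst)

theorem IsRegularLaw.measurable (h : IsRegularLaw Q X₀ m) (w : Fin 2) : Measurable (m w) := by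
  obtain ⟨L, hL⟩ := h.lipschitz
  exact (hL w).continuous.measurable

theorem IsRegularLaw.measurable_residual (h : IsRegularLaw Q X₀ m) : Measurable (regressionResidual m) := by
  have := (measurable_regression h.measurable).comp
    (by fun_prop : Measurable fun y : Cov p × Fin 2 × ℝ => (y.1, y.2.1))
  exact measurable_snd.snd.sub this

theorem IsRegularLaw.memLp_residual (h : IsRegularLaw Q X₀ m) : MemLp (regressionResidual m) 2 Q :=
  (memLp_two_iff_integrable_sq h.measurable_residual.aestronglyMeasurable).2 h.integrable_sq

variable [IsProbabilityMeasure Q]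

/-- Weighted sums of residuals, with weights depending on covariates and treatments only, have
second moment bounded by that of the weights. -/
theorem lintegral_sq_sum_residual_le (h : IsRegularLaw Q X₀ m) {C : ℝ≥0}
    (hC : ∀ φ : Cov p × Fin 2 → ℝ≥0∞, Measurable φ →
      ∫⁻ z, ENNReal.ofReal ((z.2.2 - m z.2.1 z.1) ^ 2) * φ (z.1, z.2.1) ∂Q ≤
        C * ∫⁻ z, φ (z.1, z.2.1) ∂Q)
    {a : Fin n → (Fin n → Cov p × Fin 2) → ℝ} (ha : ∀ j, Measurable (a j)) {B : ℝ}
    (hB : ∀ j d, |a j d| ≤ B) :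
    ∫⁻ z, ENNReal.ofReal ((∑ j, regressionResidual m (z j) * a j (designPart z)) ^ 2)
        ∂(Measure.pi fun _ : Fin n => Q) ≤
      C * ∑ j, ∫⁻ z, ENNReal.ofReal (a j (designPart z) ^ 2)
        ∂(Measure.pi fun _ : Fin n => Q) := by
  set μ := Measure.pi fun _ : Fin n => Q
  have had : ∀ j, Measurable fun z : Fin n → Cov p × Fin 2 × ℝ => a j (designPart z) :=
    fun j => (ha j).comp measurable_designPart
  have hεLp : ∀ j : Fin n, MemLp (fun z : Fin n → Cov p × Fin 2 × ℝ => regressionResidual m (z j)) 2 μ :=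
    fun j => h.memLp_residual.comp_measurePreserving (measurePreserving_eval (fun _ : Fin n => Q) j)
  have hint : ∀ j k, Integrable (fun z => regressionResidual m (z j) * a j (designPart z) *
      (regressionResidual m (z k) * a k (designPart z))) μ := fun j k => by
    have h1 : Integrable (fun z => regressionResidual m (z j) * regressionResidual m (z k)) μ :=
      (hεLp j).integrable_mul (hεLp k)
    have h2 := h1.mul_bdd (c := B * B) (((had j).mul (had k)).aestronglyMeasurable)
      (Eventually.of_forall fun z => by
        rw [Pi.mul_apply, norm_mul]
        exact mul_le_mul (hB j _) (hB k _) (norm_nonneg _) ((abs_nonneg _).trans (hB j (designPart z))))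
    refine h2.congr (Eventually.of_forall fun z => ?_)
    simp only [Pi.mul_apply]
    ring
  -- Unit `j` is resampled with all others frozen. The residual of `k` is then a constant and both
  -- weights are bounded functions of the covariate and treatment of `j` alone, so the residual of
  -- `j` integrates to zero against them.
  have hcross : ∀ j k, j ≠ k → ∫ z, regressionResidual m (z j) * a j (designPart z) *
      (regressionResidual m (z k) * a k (designPart z)) ∂μ = 0 := fun j k hjk => by
    rw [integral_pi_eq_integral_update Q j (hint j k)]
    refine (integral_congr_ae (Eventually.of_forall fun z => ?_)).trans (integral_zero _ _)
    simp only [Function.update_self, Function.update_of_ne hjk.symm, designPart_update]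
    have hφ := h.mean_zero (fun d => a j (Function.update (designPart z) j d) *
        a k (Function.update (designPart z) j d))
      (((ha j).comp (measurable_update _)).mul ((ha k).comp (measurable_update _)))
      ⟨B * B, fun d => by
        rw [abs_mul]
        exact mul_le_mul (hB j _) (hB k _) (abs_nonneg _)
          ((abs_nonneg _).trans (hB j (designPart z)))⟩
    have h3 := congrArg (fun t => regressionResidual m (z k) * t) hφ
    simp only [mul_zero, ← integral_const_mul] at h3
    rw [← h3]
    refine integral_congr_ae (Eventually.of_forall fun y => ?_)
    simp only [regressionResidual]
    ring
  have hdiag : ∀ j, ∫⁻ z, ENNReal.ofReal ((regressionResidual m (z j) * a j (designPart z)) ^ 2) ∂μ ≤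
      C * ∫⁻ z, ENNReal.ofReal (a j (designPart z) ^ 2) ∂μ := fun j => by
    have hr : Measurable fun z : Fin n → Cov p × Fin 2 × ℝ => regressionResidual m (z j) :=
      h.measurable_residual.comp (measurable_pi_apply j)
    have hra : Measurable fun z : Fin n → Cov p × Fin 2 × ℝ =>
        ENNReal.ofReal ((regressionResidual m (z j) * a j (designPart z)) ^ 2) :=
      ((hr.mul (had j)).pow_const 2).ennreal_ofReal
    rw [lintegral_pi_eq_lintegral_update Q j hra,
      lintegral_pi_eq_lintegral_update Q j (((had j).pow_const 2).ennreal_ofReal),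
      ← lintegral_const_mul']
    swap; · simp
    refine lintegral_mono fun z => ?_
    simp only [Function.update_self, designPart_update]
    refine le_trans (le_of_eq ?_) (hC (fun d => ENNReal.ofReal
      (a j (Function.update (designPart z) j d) ^ 2))
      ((((ha j).comp (measurable_update _)).pow_const 2).ennreal_ofReal))
    refine lintegral_congr fun y => ?_
    rw [mul_pow, ENNReal.ofReal_mul (sq_nonneg _)]
    rfl
  have hexp : ∀ z : Fin n → Cov p × Fin 2 × ℝ,
      (∑ j, regressionResidual m (z j) * a j (designPart z)) ^ 2 =
      ∑ j, ∑ k, regressionResidual m (z j) * a j (designPart z) * (regressionResidual m (z k) * a k (designPart z)) :=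
    fun z => by rw [sq, Finset.sum_mul_sum]
  have htot : ∫ z, (∑ j, regressionResidual m (z j) * a j (designPart z)) ^ 2 ∂μ =
      ∑ j, ∫ z, (regressionResidual m (z j) * a j (designPart z)) ^ 2 ∂μ := by
    simp only [hexp]
    rw [integral_finsetSum _ fun j _ => integrable_finsetSum _ fun k _ => hint j k]
    refine Finset.sum_congr rfl fun j _ => ?_
    rw [integral_finsetSum _ fun k _ => hint j k,
      Finset.sum_eq_single j (fun k _ hk => hcross j k hk.symm) (by simp)]
    simp only [sq]
  have hisq : Integrable (fun z => (∑ j, regressionResidual m (z j) * a j (designPart z)) ^ 2) μ := by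
    simp only [hexp]
    exact integrable_finsetSum _ fun j _ => integrable_finsetSum _ fun k _ => hint j k
  rw [← ofReal_integral_eq_lintegral_ofReal hisq (Eventually.of_forall fun z => sq_nonneg _), htot,
    ENNReal.ofReal_sum_of_nonneg fun j _ => integral_nonneg fun z => sq_nonneg _, Finset.mul_sum]
  refine Finset.sum_le_sum fun j _ => ?_
  rw [ofReal_integral_eq_lintegral_ofReal]
  · exact hdiag j
  · simpa only [sq] using hint j j
  · exact Eventually.of_forall fun z => sq_nonneg _

end Noise

/-! ### Events of probability tending to one: large arms and nondegenerate sample covariance. -/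

section GoodEvents

open Matrix

variable {p : ℕ} {Q : Measure (Cov p × Fin 2 × ℝ)} {X₀ : Set (Cov p)}
  {m : Fin 2 → Cov p → ℝ}

theorem IsRegularLaw.exists_bound (h : IsRegularLaw Q X₀ m) :
    ∃ B : ℝ, 0 < B ∧ ∀ᵐ y ∂Q, ∀ a, |y.1 a| ≤ B := by
  obtain ⟨B, hB0, hB⟩ := h.isCompact.isBounded.exists_pos_norm_le
  refine ⟨B, hB0, ?_⟩
  filter_upwards [h.mem] with y hy a
  exact (PiLp.norm_apply_le (p := 2) y.1 a).trans (hB _ hy)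

variable [IsProbabilityMeasure Q]

theorem tendsto_measure_pi_average_deviation {E : Type*} [MeasurableSpace E] (Q : Measure E)
    [IsProbabilityMeasure Q] {f : E → ℝ} (hf : Measurable f) {B : ℝ} (hB : ∀ᵐ y ∂Q, |f y| ≤ B)
    {t : ℝ} (ht : 0 < t) :
    Tendsto (fun n : ℕ => (Measure.pi fun _ : Fin n => Q)
      {z | t ≤ |(n : ℝ)⁻¹ * ∑ i, f (z i) - ∫ y, f y ∂Q|}) atTop (nhds 0) := by
  have h1 : Tendsto (fun n : ℕ => ENNReal.ofReal (B ^ 2 / (n * t ^ 2))) atTop (nhds 0) := by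
    rw [← ENNReal.ofReal_zero]
    refine ENNReal.tendsto_ofReal (Tendsto.div_atTop tendsto_const_nhds ?_)
    exact Tendsto.atTop_mul_const (by positivity) tendsto_natCast_atTop_atTop
  refine tendsto_of_tendsto_of_tendsto_of_le_of_le' tendsto_const_nhds h1
    (Eventually.of_forall fun n => bot_le) ?_
  filter_upwards [eventually_gt_atTop 0] with n hn
  exact measure_pi_average_deviation_le Q hf hB hn ht

/-- Each arm has positive probability `q`; by Chebyshev its sample share exceeds `q / 2`, hence its
size exceeds `n q / 2`, with probability tending to one. -/
theorem IsRegularLaw.tendsto_measure_small_arm (h : IsRegularLaw Q X₀ m) (M : ℕ) :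
    Tendsto (fun n : ℕ => (Measure.pi fun _ : Fin n => Q)
      {z | ¬ ∀ w : Fin 2, M ≤ (Finset.univ.filter fun i => (z i).2.1 = w).card})
      atTop (nhds 0) := by
  obtain ⟨c, hc, hlow⟩ := h.lower
  set f : Fin 2 → Cov p × Fin 2 × ℝ → ℝ := fun w => Set.indicator {y | y.2.1 = w} 1 with hf
  have hsm : ∀ w, MeasurableSet {y : Cov p × Fin 2 × ℝ | y.2.1 = w} := fun w =>
    measurable_snd.fst (measurableSet_singleton w)
  have hfm : ∀ w, Measurable (f w) := fun w => measurable_one.indicator (hsm w)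
  have hf1 : ∀ w y, |f w y| ≤ 1 := fun w y => by
    by_cases hy : y.2.1 = w <;> simp [hf, hy]
  have hint : ∀ w, ∫ y, f w y ∂Q = Q.real {y | y.2.1 = w} := fun w => by
    simp [hf, integral_indicator_one (hsm w)]
  have hq : ∀ w, 0 < Q.real {y : Cov p × Fin 2 × ℝ | y.2.1 = w} := fun w => by
    refine ENNReal.toReal_pos ?_ (measure_ne_top _ _)
    have h1 := hlow w Set.univ MeasurableSet.univ
    simp only [Set.univ_inter, Set.mem_univ, true_and] at h1
    refine (lt_of_lt_of_le ?_ h1).ne'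
    exact ENNReal.mul_pos (by simpa using hc.ne') h.volume_pos.ne'
  have hsum : Tendsto (fun n : ℕ => ∑ w : Fin 2, (Measure.pi fun _ : Fin n => Q)
      {z | Q.real {y : Cov p × Fin 2 × ℝ | y.2.1 = w} / 2 ≤
        |(n : ℝ)⁻¹ * ∑ i, f w (z i) - ∫ y, f w y ∂Q|}) atTop (nhds 0) := by
    have := tendsto_finsetSum (Finset.univ : Finset (Fin 2)) fun w _ =>
      tendsto_measure_pi_average_deviation Q (hfm w) (Eventually.of_forall (hf1 w))
        (half_pos (hq w))
    simpa using this
  refine tendsto_of_tendsto_of_tendsto_of_le_of_le' tendsto_const_nhds hsum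
    (Eventually.of_forall fun n => bot_le) ?_
  have hev : ∀ w, ∀ᶠ n : ℕ in atTop,
      (M : ℝ) ≤ n * (Q.real {y : Cov p × Fin 2 × ℝ | y.2.1 = w} / 2) := fun w =>
    (Tendsto.atTop_mul_const (half_pos (hq w)) tendsto_natCast_atTop_atTop).eventually_ge_atTop _
  filter_upwards [eventually_gt_atTop 0, eventually_all.2 hev] with n hn hnM
  refine le_trans (measure_mono fun z hz => ?_) (measure_biUnion_finset_le _ _)
  simp only [Set.mem_ofPred_eq, not_forall, not_le] at hz
  obtain ⟨w, hw⟩ := hz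
  simp only [Set.mem_iUnion]
  refine ⟨w, Finset.mem_univ _, ?_⟩
  by_contra hlt
  simp only [Set.mem_ofPred_eq, not_le, hint] at hlt
  have hn' : (0 : ℝ) < n := by exact_mod_cast hn
  have h2 : ∑ i, f w (z i) = (Finset.univ.filter fun i => (z i).2.1 = w).card := by
    rw [Finset.card_filter]
    push_cast
    refine Finset.sum_congr rfl fun i _ => ?_
    simp [hf, Set.indicator_apply]
  rw [h2] at hlt
  have h3 := (abs_lt.1 hlt).1
  have h4 : Q.real {y : Cov p × Fin 2 × ℝ | y.2.1 = w} / 2 <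
      (n : ℝ)⁻¹ * (Finset.univ.filter fun i => (z i).2.1 = w).card := by linarith
  have h5 := mul_lt_mul_of_pos_left h4 hn'
  rw [mul_inv_cancel_left₀ hn'.ne'] at h5
  have h6 := (hnM w).trans h5.le
  exact absurd (Nat.cast_le.1 h6) (not_le.2 hw)

theorem continuous_quadratic (S : Matrix (Fin p) (Fin p) ℝ) :
    Continuous fun v : Cov p => v.ofLp ⬝ᵥ S *ᵥ v.ofLp := by
  simp only [dotProduct, Matrix.mulVec]
  fun_prop

/-- Cauchy–Schwarz in the form `(∑ |v a|)² ≤ p ‖v‖²`; it turns entrywise convergence of the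
covariance into closeness of quadratic forms. -/
theorem abs_quadratic_le {S : Matrix (Fin p) (Fin p) ℝ} {δ : ℝ} (h : ∀ a b, |S a b| ≤ δ)
    (v : Cov p) : |v.ofLp ⬝ᵥ S *ᵥ v.ofLp| ≤ δ * p * ‖v‖ ^ 2 := by
  have h1 : v.ofLp ⬝ᵥ S *ᵥ v.ofLp = ∑ a, ∑ b, v a * (S a b * v b) := by
    simp only [dotProduct, Matrix.mulVec, Finset.mul_sum]
  rw [h1]
  calc |∑ a, ∑ b, v a * (S a b * v b)| ≤ ∑ a, ∑ b, |v a| * (δ * |v b|) := by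
        refine (Finset.abs_sum_le_sum_abs _ _).trans (Finset.sum_le_sum fun a _ =>
          (Finset.abs_sum_le_sum_abs _ _).trans (Finset.sum_le_sum fun b _ => ?_))
        rw [abs_mul, abs_mul]
        gcongr
        exact h a b
    _ = δ * (∑ a, |v a|) ^ 2 := by
        rw [sq, Finset.sum_mul_sum, Finset.mul_sum]
        refine Finset.sum_congr rfl fun a _ => ?_
        rw [Finset.mul_sum]
        exact Finset.sum_congr rfl fun b _ => by ring
    _ ≤ δ * (p * ∑ a, |v a| ^ 2) := by
        rcases isEmpty_or_nonempty (Fin p) with he | ⟨⟨a⟩⟩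
        · simp
        have hδ : 0 ≤ δ := (abs_nonneg _).trans (h a a)
        gcongr
        simpa using sq_sum_le_card_mul_sum_sq (s := Finset.univ) (f := fun a => |v a|)
    _ = δ * p * ‖v‖ ^ 2 := by
        rw [EuclideanSpace.norm_sq_eq]
        simp [mul_assoc]

/-- The covariance matrix of the covariates. -/
def populationCov (Q : Measure (Cov p × Fin 2 × ℝ)) : Matrix (Fin p) (Fin p) ℝ :=
  fun a b => ∫ y, y.1 a * y.1 b ∂Q - (∫ y, y.1 a ∂Q) * ∫ y, y.1 b ∂Q

/-- The quadratic form is the variance of `⟨v, X⟩`. Were it zero, `X` would lie almost surely in a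
hyperplane, which has probability zero because the law of `X` has a density. -/
theorem IsRegularLaw.populationCov_pos (h : IsRegularLaw Q X₀ m) {v : Cov p} (hv : v ≠ 0) :
    0 < v.ofLp ⬝ᵥ populationCov Q *ᵥ v.ofLp := by
  obtain ⟨B, hB0, hB⟩ := h.exists_bound
  have hLp : ∀ a, MemLp (fun y : Cov p × Fin 2 × ℝ => y.1 a) 2 Q := fun a =>
    MemLp.of_bound (by fun_prop) B (by filter_upwards [hB] with y hy using hy a)
  have hi1 : ∀ a, Integrable (fun y : Cov p × Fin 2 × ℝ => y.1 a) Q := fun a =>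
    (hLp a).integrable (by norm_num)
  have hi2 : ∀ a b, Integrable (fun y : Cov p × Fin 2 × ℝ => y.1 a * y.1 b) Q := fun a b =>
    (hLp a).integrable_mul (hLp b)
  set c : ℝ := ∑ a, v a * ∫ y, y.1 a ∂Q with hc
  have hlin : ∀ y : Cov p, ∑ a, v a * y a = inner ℝ v y := fun y => by
    rw [← dotProduct_ofLp]; rfl
  have hiL : Integrable (fun y : Cov p × Fin 2 × ℝ => (∑ a, v a * y.1 a)) Q :=
    integrable_finsetSum _ fun a _ => (hi1 a).const_mul _
  have hsqexp : ∀ y : Cov p, (∑ a, v a * y a) ^ 2 = ∑ a, ∑ b, v a * v b * (y a * y b) := fun y => by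
    rw [sq, Finset.sum_mul_sum]
    exact Finset.sum_congr rfl fun a _ => Finset.sum_congr rfl fun b _ => by ring
  have hiL2 : Integrable (fun y : Cov p × Fin 2 × ℝ => (∑ a, v a * y.1 a) ^ 2) Q := by
    simp only [hsqexp]
    exact integrable_finsetSum _ fun a _ => integrable_finsetSum _ fun b _ => (hi2 a b).const_mul _
  have hmean : ∫ y, (∑ a, v a * y.1 a) ∂Q = c := by
    rw [integral_finsetSum _ fun a _ => (hi1 a).const_mul _]
    simp only [integral_const_mul, hc]
  have hquad : v.ofLp ⬝ᵥ populationCov Q *ᵥ v.ofLp = ∫ y, ((∑ a, v a * y.1 a) - c) ^ 2 ∂Q := by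
    have e1 : ∫ y, ((∑ a, v a * y.1 a) - c) ^ 2 ∂Q =
        ∫ y, (∑ a, v a * y.1 a) ^ 2 ∂Q - c ^ 2 := by
      have : ∀ y : Cov p × Fin 2 × ℝ, ((∑ a, v a * y.1 a) - c) ^ 2 =
          (∑ a, v a * y.1 a) ^ 2 - (2 * c * (∑ a, v a * y.1 a) - c ^ 2) := fun y => by ring
      simp only [this]
      have hi4 : Integrable (fun y : Cov p × Fin 2 × ℝ =>
          2 * c * (∑ a, v a * y.1 a) - c ^ 2) Q := (hiL.const_mul _).sub (integrable_const _)
      rw [integral_sub hiL2 hi4, integral_sub (hiL.const_mul _) (integrable_const _),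
        integral_const_mul, hmean]
      simp
      ring
    have e2 : ∫ y, (∑ a, v a * y.1 a) ^ 2 ∂Q =
        ∑ a, ∑ b, v a * v b * ∫ y, y.1 a * y.1 b ∂Q := by
      simp only [hsqexp]
      rw [integral_finsetSum _ fun a _ => integrable_finsetSum _ fun b _ => (hi2 a b).const_mul _]
      refine Finset.sum_congr rfl fun a _ => ?_
      rw [integral_finsetSum _ fun b _ => (hi2 a b).const_mul _]
      simp only [integral_const_mul]
    rw [e1, e2, hc, sq, Finset.sum_mul_sum, ← Finset.sum_sub_distrib]
    simp only [← Finset.sum_sub_distrib, dotProduct, Matrix.mulVec, populationCov, Finset.mul_sum]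
    exact Finset.sum_congr rfl fun a _ => Finset.sum_congr rfl fun b _ => by ring
  rw [hquad]
  refine lt_of_le_of_ne (integral_nonneg fun y => sq_nonneg _) fun h0 => ?_
  have hi3 : Integrable (fun y : Cov p × Fin 2 × ℝ => ((∑ a, v a * y.1 a) - c) ^ 2) Q := by
    have h1 : MemLp (fun y : Cov p × Fin 2 × ℝ => (∑ a, v a * y.1 a) - c) 2 Q :=
      (memLp_finsetSum _ fun a _ => (hLp a).const_mul (v a)).sub (memLp_const _)
    exact h1.integrable_sq
  have hae := (integral_eq_zero_iff_of_nonneg (fun y => sq_nonneg _) hi3).1 h0.symm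
  set β : Cov p →ₗ[ℝ] ℝ := (innerSL ℝ v).toLinearMap with hβ
  have hβ0 : β ≠ 0 := fun h => hv <| by
    have := LinearMap.congr_fun h v
    simpa [hβ] using this
  have hnull := h.null (B := {y | -c + β y = 0}) (by
    have : Continuous β := β.continuous_of_finiteDimensional
    exact (isClosed_eq (by fun_prop) continuous_const).measurableSet)
    (volume_linear_level_set β hβ0 (-c))
  have hae' : ∀ᵐ y ∂Q, y ∉ Prod.fst ⁻¹' {y : Cov p | -c + β y = 0} :=
    measure_eq_zero_iff_ae_notMem.1 hnull
  have : ∀ᵐ _y ∂Q, False := by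
    filter_upwards [hae, hae'] with y h1 h2
    refine h2 ?_
    have h3 : (∑ a, v a * y.1 a) - c = 0 := by simpa using h1
    rw [hlin] at h3
    simp only [Set.mem_preimage, Set.mem_ofPred_eq, hβ, ContinuousLinearMap.coe_coe, innerSL_apply_apply]
    linarith
  exact (NeZero.ne Q) (by simpa using this)

/-- The minimum of the form over the unit sphere is attained by compactness, and homogeneity does
the rest. The empty sphere corresponds to the zero space. -/
theorem IsRegularLaw.exists_populationCov_coercive (h : IsRegularLaw Q X₀ m) :
    ∃ l : ℝ≥0, 0 < l ∧ ∀ v : Cov p, l * ‖v‖ ^ 2 ≤ v.ofLp ⬝ᵥ populationCov Q *ᵥ v.ofLp := by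
  rcases (Metric.sphere (0 : Cov p) 1).eq_empty_or_nonempty with he | hne
  · refine ⟨1, one_pos, fun v => ?_⟩
    have : v = 0 := by
      by_contra hv
      have h1 : ‖v‖⁻¹ • v ∈ Metric.sphere (0 : Cov p) 1 := by
        rw [mem_sphere_zero_iff_norm, norm_smul, norm_inv, norm_norm,
          inv_mul_cancel₀ (norm_ne_zero_iff.2 hv)]
      rw [he] at h1
      exact h1
    simp [this]
  · obtain ⟨v0, hv0, hmin⟩ := (isCompact_sphere (0 : Cov p) 1).exists_isMinOn hne
      (continuous_quadratic (populationCov Q)).continuousOn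
    have hv0n : v0 ≠ 0 := fun h => by simp [h] at hv0
    have hpos := h.populationCov_pos hv0n
    refine ⟨⟨_, hpos.le⟩, hpos, fun v => ?_⟩
    by_cases hv : v = 0
    · simp [hv]
    have h1 : ‖v‖⁻¹ • v ∈ Metric.sphere (0 : Cov p) 1 := by
      rw [mem_sphere_zero_iff_norm, norm_smul, norm_inv, norm_norm,
        inv_mul_cancel₀ (norm_ne_zero_iff.2 hv)]
    have h2 := hmin h1
    have hvn : 0 < ‖v‖ := norm_pos_iff.2 hv
    simp only [Set.mem_ofPred_eq, WithLp.ofLp_smul, Matrix.mulVec_smul, dotProduct_smul,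
      smul_dotProduct, smul_eq_mul] at h2
    change v0.ofLp ⬝ᵥ populationCov Q *ᵥ v0.ofLp * ‖v‖ ^ 2 ≤ _
    calc v0.ofLp ⬝ᵥ populationCov Q *ᵥ v0.ofLp * ‖v‖ ^ 2
        ≤ (‖v‖⁻¹ * (‖v‖⁻¹ * (v.ofLp ⬝ᵥ populationCov Q *ᵥ v.ofLp))) * ‖v‖ ^ 2 := by gcongr
      _ = _ := by field_simp

/-- With probability tending to one the sample covariance matrix is uniformly positive definite
and the covariates lie within a fixed distance of each other. -/
theorem IsRegularLaw.exists_good_designs (h : IsRegularLaw Q X₀ m) {R : ℝ≥0}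
    (hdiam : ∀ x ∈ X₀, ∀ y ∈ X₀, dist x y ≤ R) :
    ∃ l : ℝ≥0, 0 < l ∧ ∃ G : ∀ n : ℕ, Set (Fin n → Cov p), (∀ n, MeasurableSet (G n)) ∧
      (∀ n, ∀ x ∈ G n, (∀ i j, ‖x i - x j‖ ≤ R) ∧
        ∀ v : Cov p, l * ‖v‖ ^ 2 ≤ v.ofLp ⬝ᵥ sampleCov x *ᵥ v.ofLp) ∧
      Tendsto (fun n : ℕ => (Measure.pi fun _ : Fin n => Q) {z | covariates z ∉ G n})
        atTop (nhds 0) := by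
  obtain ⟨l, hl, hcoer⟩ := h.exists_populationCov_coercive
  obtain ⟨B, hB0, hB⟩ := h.exists_bound
  have hl' : (0 : ℝ) < l := hl
  -- An entrywise error `δ` moves the quadratic form by at most `δ p ‖v‖²`, at most half of the
  -- coercivity. The tolerance `η` on first and second moments is chosen so that `η + η (2B + η)`,
  -- the resulting error in a covariance entry, is at most `δ`.
  set δ : ℝ := l / (2 * (p + 1)) with hδ
  have hδ0 : 0 < δ := by positivity
  set η : ℝ := min 1 (δ / (2 * B + 2)) with hη
  have hη0 : 0 < η := by positivity
  have hηδ : η + η * (2 * B + η) ≤ δ := by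
    have h1 : η ≤ 1 := min_le_left _ _
    have h2 : η * (2 * B + 2) ≤ δ := by
      have := min_le_right 1 (δ / (2 * B + 2))
      rwa [← hη, le_div_iff₀ (by positivity)] at this
    nlinarith
  set e1 : Fin p → ℝ := fun a => ∫ y, y.1 a ∂Q
  set e2 : Fin p × Fin p → ℝ := fun a => ∫ y, y.1 a.1 * y.1 a.2 ∂Q
  set G : ∀ n : ℕ, Set (Fin n → Cov p) := fun n => {x | (∀ i j, ‖x i - x j‖ ≤ R) ∧
    (∀ a, |(n : ℝ)⁻¹ * ∑ i, x i a - e1 a| < η) ∧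
    (∀ a : Fin p × Fin p, |(n : ℝ)⁻¹ * ∑ i, x i a.1 * x i a.2 - e2 a| < η) ∧ 0 < n} with hG
  have he1 : ∀ a, |e1 a| ≤ B := fun a => by
    have := norm_integral_le_of_norm_le_const (μ := Q) (f := fun y => y.1 a) (C := B)
      (by filter_upwards [hB] with y hy using hy a)
    simpa using this
  refine ⟨l / 2, by positivity, G, fun n => ?_, fun n x hx => ⟨hx.1, fun v => ?_⟩, ?_⟩
  · have m1 : MeasurableSet {x : Fin n → Cov p | ∀ i j, ‖x i - x j‖ ≤ R} := by
      simp only [Set.ofPred_forall]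
      exact MeasurableSet.iInter fun i => MeasurableSet.iInter fun j =>
        measurableSet_le (f := fun x : Fin n → Cov p => ‖x i - x j‖) (by fun_prop) measurable_const
    have m2 : MeasurableSet
        {x : Fin n → Cov p | ∀ a, |(n : ℝ)⁻¹ * ∑ i, x i a - e1 a| < η} := by
      simp only [Set.ofPred_forall]
      exact MeasurableSet.iInter fun a => measurableSet_lt
        (f := fun x : Fin n → Cov p => |(n : ℝ)⁻¹ * ∑ i, x i a - e1 a|)
        (Measurable.abs (by fun_prop)) measurable_const
    have m3 : MeasurableSet {x : Fin n → Cov p | ∀ a : Fin p × Fin p,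
        |(n : ℝ)⁻¹ * ∑ i, x i a.1 * x i a.2 - e2 a| < η} := by
      simp only [Set.ofPred_forall]
      exact MeasurableSet.iInter fun a => measurableSet_lt
        (f := fun x : Fin n → Cov p => |(n : ℝ)⁻¹ * ∑ i, x i a.1 * x i a.2 - e2 a|)
        (Measurable.abs (by fun_prop)) measurable_const
    exact m1.inter (m2.inter (m3.inter (MeasurableSet.const _)))
  · obtain ⟨-, hx1, hx2, hn⟩ := hx
    have hn' : (n : ℝ) ≠ 0 := by exact_mod_cast hn.ne'
    have hent : ∀ a b, |(sampleCov x - populationCov Q) a b| ≤ δ := fun a b => by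
      have hs := sum_centered_mul_centered Finset.univ (fun i => x i a) (fun i => x i b)
        (c := (n : ℝ)) (by simp) hn'
      have hS : sampleCov x a b = (n : ℝ)⁻¹ * ∑ i, x i a * x i b -
          ((n : ℝ)⁻¹ * ∑ i, x i a) * ((n : ℝ)⁻¹ * ∑ i, x i b) := by
        simp only [sampleCov, sampleMean, Matrix.smul_apply, Matrix.sum_apply,
          Matrix.vecMulVec_apply, WithLp.ofLp_sub, Pi.sub_apply, WithLp.ofLp_smul, Pi.smul_apply,
          WithLp.ofLp_sum, Finset.sum_apply, smul_eq_mul]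
        rw [hs]
        ring
      have h1 := (hx2 (a, b)).le
      have h2 := (hx1 a).le
      have h3 := (hx1 b).le
      have h4 := he1 a
      have h5 := he1 b
      simp only at h1
      rw [Matrix.sub_apply, hS]
      change |_ - (e2 (a, b) - e1 a * e1 b)| ≤ δ
      set u := (n : ℝ)⁻¹ * ∑ i, x i a
      set w := (n : ℝ)⁻¹ * ∑ i, x i b
      have e : (n : ℝ)⁻¹ * ∑ i, x i a * x i b - u * w - (e2 (a, b) - e1 a * e1 b) =
          ((n : ℝ)⁻¹ * ∑ i, x i a * x i b - e2 (a, b)) -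
          ((u - e1 a) * e1 b + e1 a * (w - e1 b) + (u - e1 a) * (w - e1 b)) := by ring
      rw [e]
      refine (abs_sub _ _).trans ?_
      have h6 : |(u - e1 a) * e1 b + e1 a * (w - e1 b) + (u - e1 a) * (w - e1 b)| ≤
          η * B + B * η + η * η := by
        refine (abs_add_three _ _ _).trans ?_
        simp only [abs_mul]
        gcongr
      linarith
    have h1 := abs_quadratic_le hent v
    have h2 : v.ofLp ⬝ᵥ (sampleCov x - populationCov Q) *ᵥ v.ofLp =
        v.ofLp ⬝ᵥ sampleCov x *ᵥ v.ofLp - v.ofLp ⬝ᵥ populationCov Q *ᵥ v.ofLp := by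
      rw [Matrix.sub_mulVec, dotProduct_sub]
    rw [h2] at h1
    have h3 := hcoer v
    have h4 := (abs_le.1 h1).1
    have h5 : δ * p ≤ l / 2 := by
      rw [hδ, div_mul_eq_mul_div, div_le_div_iff₀ (by positivity) (by positivity)]
      nlinarith
    have h6 : δ * p * ‖v‖ ^ 2 ≤ l / 2 * ‖v‖ ^ 2 := by gcongr
    push_cast
    linarith
  · have hsum : Tendsto (fun n : ℕ =>
        ∑ a : Fin p, (Measure.pi fun _ : Fin n => Q)
          {z | η ≤ |(n : ℝ)⁻¹ * ∑ i, (z i).1 a - ∫ y, y.1 a ∂Q|} +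
        ∑ a : Fin p × Fin p, (Measure.pi fun _ : Fin n => Q)
          {z | η ≤ |(n : ℝ)⁻¹ * ∑ i, (z i).1 a.1 * (z i).1 a.2 - ∫ y, y.1 a.1 * y.1 a.2 ∂Q|})
        atTop (nhds 0) := by
      have t1 := tendsto_finsetSum (Finset.univ : Finset (Fin p)) fun a _ =>
        tendsto_measure_pi_average_deviation Q (f := fun y => y.1 a) (by fun_prop) (B := B)
          (by filter_upwards [hB] with y hy using hy a) hη0
      have t2 := tendsto_finsetSum (Finset.univ : Finset (Fin p × Fin p)) fun a _ =>
        tendsto_measure_pi_average_deviation Q (f := fun y => y.1 a.1 * y.1 a.2) (by fun_prop)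
          (B := B * B) (by
            filter_upwards [hB] with y hy
            rw [abs_mul]
            exact mul_le_mul (hy _) (hy _) (abs_nonneg _) hB0.le) hη0
      simpa using t1.add t2
    refine tendsto_of_tendsto_of_tendsto_of_le_of_le' tendsto_const_nhds hsum
      (Eventually.of_forall fun n => bot_le) ?_
    filter_upwards [eventually_gt_atTop 0] with n hn
    have hX : ∀ᵐ z ∂(Measure.pi fun _ : Fin n => Q), ∀ i, (z i).1 ∈ X₀ := ae_pi_of_ae h.mem
    have hle : {z : Fin n → Cov p × Fin 2 × ℝ | covariates z ∉ G n}
        ≤ᵐ[Measure.pi fun _ : Fin n => Q]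
        ((⋃ a ∈ (Finset.univ : Finset (Fin p)),
          {z | η ≤ |(n : ℝ)⁻¹ * ∑ i, (z i).1 a - ∫ y, y.1 a ∂Q|}) ∪
        ⋃ a ∈ (Finset.univ : Finset (Fin p × Fin p)),
          {z | η ≤ |(n : ℝ)⁻¹ * ∑ i, (z i).1 a.1 * (z i).1 a.2 - ∫ y, y.1 a.1 * y.1 a.2 ∂Q|} :
            Set (Fin n → Cov p × Fin 2 × ℝ)) := by
      filter_upwards [hX] with z hz hzG
      by_contra hcon
      refine hzG ⟨fun i j => ?_, fun a => ?_, fun a => ?_, hn⟩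
      · rw [← dist_eq_norm]; exact hdiam _ (hz i) _ (hz j)
      · by_contra hc
        exact hcon (Or.inl (Set.mem_biUnion (Finset.mem_coe.2 (Finset.mem_univ a)) (not_lt.1 hc)))
      · by_contra hc
        exact hcon (Or.inr (Set.mem_biUnion (Finset.mem_coe.2 (Finset.mem_univ a)) (not_lt.1 hc)))
    refine (measure_mono_ae hle).trans ((measure_union_le _ _).trans ?_)
    exact add_le_add (measure_biUnion_finset_le _ _) (measure_biUnion_finset_le _ _)

end GoodEvents

/-! ### Decomposition of the estimator into effect, discrepancy and noise. -/

section Decomposition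

variable {p n : ℕ}

/-- The sign `2 w - 1` of a treatment. -/
def treatmentSign (w : Fin 2) : ℝ := 2 * ((w : ℕ) : ℝ) - 1

theorem abs_treatmentSign (w : Fin 2) : |treatmentSign w| = 1 := by
  fin_cases w <;> norm_num [treatmentSign]

theorem abs_policySign (π : Policy p) (x : Cov p) : |policySign π x| = 1 :=
  abs_treatmentSign (π x)

/-- The weight of the residual of unit `j` in the matching estimator, multiplied by `n`. -/
def residualWeight (M : ℕ) (π : Policy p) (X : Fin n → Cov p) (W : Fin n → Fin 2) (j : Fin n) : ℝ :=
  policySign π (X j) * treatmentSign (W j) - (1 / (M : ℝ)) *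
    ∑ i, if j ∈ matchedSet (mahalanobis X) M X W i then
      policySign π (X i) * treatmentSign (W i) else 0

/-- The matching discrepancy of unit `i`. -/
def matchingBias (M : ℕ) (π : Policy p) (m : Fin 2 → Cov p → ℝ) (X : Fin n → Cov p)
    (W : Fin n → Fin 2) (i : Fin n) : ℝ :=
  policySign π (X i) * treatmentSign (W i) * ((1 / (M : ℝ)) *
    ∑ j ∈ matchedSet (mahalanobis X) M X W i, (m (1 - W i) (X i) - m (1 - W i) (X j)))

theorem imputed_sub_imputed (M : ℕ) (X : Fin n → Cov p) (W : Fin n → Fin 2) (Y : Fin n → ℝ)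
    (i : Fin n) : imputed M X W Y i 1 - imputed M X W Y i 0 =
      treatmentSign (W i) *
        (Y i - (1 / (M : ℝ)) * ∑ j ∈ matchedSet (mahalanobis X) M X W i, Y j) := by
  unfold imputed treatmentSign
  rcases Fin.exists_fin_two.1 ⟨W i, rfl⟩ with h | h
  · simp [h]
  · norm_num [h]

/-- Replace each outcome by regression plus residual. Exactly `M` matches are needed for the average
of `m (1 - W i) (X i)` over them to reproduce this value; the regression parts then differ from the
effect at `X i` by the discrepancy. -/
theorem matchingEstimator_eq {M : ℕ} (hM : 1 ≤ M) (π : Policy p) (m : Fin 2 → Cov p → ℝ)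
    (X : Fin n → Cov p) (W : Fin n → Fin 2) (Y : Fin n → ℝ)
    (hJ : ∀ i, (matchedSet (mahalanobis X) M X W i).card = M) :
    matchingEstimator M X W Y π =
      (n : ℝ)⁻¹ * ∑ i, policySign π (X i) * (m 1 (X i) - m 0 (X i)) +
      (n : ℝ)⁻¹ * ∑ i, matchingBias M π m X W i +
      (n : ℝ)⁻¹ * ∑ j, (Y j - m (W j) (X j)) * residualWeight M π X W j := by
  have hM0 : (M : ℝ) ≠ 0 := by positivity
  rw [matchingEstimator, one_div, ← mul_add, ← mul_add]
  congr 1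
  set J := fun i => matchedSet (mahalanobis X) M X W i with hJdef
  -- Exchanging the sums over units and over their matches collects the total coefficient of each
  -- residual.
  have hnoise : ∑ j, (Y j - m (W j) (X j)) * residualWeight M π X W j =
      ∑ i, policySign π (X i) * treatmentSign (W i) *
        ((Y i - m (W i) (X i)) - (1 / (M : ℝ)) * ∑ j ∈ J i, (Y j - m (W j) (X j))) := by
    have h1 : ∑ j, (Y j - m (W j) (X j)) * ((1 / (M : ℝ)) * ∑ i, if j ∈ J i then
        policySign π (X i) * treatmentSign (W i) else 0) =
        ∑ i, policySign π (X i) * treatmentSign (W i) *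
          ((1 / (M : ℝ)) * ∑ j ∈ J i, (Y j - m (W j) (X j))) := by
      simp only [Finset.mul_sum]
      rw [Finset.sum_comm]
      refine Finset.sum_congr rfl fun i _ => ?_
      rw [← Finset.sum_filter_add_sum_filter_not Finset.univ (fun j => j ∈ J i)]
      rw [Finset.sum_eq_zero (s := Finset.univ.filter fun j => j ∉ J i) (fun j hj => by
        rw [if_neg (Finset.mem_filter.1 hj).2]; ring), add_zero]
      have : Finset.univ.filter (fun j => j ∈ J i) = J i := by ext; simp
      rw [this]
      refine Finset.sum_congr rfl fun j hj => ?_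
      rw [if_pos hj]; ring
    have h2 : ∑ i, policySign π (X i) * treatmentSign (W i) *
        ((Y i - m (W i) (X i)) - (1 / (M : ℝ)) * ∑ j ∈ J i, (Y j - m (W j) (X j))) =
        ∑ i, policySign π (X i) * treatmentSign (W i) * (Y i - m (W i) (X i)) -
        ∑ i, policySign π (X i) * treatmentSign (W i) *
          ((1 / (M : ℝ)) * ∑ j ∈ J i, (Y j - m (W j) (X j))) := by
      rw [← Finset.sum_sub_distrib]
      exact Finset.sum_congr rfl fun i _ => by ring
    rw [h2, ← h1, ← Finset.sum_sub_distrib]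
    refine Finset.sum_congr rfl fun i _ => ?_
    simp only [residualWeight, hJdef]
    ring
  rw [hnoise, ← Finset.sum_add_distrib, ← Finset.sum_add_distrib]
  refine Finset.sum_congr rfl fun i _ => ?_
  rw [imputed_sub_imputed, matchingBias]
  have hopp : ∀ j ∈ J i, m (W j) (X j) = m (1 - W i) (X j) := fun j hj => by
    rw [mem_oppositeArm.1 (matchedSet_subset _ M X W i hj)]
  have h2 : ∑ j ∈ J i, (Y j - m (W j) (X j)) = ∑ j ∈ J i, Y j - ∑ j ∈ J i, m (1 - W i) (X j) := by
    rw [Finset.sum_sub_distrib, Finset.sum_congr rfl hopp]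
  have h3 : ∑ j ∈ J i, (m (1 - W i) (X i) - m (1 - W i) (X j)) =
      M * m (1 - W i) (X i) - ∑ j ∈ J i, m (1 - W i) (X j) := by
    rw [Finset.sum_sub_distrib, Finset.sum_const, hJ i, nsmul_eq_mul]
  have h4 : m 1 (X i) - m 0 (X i) =
      treatmentSign (W i) * (m (W i) (X i) - m (1 - W i) (X i)) := by
    unfold treatmentSign
    rcases Fin.exists_fin_two.1 ⟨W i, rfl⟩ with h | h
    · simp [h]
    · norm_num [h]
  change policySign π (X i) * (treatmentSign (W i) * (Y i - 1 / (M : ℝ) * ∑ j ∈ J i, Y j)) =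
    policySign π (X i) * (m 1 (X i) - m 0 (X i)) + policySign π (X i) * treatmentSign (W i) *
      (1 / (M : ℝ) * ∑ j ∈ J i, (m (1 - W i) (X i) - m (1 - W i) (X j))) + _
  rw [h2, h3, h4]
  field_simp
  ring

/-- The number of units to which unit `j` is matched. -/
def matchCount (M : ℕ) (X : Fin n → Cov p) (W : Fin n → Fin 2) (j : Fin n) : ℕ :=
  (Finset.univ.filter fun i => j ∈ matchedSet (mahalanobis X) M X W i).card

theorem abs_residualWeight_le {M : ℕ} (hM : 1 ≤ M) (π : Policy p) (X : Fin n → Cov p)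
    (W : Fin n → Fin 2) (j : Fin n) : |residualWeight M π X W j| ≤ 1 + matchCount M X W j := by
  have hM1 : (1 : ℝ) ≤ M := by exact_mod_cast hM
  have h1 : |∑ i, if j ∈ matchedSet (mahalanobis X) M X W i then
      policySign π (X i) * treatmentSign (W i) else 0| ≤ matchCount M X W j := by
    refine (Finset.abs_sum_le_sum_abs _ _).trans (le_of_eq ?_)
    rw [matchCount, Finset.card_filter]
    push_cast
    refine Finset.sum_congr rfl fun i _ => ?_
    split_ifs
    · rw [abs_mul, abs_policySign, abs_treatmentSign, one_mul]
    · simp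
  unfold residualWeight
  refine (abs_sub _ _).trans (add_le_add ?_ ?_)
  · rw [abs_mul, abs_policySign, abs_treatmentSign, one_mul]
  · rw [abs_mul, abs_of_nonneg (by positivity)]
    refine (mul_le_of_le_one_left (abs_nonneg _) ?_).trans h1
    rw [div_le_one (by linarith)]
    exact hM1

/-- Double counting: the sum of squares equals `∑ |J i ∩ J i'|` over ordered pairs. Diagonal pairs
contribute at most `M` each, and so does each off-diagonal pair with a common match. -/
theorem sum_matchCount_sq_le (M : ℕ) (X : Fin n → Cov p) (W : Fin n → Fin 2) :
    ∑ j, matchCount M X W j ^ 2 ≤ n * M + M * ((Finset.univ : Finset (Fin n)).offDiag.filter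
      fun q => ∃ j, j ∈ matchedSet (mahalanobis X) M X W q.1 ∧
        j ∈ matchedSet (mahalanobis X) M X W q.2).card := by
  set J := fun i => matchedSet (mahalanobis X) M X W i with hJ
  have h1 : ∑ j, matchCount M X W j ^ 2 =
      ∑ q : Fin n × Fin n, (J q.1 ∩ J q.2).card := by
    have : ∀ j, matchCount M X W j ^ 2 =
        ∑ q : Fin n × Fin n, if j ∈ J q.1 ∩ J q.2 then 1 else 0 := fun j => by
      rw [matchCount, Finset.card_filter, sq, Finset.sum_mul_sum, ← Finset.sum_product',
        Finset.univ_product_univ]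
      refine Finset.sum_congr rfl fun q _ => ?_
      by_cases h1 : j ∈ J q.1 <;> by_cases h2 : j ∈ J q.2 <;> simp [hJ] at h1 h2 <;> simp [h1, h2, hJ]
    simp only [this]
    rw [Finset.sum_comm]
    refine Finset.sum_congr rfl fun q _ => ?_
    rw [← Finset.card_filter]
    congr 1
    ext j; simp
  rw [h1, ← Finset.univ_product_univ, ← Finset.diag_union_offDiag,
    Finset.sum_union (Finset.disjoint_diag_offDiag _), Finset.sum_diag]
  refine add_le_add ?_ ?_
  · calc ∑ i, (J i ∩ J i).card ≤ ∑ _i : Fin n, M := by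
          refine Finset.sum_le_sum fun i _ => ?_
          rw [Finset.inter_self]
          exact card_matchedSet_le _ M X W i
      _ = n * M := by simp
  · rw [mul_comm, Finset.card_filter, Finset.sum_mul]
    refine Finset.sum_le_sum fun q _ => ?_
    split_ifs with h
    · rw [one_mul]
      exact (Finset.card_le_card Finset.inter_subset_left).trans (card_matchedSet_le _ M X W _)
    · rw [zero_mul, Nat.le_zero, Finset.card_eq_zero]
      refine Finset.eq_empty_of_forall_notMem fun j hj => h ⟨j, ?_⟩
      simpa using hj

/-- Follows from `(1 + k)² ≤ 2 + 2 k²` and the pair count; the term `2 n` is absorbed using `M ≥ 1`.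
-/
theorem sum_residualWeight_sq_le {M : ℕ} (hM : 1 ≤ M) (π : Policy p) (X : Fin n → Cov p)
    (W : Fin n → Fin 2) :
    ∑ j, residualWeight M π X W j ^ 2 ≤ 4 * M * n + 2 * M *
      ((Finset.univ : Finset (Fin n)).offDiag.filter
        fun q => ∃ j, j ∈ matchedSet (mahalanobis X) M X W q.1 ∧
          j ∈ matchedSet (mahalanobis X) M X W q.2).card := by
  have h1 : ∑ j, residualWeight M π X W j ^ 2 ≤ ∑ j, (2 + 2 * (matchCount M X W j : ℝ) ^ 2) := by
    refine Finset.sum_le_sum fun j _ => ?_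
    have h := abs_residualWeight_le hM π X W j
    rw [← sq_abs]
    calc |residualWeight M π X W j| ^ 2 ≤ (1 + (matchCount M X W j : ℝ)) ^ 2 := by gcongr
      _ ≤ _ := by nlinarith [sq_nonneg ((matchCount M X W j : ℝ) - 1)]
  have h2 : (∑ j, (matchCount M X W j : ℝ) ^ 2) ≤ n * M + M *
      ((Finset.univ : Finset (Fin n)).offDiag.filter
        fun q => ∃ j, j ∈ matchedSet (mahalanobis X) M X W q.1 ∧
          j ∈ matchedSet (mahalanobis X) M X W q.2).card := by
    exact_mod_cast sum_matchCount_sq_le M X W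
  rw [Finset.sum_add_distrib, ← Finset.mul_sum] at h1
  simp only [Finset.sum_const, Finset.card_univ, Fintype.card_fin, nsmul_eq_mul] at h1
  have hM1 : (1 : ℝ) ≤ M := by exact_mod_cast hM
  have hn : (0 : ℝ) ≤ n := by positivity
  nlinarith

theorem measurableSet_mem_matchedSet (M : ℕ) (i j : Fin n) :
    MeasurableSet {d : Fin n → Cov p × Fin 2 | j ∈ matchedSet (mahalanobis fun i => (d i).1) M
      (fun i => (d i).1) (fun i => (d i).2) i} := by
  have hX : ∀ i, Measurable fun d : Fin n → Cov p × Fin 2 => (d i).1 := fun i => by fun_prop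
  have hN : ∀ k, Measurable fun d : Fin n → Cov p × Fin 2 =>
      matrixNorm (mahalanobis fun i => (d i).1) ((d k).1 - (d i).1) := fun k =>
    measurable_matrixNorm_inv (measurable_sampleCov hX) ((hX k).sub (hX i))
  have hW : ∀ k, MeasurableSet {d : Fin n → Cov p × Fin 2 | (d k).2 = 1 - (d i).2} := fun k =>
    measurableSet_eq_fun (f := fun d : Fin n → Cov p × Fin 2 => (d k).2)
      (g := fun d => 1 - (d i).2) (by fun_prop)
      ((measurable_of_finite fun w : Fin 2 => 1 - w).comp (by fun_prop))
  have hcard : Measurable fun d : Fin n → Cov p × Fin 2 =>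
      (Finset.univ.filter fun k => (d k).2 = 1 - (d i).2 ∧
        matrixNorm (mahalanobis fun i => (d i).1) ((d k).1 - (d i).1) ≤
        matrixNorm (mahalanobis fun i => (d i).1) ((d j).1 - (d i).1)).card := by
    simp only [Finset.card_filter]
    exact Finset.measurable_fun_sum _ fun k _ => Measurable.ite
      ((hW k).inter (measurableSet_le (hN k) (hN j))) measurable_const measurable_const
  have : {d : Fin n → Cov p × Fin 2 | j ∈ matchedSet (mahalanobis fun i => (d i).1) M
      (fun i => (d i).1) (fun i => (d i).2) i} = {d | (d j).2 = 1 - (d i).2} ∩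
      {d | (Finset.univ.filter fun k => (d k).2 = 1 - (d i).2 ∧
        matrixNorm (mahalanobis fun i => (d i).1) ((d k).1 - (d i).1) ≤
        matrixNorm (mahalanobis fun i => (d i).1) ((d j).1 - (d i).1)).card ≤ M} := by
    ext d
    simp [matchedSet]
  rw [this]
  exact (hW j).inter (hcard measurableSet_Iic)

theorem measurable_residualWeight (M : ℕ) {π : Policy p} (hπ : Measurable π) (j : Fin n) :
    Measurable fun d : Fin n → Cov p × Fin 2 =>
      residualWeight M π (fun i => (d i).1) (fun i => (d i).2) j := by
  have hs : ∀ i, Measurable fun d : Fin n → Cov p × Fin 2 =>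
      policySign π (d i).1 * treatmentSign (d i).2 := fun i =>
    ((measurable_of_finite treatmentSign).comp
      (hπ.comp (by fun_prop : Measurable fun d : Fin n → Cov p × Fin 2 => (d i).1))).mul
    ((measurable_of_finite treatmentSign).comp
      (by fun_prop : Measurable fun d : Fin n → Cov p × Fin 2 => (d i).2))
  unfold residualWeight
  exact (hs j).sub ((Finset.measurable_fun_sum _ fun i _ => Measurable.ite
    (measurableSet_mem_matchedSet M i j) (hs i) measurable_const).const_mul _)

end Decomposition

/-! ### Deterministic bounds for shared matches and discrepancies. -/

section Bounds

variable {p n : ℕ} {Q : Measure (Cov p × Fin 2 × ℝ)} [IsProbabilityMeasure Q] {X₀ : Set (Cov p)}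
  {m : Fin 2 → Cov p → ℝ}

/-- By the triangle inequality the two units are within twice the larger of their distances to the
common match. Each distance is bounded by a radius that ignores the other unit, as the independence
argument requires. -/
theorem edist_pow_le_or_of_common_match {X : Fin n → Cov p} {W : Fin n → Fin 2} {M : ℕ} {R κ : ℝ≥0}
    (hmatch : ∀ i j i', j ∈ matchedSet (mahalanobis X) M X W i →
      edist (X j) (X i) ^ p ≤ (κ : ℝ≥0∞) ^ p * matchingRadius R M X W i i') {i i' j : Fin n}
    (hi : j ∈ matchedSet (mahalanobis X) M X W i) (hi' : j ∈ matchedSet (mahalanobis X) M X W i') :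
    edist (X i') (X i) ^ p ≤ ((2 * κ) ^ p : ℝ≥0) * matchingRadius R M X W i i' ∨
      edist (X i) (X i') ^ p ≤ ((2 * κ) ^ p : ℝ≥0) * matchingRadius R M X W i' i := by
  have h1 := hmatch i j i' hi
  have h2 := hmatch i' j i hi'
  have htri : edist (X i') (X i) ≤ edist (X j) (X i') + edist (X j) (X i) := by
    rw [edist_comm (X j) (X i')]; exact edist_triangle _ _ _
  have hK : (((2 * κ) ^ p : ℝ≥0) : ℝ≥0∞) = 2 ^ p * (κ : ℝ≥0∞) ^ p := by
    rw [← mul_pow]; push_cast; rfl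
  rcases le_total (edist (X j) (X i')) (edist (X j) (X i)) with h | h
  · left
    calc edist (X i') (X i) ^ p ≤ (2 * edist (X j) (X i)) ^ p := by
          gcongr
          rw [two_mul]
          exact htri.trans (by gcongr)
      _ ≤ 2 ^ p * ((κ : ℝ≥0∞) ^ p * matchingRadius R M X W i i') := by
          rw [mul_pow]; gcongr
      _ = _ := by rw [hK, mul_assoc]
  · right
    rw [edist_comm]
    calc edist (X i') (X i) ^ p ≤ (2 * edist (X j) (X i')) ^ p := by
          gcongr
          rw [two_mul]
          exact htri.trans (by gcongr)
      _ ≤ 2 ^ p * ((κ : ℝ≥0∞) ^ p * matchingRadius R M X W i' i) := by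
          rw [mul_pow]; gcongr
      _ = _ := by rw [hK, mul_assoc]

theorem abs_matchingBias_pow_le (hp : 1 ≤ p) {X : Fin n → Cov p} {W : Fin n → Fin 2} {M : ℕ}
    {L : ℝ≥0} (hL : ∀ w, LipschitzWith L (m w)) (π : Policy p) {i : Fin n} {t : ℝ} (ht : 0 ≤ t)
    (hmatch : ∀ j ∈ matchedSet (mahalanobis X) M X W i, dist (X j) (X i) ^ p ≤ t) :
    |matchingBias M π m X W i| ^ p ≤ (L : ℝ) ^ p * t := by
  have hp0 : p ≠ 0 := by omega
  set r : ℝ := t ^ (p : ℝ)⁻¹ with hr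
  have hr0 : 0 ≤ r := Real.rpow_nonneg ht _
  have hrp : r ^ p = t := Real.rpow_inv_natCast_pow ht hp0
  have h1 : |matchingBias M π m X W i| ≤ L * r := by
    rw [matchingBias, abs_mul, abs_mul, abs_policySign, abs_treatmentSign, one_mul, one_mul,
      abs_mul, abs_of_nonneg (by positivity)]
    calc 1 / (M : ℝ) * |∑ j ∈ matchedSet (mahalanobis X) M X W i,
            (m (1 - W i) (X i) - m (1 - W i) (X j))|
        ≤ 1 / (M : ℝ) * ∑ j ∈ matchedSet (mahalanobis X) M X W i, L * r := by
          gcongr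
          refine (Finset.abs_sum_le_sum_abs _ _).trans (Finset.sum_le_sum fun j hj => ?_)
          rw [← Real.dist_eq]
          refine ((hL _).dist_le_mul _ _).trans ?_
          gcongr
          refine le_of_pow_le_pow_left₀ hp0 hr0 ?_
          rw [hrp, dist_comm]
          exact hmatch j hj
      _ ≤ 1 / (M : ℝ) * (M * (L * r)) := by
          rw [Finset.sum_const, nsmul_eq_mul]
          gcongr
          exact card_matchedSet_le _ M X W i
      _ ≤ L * r := by
          rcases Nat.eq_zero_or_pos M with rfl | hM
          · simp; positivity
          · have : (M : ℝ) ≠ 0 := by positivity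
            field_simp
            exact le_rfl
  calc |matchingBias M π m X W i| ^ p ≤ (L * r) ^ p := by gcongr
    _ = _ := by rw [mul_pow, hrp]

/-- Jensen's inequality: it allows the mean discrepancy to be controlled through `p`-th powers, the
scale on which radii have mean of order `1 / n`. -/
theorem abs_average_pow_le (hn : 0 < n) (f : Fin n → ℝ) (k : ℕ) :
    |(n : ℝ)⁻¹ * ∑ i, f i| ^ k ≤ (n : ℝ)⁻¹ * ∑ i, |f i| ^ k := by
  have hn' : (n : ℝ) ≠ 0 := by positivity
  have h := Real.pow_arith_mean_le_arith_mean_pow Finset.univ (fun _ : Fin n => (n : ℝ)⁻¹)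
    (fun i => |f i|) (fun _ _ => by positivity) (by simp [hn']) (fun _ _ => abs_nonneg _) k
  simp only [← Finset.mul_sum] at h
  refine le_trans ?_ h
  rw [abs_mul, abs_of_nonneg (by positivity)]
  gcongr
  exact Finset.abs_sum_le_sum_abs _ _

end Bounds

/-! ### Probabilistic orders of the discrepancy and of the noise. -/

section StochasticBounds

open Matrix

variable {p : ℕ} {Q : Measure (Cov p × Fin 2 × ℝ)} {X₀ : Set (Cov p)} {m : Fin 2 → Cov p → ℝ}

/-- The sample covariance is bounded below by `l` and above by `R ^ 2`, so the norm of its inverse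
distorts the order of Euclidean lengths by a factor at most `R ^ 2 / l`. -/
theorem edist_pow_le_of_coercive {n : ℕ} {X : Fin n → Cov p} {R l : ℝ≥0} (hR : 0 < R) (hl : 0 < l)
    (hX : ∀ i j, ‖X i - X j‖ ≤ R)
    (hS : ∀ v : Cov p, l * ‖v‖ ^ 2 ≤ v.ofLp ⬝ᵥ sampleCov X *ᵥ v.ofLp) (M : ℕ) (W : Fin n → Fin 2)
    (i j i' : Fin n) (hj : j ∈ matchedSet (mahalanobis X) M X W i) :
    edist (X j) (X i) ^ p ≤
      ((max 1 (R ^ 2 / l) : ℝ≥0) : ℝ≥0∞) ^ p * matchingRadius R M X W i i' := by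
  refine edist_pow_le_matchingRadius (mahalanobis X) M X W (le_max_left _ _) (fun i j => ?_)
    (fun a b hab => ?_) hj i'
  · rw [edist_eq_enorm_sub, ← ofReal_norm]
    exact (ENNReal.ofReal_le_ofReal (hX i j)).trans (by simp)
  · refine (enorm_le_of_matrixNorm_inv_le hl (by positivity : 0 < R ^ 2) hS (fun v => ?_) a b
      hab).trans ?_
    · have := norm_sampleCov_mulVec_le hX v
      simpa using this
    · gcongr
      exact le_max_right _ _

variable [IsProbabilityMeasure Q]

theorem IsRegularLaw.exists_lintegral_matchingRadius_le (h : IsRegularLaw Q X₀ m) (hp : 1 ≤ p)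
    {R : ℝ≥0} (hR : 0 < R) (hdiam : ∀ x ∈ X₀, ∀ y ∈ X₀, dist x y ≤ R) {M : ℕ} (hM : 1 ≤ M) :
    ∃ C : ℝ, 0 < C ∧ ∀ n : ℕ, 6 * M ≤ n → ∀ i i' : Fin n,
      ∫⁻ z, matchingRadius R M (covariates z) (treatments z) i i'
        ∂(Measure.pi fun _ : Fin n => Q) ≤ ENNReal.ofReal (C / n) := by
  obtain ⟨θ, hθ, hlow⟩ := h.exists_ball_lower hp hR hdiam
  have : (0 : ℝ) < M := by exact_mod_cast hM
  exact ⟨2 * M ^ 2 / θ, by positivity, fun n hn i i' =>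
    lintegral_matchingRadius_le hθ h.mem hlow hM hn i i'⟩

/-- The average matching discrepancy is of order `n ^ (-1/p)` in probability. -/
theorem IsRegularLaw.exists_bias_bound (h : IsRegularLaw Q X₀ m) (hp : 1 ≤ p)
    {R l : ℝ≥0} (hR : 0 < R) (hl : 0 < l) (hdiam : ∀ x ∈ X₀, ∀ y ∈ X₀, dist x y ≤ R) {M : ℕ}
    (hM : 1 ≤ M) {G : ∀ n : ℕ, Set (Fin n → Cov p)}
    (hG : ∀ n, ∀ x ∈ G n, (∀ i j, ‖x i - x j‖ ≤ R) ∧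
        ∀ v : Cov p, l * ‖v‖ ^ 2 ≤ v.ofLp ⬝ᵥ sampleCov x *ᵥ v.ofLp) (π : Policy p) :
    ∃ D : ℝ, 0 ≤ D ∧ ∀ n : ℕ, 6 * M ≤ n → ∀ A : ℝ, 0 < A →
      (Measure.pi fun _ : Fin n => Q) {z | covariates z ∈ G n ∧ A < n *
        |(n : ℝ)⁻¹ * ∑ i, matchingBias M π m (covariates z) (treatments z) i| ^ p} ≤
      ENNReal.ofReal (D / A) := by
  obtain ⟨C, hC, hT⟩ := h.exists_lintegral_matchingRadius_le hp hR hdiam hM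
  obtain ⟨L, hL⟩ := h.lipschitz
  set κ : ℝ≥0 := max 1 (R ^ 2 / l) with hκ
  set K : ℝ≥0 := L ^ p * κ ^ p with hK
  refine ⟨K * C, by positivity, fun n hn A hA => ?_⟩
  have hn0 : 0 < n := by omega
  have hn' : (0 : ℝ) < n := by exact_mod_cast hn0
  set μ := Measure.pi fun _ : Fin n => Q
  -- On good designs `F` dominates `n` times the `p`-th power of the mean discrepancy, and its mean
  -- is bounded uniformly in `n`; Markov's inequality concludes. No second unit has to be left out,
  -- hence the repeated index `i i`.
  set F : (Fin n → Cov p × Fin 2 × ℝ) → ℝ≥0∞ := fun z =>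
    K * ∑ i, matchingRadius R M (covariates z) (treatments z) i i with hF
  have hFm : Measurable F := by
    rw [hF]
    exact (Finset.measurable_fun_sum _ fun i _ => measurable_matchingRadius _ M i i).const_mul _
  have hFint : ∫⁻ z, F z ∂μ ≤ ENNReal.ofReal (K * C) := by
    rw [hF, lintegral_const_mul _
      (Finset.measurable_fun_sum _ fun i _ => measurable_matchingRadius _ M i i),
      lintegral_finsetSum _ fun i _ => measurable_matchingRadius _ M i i]
    calc (K : ℝ≥0∞) * ∑ i : Fin n, ∫⁻ z, matchingRadius R M (covariates z) (treatments z) i i ∂μ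
        ≤ K * ∑ _i : Fin n, ENNReal.ofReal (C / n) := by
          gcongr with i _
          exact hT n hn i i
      _ = ENNReal.ofReal (K * C) := by
          rw [Finset.sum_const, Finset.card_univ, Fintype.card_fin, ← ENNReal.ofReal_nsmul,
            ENNReal.ofReal_mul (by positivity), ENNReal.ofReal_coe_nnreal]
          congr 2
          simp
          field_simp
  have hsub : {z | covariates z ∈ G n ∧ A < n *
      |(n : ℝ)⁻¹ * ∑ i, matchingBias M π m (covariates z) (treatments z) i| ^ p} ⊆
      {z | ENNReal.ofReal A ≤ F z} := by
    rintro z ⟨hz, hzA⟩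
    obtain ⟨hz1, hz2⟩ := hG n _ hz
    have hmatch := edist_pow_le_of_coercive hR hl hz1 hz2 M (treatments z)
    have htop : ∀ i, (κ : ℝ≥0∞) ^ p * matchingRadius R M (covariates z) (treatments z) i i ≠ ⊤ :=
      fun i => ENNReal.mul_ne_top (by simp) (matchingRadius_ne_top _ _ _ _)
    set t : Fin n → ℝ := fun i =>
      ((κ : ℝ≥0∞) ^ p * matchingRadius R M (covariates z) (treatments z) i i).toReal with ht
    have hb : ∀ i, |matchingBias M π m (covariates z) (treatments z) i| ^ p ≤ (L : ℝ) ^ p * t i := by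
      intro i
      refine abs_matchingBias_pow_le hp hL π ENNReal.toReal_nonneg fun j hj => ?_
      have h1 := ENNReal.toReal_mono (htop i) (hmatch i j i hj)
      rwa [ENNReal.toReal_pow, edist_dist, ENNReal.toReal_ofReal dist_nonneg] at h1
    have h2 : (n : ℝ) * |(n : ℝ)⁻¹ *
        ∑ i, matchingBias M π m (covariates z) (treatments z) i| ^ p ≤
        ∑ i, (L : ℝ) ^ p * t i := by
      calc _ ≤ (n : ℝ) * ((n : ℝ)⁻¹ *
            ∑ i, |matchingBias M π m (covariates z) (treatments z) i| ^ p) := by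
            gcongr; exact abs_average_pow_le hn0 _ p
        _ = ∑ i, |matchingBias M π m (covariates z) (treatments z) i| ^ p :=
            mul_inv_cancel_left₀ hn'.ne' _
        _ ≤ _ := Finset.sum_le_sum fun i _ => hb i
    have h3 : F z = ENNReal.ofReal (∑ i, (L : ℝ) ^ p * t i) := by
      rw [ENNReal.ofReal_sum_of_nonneg fun i _ => by positivity]
      change (K : ℝ≥0∞) * ∑ i, matchingRadius R M (covariates z) (treatments z) i i = _
      rw [Finset.mul_sum]
      refine Finset.sum_congr rfl fun i _ => ?_
      rw [ENNReal.ofReal_mul (by positivity), ht, ENNReal.ofReal_toReal (htop i), hK,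
        ENNReal.ofReal_pow (by positivity), ENNReal.ofReal_coe_nnreal]
      push_cast
      ring
    change ENNReal.ofReal A ≤ F z
    rw [h3]
    exact ENNReal.ofReal_le_ofReal (hzA.le.trans h2)
  refine (measure_mono hsub).trans ?_
  have hmk := meas_ge_le_lintegral_div (μ := μ) hFm.aemeasurable
    (ε := ENNReal.ofReal A) (by simpa using hA) ENNReal.ofReal_ne_top
  refine hmk.trans ?_
  rw [ENNReal.ofReal_div_of_pos hA]
  gcongr

/-- The averaged residual term is of order `n ^ (-1/2)` in probability. -/
theorem IsRegularLaw.exists_noise_bound (h : IsRegularLaw Q X₀ m) (hp : 1 ≤ p)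
    {R l : ℝ≥0} (hR : 0 < R) (hl : 0 < l) (hdiam : ∀ x ∈ X₀, ∀ y ∈ X₀, dist x y ≤ R) {M : ℕ}
    (hM : 1 ≤ M) {G : ∀ n : ℕ, Set (Fin n → Cov p)} (hGm : ∀ n, MeasurableSet (G n))
    (hG : ∀ n, ∀ x ∈ G n, (∀ i j, ‖x i - x j‖ ≤ R) ∧
        ∀ v : Cov p, l * ‖v‖ ^ 2 ≤ v.ofLp ⬝ᵥ sampleCov x *ᵥ v.ofLp) {π : Policy p}
    (hπ : Measurable π) :
    ∃ D : ℝ, 0 ≤ D ∧ ∀ n : ℕ, 6 * M ≤ n → ∀ A : ℝ, 0 < A →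
      (Measure.pi fun _ : Fin n => Q) {z | covariates z ∈ G n ∧ A / √n < |(n : ℝ)⁻¹ *
        ∑ j, regressionResidual m (z j) *
          residualWeight M π (covariates z) (treatments z) j|} ≤ ENNReal.ofReal (D / A ^ 2) := by
  classical
  obtain ⟨C, hC, hT⟩ := h.exists_lintegral_matchingRadius_le hp hR hdiam hM
  obtain ⟨b, hb⟩ := h.upper
  obtain ⟨V, hV⟩ := h.variance_le
  set κ : ℝ≥0 := max 1 (R ^ 2 / l) with hκ
  set K : ℝ≥0 := (2 * κ) ^ p with hK
  set ω : ℝ≥0 := (volume (Metric.ball (0 : Cov p) 1)).toNNReal with hω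
  have hω' : volume (Metric.ball (0 : Cov p) 1) = ω :=
    (ENNReal.coe_toNNReal measure_ball_lt_top.ne).symm
  -- `E * n` bounds the expected sum of squared weights: `4 M` comes from single units, the rest
  -- from at most `n ^ 2` pairs, each close in one of two directions with probability at most `b K ω
  -- C / n` per direction.
  set E : ℝ := 4 * M + 2 * M * (2 * (b * K * ω * C)) with hE
  have hE0 : 0 ≤ E := by positivity
  refine ⟨V * E, by positivity, fun n hn A hA => ?_⟩
  have hn0 : 0 < n := by omega
  have hn' : (0 : ℝ) < n := by exact_mod_cast hn0
  set μ := Measure.pi fun _ : Fin n => Q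
  -- The weights are set to zero off the good designs, where their squares are not controlled. They
  -- remain functions of the design; the crude bound `1 + n` serves only integrability.
  set a : Fin n → (Fin n → Cov p × Fin 2) → ℝ := fun j d =>
    if (fun i => (d i).1) ∈ G n then
      residualWeight M π (fun i => (d i).1) (fun i => (d i).2) j else 0 with ha
  have ham : ∀ j, Measurable (a j) := fun j =>
    Measurable.ite ((by fun_prop : Measurable fun d : Fin n → Cov p × Fin 2 => fun i => (d i).1)
      (hGm n)) (measurable_residualWeight M hπ j) measurable_const
  have haB : ∀ j d, |a j d| ≤ 1 + n := fun j d => by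
    simp only [ha]
    split_ifs
    · refine (abs_residualWeight_le hM π _ _ j).trans ?_
      gcongr
      refine (Finset.card_le_univ _).trans (by simp)
    · simp; positivity
  have hsq := lintegral_sq_sum_residual_le h hV ham haB
  set close : Fin n × Fin n → Set (Fin n → Cov p × Fin 2 × ℝ) := fun q =>
    {z | edist (z q.2).1 (z q.1).1 ^ p ≤
      K * matchingRadius R M (covariates z) (treatments z) q.1 q.2} with hclose
  have hclosem : ∀ q, MeasurableSet (close q) := fun q =>
    measurableSet_le (f := fun z : Fin n → Cov p × Fin 2 × ℝ => edist (z q.2).1 (z q.1).1 ^ p)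
      (by fun_prop) ((measurable_matchingRadius _ M _ _).const_mul _)
  have hcloseμ : ∀ q ∈ (Finset.univ : Finset (Fin n)).offDiag,
      μ (close q) ≤ ENNReal.ofReal (b * K * ω * C / n) := fun q hq => by
    refine (measure_close_pair_le hp hb (Finset.mem_offDiag.1 hq).2.2 K).trans ?_
    rw [hω', mul_div_assoc, ENNReal.ofReal_mul (by positivity)]
    refine mul_le_mul' (le_of_eq ?_) (hT n hn _ _)
    rw [← NNReal.coe_mul, ← NNReal.coe_mul, ENNReal.ofReal_coe_nnreal]
    push_cast; rfl
  -- Both orientations of a pair are counted, since it is unknown which of the two radii covers it.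
  set N : (Fin n → Cov p × Fin 2 × ℝ) → ℝ≥0∞ := fun z =>
    ∑ q ∈ (Finset.univ : Finset (Fin n)).offDiag,
      ((close q).indicator 1 z + (close q.swap).indicator 1 z) with hN
  have hpoint : ∀ z, ∑ j, ENNReal.ofReal (a j (designPart z) ^ 2) ≤
      ENNReal.ofReal (4 * M * n) + ENNReal.ofReal (2 * M) * N z := fun z => by
    rw [← ENNReal.ofReal_sum_of_nonneg fun j _ => sq_nonneg _]
    by_cases hz : covariates z ∈ G n
    swap
    · have : ∀ j, a j (designPart z) = 0 := fun j => if_neg hz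
      rw [Finset.sum_eq_zero fun j _ => by rw [this j, sq, zero_mul], ENNReal.ofReal_zero]
      exact zero_le
    have hz' : ∀ j, a j (designPart z) =
        residualWeight M π (covariates z) (treatments z) j := fun j => if_pos hz
    simp only [hz']
    obtain ⟨hz1, hz2⟩ := hG n _ hz
    have hmatch := edist_pow_le_of_coercive hR hl hz1 hz2 M (treatments z)
    refine (ENNReal.ofReal_le_ofReal
      (sum_residualWeight_sq_le hM π (covariates z) (treatments z))).trans ?_
    rw [ENNReal.ofReal_add (by positivity) (mul_nonneg (by positivity) (Nat.cast_nonneg _)),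
      ENNReal.ofReal_mul (p := 2 * (M : ℝ)) (by positivity)]
    gcongr
    rw [ENNReal.ofReal_natCast, Finset.card_filter]
    push_cast
    refine Finset.sum_le_sum fun q _ => ?_
    split_ifs with hq
    · obtain ⟨j, hj1, hj2⟩ := hq
      rcases edist_pow_le_or_of_common_match hmatch hj1 hj2 with h1 | h1
      · have : z ∈ close q := h1
        simp [this]
      · have : z ∈ close q.swap := h1
        simp [this]
    · exact bot_le
  have hpair : ∀ q : Fin n × Fin n, Measurable fun z : Fin n → Cov p × Fin 2 × ℝ =>
      ((close q).indicator 1 z + (close q.swap).indicator 1 z : ℝ≥0∞) := fun q =>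
    (measurable_one.indicator (hclosem q)).add (measurable_one.indicator (hclosem q.swap))
  have hNm : Measurable N := Finset.measurable_fun_sum _ fun q _ => hpair q
  have hNint : ∫⁻ z, N z ∂μ ≤ ENNReal.ofReal (2 * (b * K * ω * C) * n) := by
    rw [hN, lintegral_finsetSum _ fun q _ => hpair q]
    calc _ ≤ ∑ _q ∈ (Finset.univ : Finset (Fin n)).offDiag,
          ENNReal.ofReal (2 * (b * K * ω * C / n)) := by
          refine Finset.sum_le_sum fun q hq => ?_
          have hq' : q.swap ∈ (Finset.univ : Finset (Fin n)).offDiag := by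
            simp only [Finset.mem_offDiag, Finset.mem_univ, true_and, Prod.fst_swap,
              Prod.snd_swap] at hq ⊢
            exact fun h => hq h.symm
          rw [lintegral_add_left (measurable_one.indicator (hclosem q)),
            lintegral_indicator_one (hclosem q), lintegral_indicator_one (hclosem q.swap),
            two_mul, ENNReal.ofReal_add (by positivity) (by positivity)]
          exact add_le_add (hcloseμ q hq) (hcloseμ _ hq')
      _ ≤ ENNReal.ofReal (2 * (b * K * ω * C) * n) := by
          rw [Finset.sum_const, ← ENNReal.ofReal_nsmul, Finset.offDiag_card]
          refine ENNReal.ofReal_le_ofReal ?_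
          simp only [Finset.card_univ, Fintype.card_fin, nsmul_eq_mul]
          calc ((n * n - n : ℕ) : ℝ) * (2 * (b * K * ω * C / n))
              ≤ ((n * n : ℕ) : ℝ) * (2 * (b * K * ω * C / n)) := by
                gcongr; exact Nat.sub_le _ _
            _ = _ := by push_cast; field_simp
  have hweights : ∑ j, ∫⁻ z, ENNReal.ofReal (a j (designPart z) ^ 2) ∂μ ≤
      ENNReal.ofReal (E * n) := by
    have hw : ∀ j, Measurable fun z : Fin n → Cov p × Fin 2 × ℝ =>
        ENNReal.ofReal (a j (designPart z) ^ 2) := fun j =>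
      (((ham j).comp measurable_designPart).pow_const 2).ennreal_ofReal
    rw [← lintegral_finsetSum _ fun j _ => hw j]
    refine (lintegral_mono hpoint).trans ?_
    rw [lintegral_add_left measurable_const, lintegral_const_mul _ hNm]
    calc _ ≤ ENNReal.ofReal (4 * M * n) +
          ENNReal.ofReal (2 * M) * ENNReal.ofReal (2 * (b * K * ω * C) * n) := by
          gcongr
          simp
      _ = ENNReal.ofReal (E * n) := by
          rw [← ENNReal.ofReal_mul (by positivity),
            ← ENNReal.ofReal_add (by positivity) (by positivity)]
          congr 1
          rw [hE]; ring
  set S : (Fin n → Cov p × Fin 2 × ℝ) → ℝ := fun z =>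
    ∑ j, regressionResidual m (z j) * a j (designPart z) with hS
  have hSm : Measurable S := Finset.measurable_fun_sum _ fun j _ =>
    (h.measurable_residual.comp (measurable_pi_apply j)).mul ((ham j).comp measurable_designPart)
  have hsub : {z | covariates z ∈ G n ∧ A / √n < |(n : ℝ)⁻¹ *
      ∑ j, regressionResidual m (z j) * residualWeight M π (covariates z) (treatments z) j|} ⊆
      {z | ENNReal.ofReal (A ^ 2 * n) ≤ ENNReal.ofReal (S z ^ 2)} := by
    rintro z ⟨hz, hzA⟩
    have hz' : ∀ j, a j (designPart z) =
        residualWeight M π (covariates z) (treatments z) j := fun j => if_pos hz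
    simp only [← hz'] at hzA
    change A / √n < |(n : ℝ)⁻¹ * S z| at hzA
    refine ENNReal.ofReal_le_ofReal ?_
    have h1 : (A / √n) ^ 2 ≤ ((n : ℝ)⁻¹ * S z) ^ 2 := by
      rw [← sq_abs ((n : ℝ)⁻¹ * S z)]
      exact pow_le_pow_left₀ (by positivity) hzA.le 2
    rw [div_pow, Real.sq_sqrt hn'.le, mul_pow, inv_pow] at h1
    have h2 := mul_le_mul_of_nonneg_left h1 (by positivity : (0 : ℝ) ≤ (n : ℝ) ^ 2)
    rw [mul_inv_cancel_left₀ (by positivity)] at h2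
    refine le_trans (le_of_eq ?_) h2
    field_simp
  refine (measure_mono hsub).trans ?_
  have hpos : 0 < A ^ 2 * n := by positivity
  refine (meas_ge_le_lintegral_div (μ := μ) (hSm.pow_const 2).ennreal_ofReal.aemeasurable
    (ε := ENNReal.ofReal (A ^ 2 * n)) (by simpa using hpos) ENNReal.ofReal_ne_top).trans ?_
  calc _ ≤ (V * ENNReal.ofReal (E * n)) / ENNReal.ofReal (A ^ 2 * n) := by
        gcongr
        refine hsq.trans ?_
        gcongr
    _ = ENNReal.ofReal (V * E / A ^ 2) := by
        rw [← ENNReal.ofReal_coe_nnreal, ← ENNReal.ofReal_mul (by positivity),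
          ← ENNReal.ofReal_div_of_pos hpos]
        congr 1
        field_simp

end StochasticBounds

/-! ### Assembly of the rate for a regular law. -/

section Rate

open Matrix

variable {p : ℕ} {Q : Measure (Cov p × Fin 2 × ℝ)} {X₀ : Set (Cov p)} {m : Fin 2 → Cov p → ℝ}

theorem measurable_policySign {π : Policy p} (hπ : Measurable π) : Measurable (policySign π) :=
  (measurable_of_finite treatmentSign).comp hπ

theorem ne_of_mem_oppositeArm {n : ℕ} {W : Fin n → Fin 2} {i j : Fin n} (hj : j ∈ oppositeArm W i) :
    i ≠ j := by
  rintro rfl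
  have h := mem_oppositeArm.1 hj
  revert h
  generalize W i = w
  revert w
  decide

theorem exists_tail_constant {D δ : ℝ} (hD : 0 ≤ D) (hδ : 0 < δ) :
    ∃ A : ℝ, 1 ≤ A ∧ D / A ≤ δ ∧ D / A ^ 2 ≤ δ := by
  have hA : 1 ≤ D / δ + 1 := by have : 0 ≤ D / δ := by positivity
                                linarith
  have h1 : D / (D / δ + 1) ≤ δ := by
    rw [div_le_iff₀ (by linarith)]
    have : δ * (D / δ) = D := by field_simp
    nlinarith
  refine ⟨D / δ + 1, hA, h1, le_trans ?_ h1⟩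
  gcongr
  nlinarith

theorem inv_sqrt_le_rate {n : ℕ} (hn : 1 ≤ n) (p : ℕ) :
    1 / √(n : ℝ) ≤ (n : ℝ) ^ (-(1 / (max 2 p : ℕ) : ℝ)) := by
  have hn' : (1 : ℝ) ≤ n := by exact_mod_cast hn
  rw [Real.sqrt_eq_rpow, one_div, ← Real.rpow_neg (by positivity)]
  refine Real.rpow_le_rpow_of_exponent_le hn' ?_
  have : (2 : ℝ) ≤ (max 2 p : ℕ) := by exact_mod_cast le_max_left 2 p
  rw [neg_le_neg_iff]
  exact one_div_le_one_div_of_le (by norm_num) this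

theorem rpow_inv_le_rate {n : ℕ} (hn : 1 ≤ n) (hp : 1 ≤ p) :
    (n : ℝ) ^ (-(1 / p : ℝ)) ≤ (n : ℝ) ^ (-(1 / (max 2 p : ℕ) : ℝ)) := by
  have hn' : (1 : ℝ) ≤ n := by exact_mod_cast hn
  refine Real.rpow_le_rpow_of_exponent_le hn' ?_
  have hp' : (0 : ℝ) < p := by exact_mod_cast hp
  have : (p : ℝ) ≤ (max 2 p : ℕ) := by exact_mod_cast le_max_right 2 p
  rw [neg_le_neg_iff]
  exact one_div_le_one_div_of_le hp' this

theorem IsRegularLaw.exists_effect_bound (h : IsRegularLaw Q X₀ m) (π : Policy p) :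
    ∃ B : ℝ, ∀ᵐ y ∂Q, |policySign π y.1 * (m 1 y.1 - m 0 y.1)| ≤ B := by
  obtain ⟨L, hL⟩ := h.lipschitz
  obtain ⟨B, hB⟩ := h.isCompact.exists_bound_of_continuousOn
    ((hL 1).continuous.sub (hL 0).continuous).continuousOn
  refine ⟨B, ?_⟩
  filter_upwards [h.mem] with y hy
  rw [abs_mul, abs_policySign, one_mul]
  exact hB _ hy

variable [IsProbabilityMeasure Q]

/-- The matching estimator of the advantage attains the rate `n ^ (-1 / max 2 p)`. -/
theorem IsRegularLaw.matching_rate (h : IsRegularLaw Q X₀ m) (hp : 1 ≤ p) {M : ℕ} (hM : 1 ≤ M)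
    {π : Policy p} (hπ : Measurable π) {ε : ℝ} (hε : 0 < ε) :
    ∃ C : ℝ, 0 < C ∧ ∀ᶠ n : ℕ in atTop, (Measure.pi fun _ : Fin n => Q)
      {z | C * (n : ℝ) ^ (-(1 / (max 2 p : ℕ) : ℝ)) <
        |matchingEstimator M (covariates z) (treatments z) (fun i => (z i).2.2) π -
          ∫ y, policySign π y.1 * (m 1 y.1 - m 0 y.1) ∂Q|} ≤ ENNReal.ofReal ε := by
  obtain ⟨R, hR, hdiam⟩ := h.exists_diameter
  obtain ⟨l, hl, G, hGm, hG, hGlim⟩ := h.exists_good_designs hdiam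
  obtain ⟨B, hB⟩ := h.exists_effect_bound π
  obtain ⟨D2, hD2, hbias⟩ := h.exists_bias_bound hp hR hl hdiam hM hG π
  obtain ⟨D3, hD3, hnoise⟩ := h.exists_noise_bound hp hR hl hdiam hM hGm hG hπ
  -- There are five exceptional events: a bad design, a small arm, and a large value of each of the
  -- three terms.
  set δ : ℝ := ε / 5 with hδ
  have hδ0 : 0 < δ := by positivity
  obtain ⟨A1, hA1, -, hA1'⟩ := exists_tail_constant (sq_nonneg B) hδ0
  obtain ⟨A2, hA2, hA2', -⟩ := exists_tail_constant hD2 hδ0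
  obtain ⟨A3, hA3, -, hA3'⟩ := exists_tail_constant hD3 hδ0
  have hgm : Measurable fun y : Cov p × Fin 2 × ℝ => policySign π y.1 * (m 1 y.1 - m 0 y.1) :=
    ((measurable_policySign hπ).comp measurable_fst).mul
      (((h.measurable 1).comp measurable_fst).sub ((h.measurable 0).comp measurable_fst))
  have hδE : 0 < ENNReal.ofReal δ := by simpa using hδ0
  refine ⟨A1 + A2 + A3, by linarith, ?_⟩
  -- This makes the scatter matrix of the remaining points invertible, as `ae_no_tie` requires.
  have hlarge : ∀ᶠ n : ℕ in atTop, (R : ℝ) ^ 2 < n * l :=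
    (Tendsto.atTop_mul_const (show (0 : ℝ) < l from hl)
      tendsto_natCast_atTop_atTop).eventually_gt_atTop _
  filter_upwards [eventually_ge_atTop (6 * M), hlarge, hGlim.eventually_le_const hδE,
    (h.tendsto_measure_small_arm M).eventually_le_const hδE] with n hn hnl hG1 harm
  have hn0 : 0 < n := by omega
  have hn' : (0 : ℝ) < n := by exact_mod_cast hn0
  have hsqrt : 0 < √(n : ℝ) := Real.sqrt_pos.2 hn'
  set μ := Measure.pi fun _ : Fin n => Q
  set θ := ∫ y, policySign π y.1 * (m 1 y.1 - m 0 y.1) ∂Q with hθ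
  set r : ℝ := (n : ℝ) ^ (-(1 / (max 2 p : ℕ) : ℝ)) with hr
  set E1 : Set (Fin n → Cov p × Fin 2 × ℝ) := {z | A1 / √n ≤
    |(n : ℝ)⁻¹ * ∑ i, policySign π (z i).1 * (m 1 (z i).1 - m 0 (z i).1) - θ|} with hE1
  set E2 : Set (Fin n → Cov p × Fin 2 × ℝ) := {z | covariates z ∈ G n ∧ A2 < n *
    |(n : ℝ)⁻¹ * ∑ i, matchingBias M π m (covariates z) (treatments z) i| ^ p} with hE2
  set E3 : Set (Fin n → Cov p × Fin 2 × ℝ) := {z | covariates z ∈ G n ∧ A3 / √n < |(n : ℝ)⁻¹ *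
    ∑ j, regressionResidual m (z j) * residualWeight M π (covariates z) (treatments z) j|} with hE3
  have hE1le : μ E1 ≤ ENNReal.ofReal δ := by
    refine (measure_pi_average_deviation_le Q hgm hB hn0 (by positivity)).trans
      (ENNReal.ofReal_le_ofReal (le_trans (le_of_eq ?_) hA1'))
    rw [div_pow, Real.sq_sqrt hn'.le]
    field_simp
  have hE2le : μ E2 ≤ ENNReal.ofReal δ :=
    (hbias n hn A2 (by linarith)).trans (ENNReal.ofReal_le_ofReal hA2')
  have hE3le : μ E3 ≤ ENNReal.ofReal δ :=
    (hnoise n hn A3 (by linarith)).trans (ENNReal.ofReal_le_ofReal hA3')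
  have htie : ∀ᵐ z ∂μ, ∀ i j k : Fin n, j ≠ k → i ≠ j → i ≠ k →
      (∀ i j, ‖(z i).1 - (z j).1‖ ≤ R) →
      (∀ v : Cov p, l * ‖v‖ ^ 2 ≤ v.ofLp ⬝ᵥ sampleCov (fun i => (z i).1) *ᵥ v.ofLp) →
      matrixNorm (mahalanobis fun i => (z i).1) ((z j).1 - (z i).1) ≠
        matrixNorm (mahalanobis fun i => (z i).1) ((z k).1 - (z i).1) := by
    refine ae_all_iff.2 fun i => ae_all_iff.2 fun j => ae_all_iff.2 fun k =>
      ae_all_iff.2 fun hjk => ae_all_iff.2 fun hij => ae_all_iff.2 fun hik => ?_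
    exact ae_no_tie Q measurable_fst (fun B hB h0 => h.null hB h0) hp (show (0 : ℝ) < l from hl)
      hnl hjk hij hik
  have hsub : ({z | (A1 + A2 + A3) * r <
      |matchingEstimator M (covariates z) (treatments z) (fun i => (z i).2.2) π - θ|} :
        Set (Fin n → Cov p × Fin 2 × ℝ)) ≤ᵐ[μ]
      ({z | covariates z ∉ G n} ∪
        ({z | ¬ ∀ w : Fin 2, M ≤ (Finset.univ.filter fun i => (z i).2.1 = w).card} ∪
        (E1 ∪ (E2 ∪ E3))) : Set (Fin n → Cov p × Fin 2 × ℝ)) := by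
    filter_upwards [htie] with z hz hbad
    by_contra hcon
    have hcon' : ¬ (covariates z ∉ G n ∨
      ¬ (∀ w : Fin 2, M ≤ (Finset.univ.filter fun i => (z i).2.1 = w).card) ∨
      z ∈ E1 ∨ z ∈ E2 ∨ z ∈ E3) := hcon
    push Not at hcon'
    obtain ⟨hzG, harms, h1, h2, h3⟩ := hcon'
    obtain ⟨hz1, hz2⟩ := hG n _ hzG
    have hJ : ∀ i, (matchedSet (mahalanobis (covariates z)) M (covariates z) (treatments z) i).card
        = M := fun i => by
      refine card_matchedSet_eq _ M _ _ i (harms (1 - (z i).2.1)) fun j hj k hk hjk => ?_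
      exact hz i j k hjk (ne_of_mem_oppositeArm hj) (ne_of_mem_oppositeArm hk) hz1 hz2
    have hdec := matchingEstimator_eq hM π m (covariates z) (treatments z)
      (fun i => (z i).2.2) hJ
    have b1 : |(n : ℝ)⁻¹ * ∑ i, policySign π (z i).1 * (m 1 (z i).1 - m 0 (z i).1) - θ| ≤
        A1 * r := by
      refine (not_le.1 h1).le.trans ?_
      rw [div_eq_mul_one_div]
      gcongr
      exact inv_sqrt_le_rate hn0 p
    have b3 : |(n : ℝ)⁻¹ * ∑ j, regressionResidual m (z j) *
        residualWeight M π (covariates z) (treatments z) j| ≤ A3 * r := by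
      refine (not_lt.1 fun hc => h3 ⟨hzG, hc⟩).trans ?_
      rw [div_eq_mul_one_div]
      gcongr
      exact inv_sqrt_le_rate hn0 p
    have b2 : |(n : ℝ)⁻¹ * ∑ i, matchingBias M π m (covariates z) (treatments z) i| ≤ A2 * r := by
      have h4 := not_lt.1 fun hc => h2 ⟨hzG, hc⟩
      refine le_trans ?_ (mul_le_mul_of_nonneg_left (rpow_inv_le_rate hn0 hp)
        (by linarith : (0 : ℝ) ≤ A2))
      refine le_of_pow_le_pow_left₀ (by omega : p ≠ 0) (by positivity) ?_
      have h5 : ((n : ℝ) ^ (-(1 / p : ℝ))) ^ p = (n : ℝ)⁻¹ := by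
        rw [← Real.rpow_natCast, ← Real.rpow_mul hn'.le]
        have : (p : ℝ) ≠ 0 := by positivity
        rw [neg_mul, one_div, inv_mul_cancel₀ this, Real.rpow_neg_one]
      rw [mul_pow, h5, ← div_eq_mul_inv, le_div_iff₀ hn', mul_comm]
      -- The constant `A2` was taken at least one so that `A2 ≤ A2 ^ p`, which permits extracting
      -- the `p`-th root with the same constant.
      exact h4.trans (le_self_pow₀ hA2 (by omega))
    refine absurd hbad (not_lt.2 ?_)
    rw [hdec]
    have e : (n : ℝ)⁻¹ * ∑ i, policySign π (covariates z i) *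
          (m 1 (covariates z i) - m 0 (covariates z i)) +
        (n : ℝ)⁻¹ * ∑ i, matchingBias M π m (covariates z) (treatments z) i +
        (n : ℝ)⁻¹ * ∑ j, ((z j).2.2 - m (treatments z j) (covariates z j)) *
          residualWeight M π (covariates z) (treatments z) j - θ =
        ((n : ℝ)⁻¹ * ∑ i, policySign π (z i).1 * (m 1 (z i).1 - m 0 (z i).1) - θ) +
        (n : ℝ)⁻¹ * ∑ i, matchingBias M π m (covariates z) (treatments z) i +
        (n : ℝ)⁻¹ * ∑ j, regressionResidual m (z j) *
          residualWeight M π (covariates z) (treatments z) j := by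
      simp only [regressionResidual, covariates, treatments]
      ring
    rw [e]
    refine (abs_add_three _ _ _).trans ?_
    linarith
  refine (measure_mono_ae hsub).trans ?_
  calc _ ≤ ENNReal.ofReal δ + (ENNReal.ofReal δ + (ENNReal.ofReal δ +
        (ENNReal.ofReal δ + ENNReal.ofReal δ))) := by
        refine (measure_union_le _ _).trans (add_le_add hG1 ?_)
        refine (measure_union_le _ _).trans (add_le_add harm ?_)
        refine (measure_union_le _ _).trans (add_le_add hE1le ?_)
        exact (measure_union_le _ _).trans (add_le_add hE2le hE3le)
    _ = ENNReal.ofReal ε := by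
        rw [← ENNReal.ofReal_add hδ0.le hδ0.le, ← ENNReal.ofReal_add hδ0.le (by positivity),
          ← ENNReal.ofReal_add hδ0.le (by positivity), ← ENNReal.ofReal_add hδ0.le (by positivity)]
        congr 1
        rw [hδ]; ring

end Rate

theorem measurableSet_sigmaXW_treatment {Ω₀ : Type*} {p : ℕ} {X : Ω₀ → Cov p} {W : Ω₀ → Fin 2}
    (w : Fin 2) : MeasurableSet[sigmaXW X W] (W ⁻¹' {w}) :=
  ⟨Prod.snd ⁻¹' {w}, measurable_snd (measurableSet_singleton w), rfl⟩

/-! ### Identification of the advantage from observed data. -/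

section Model

variable {Ω₀ : Type*} [MeasurableSpace Ω₀] [StandardBorelSpace Ω₀] {P₀ : Measure Ω₀}
  [IsProbabilityMeasure P₀] {p : ℕ} {X : Ω₀ → Cov p} {W : Ω₀ → Fin 2} {Ypot : Fin 2 → Ω₀ → ℝ}
  {X₀ : Set (Cov p)}

theorem IsCausalModel.sigmaXW_le (h : IsCausalModel P₀ X W Ypot) :
    sigmaXW X W ≤ (inferInstance : MeasurableSpace Ω₀) :=
  (h.measurable_X.prodMk h.measurable_W).comap_le

theorem IsCausalModel.measurable_outcome (h : IsCausalModel P₀ X W Ypot) :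
    Measurable (outcome W Ypot) := by
  have : outcome W Ypot = fun ω => if W ω = 0 then Ypot 0 ω else Ypot 1 ω := by
    ext ω
    unfold outcome
    have h2 : W ω = 0 ∨ W ω = 1 := by omega
    rcases h2 with h2 | h2 <;> simp [h2]
  rw [this]
  exact Measurable.ite (h.measurable_W (measurableSet_singleton 0)) (h.measurable_Ypot 0)
    (h.measurable_Ypot 1)

/-- Integrating the propensity score over `X ∈ B` turns its pointwise bounds into bounds on joint
probabilities; the upper bound `1 - c` serves the control arm. -/
theorem IsCausalModel.exists_overlap (h : IsCausalModel P₀ X W Ypot) :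
    ∃ c : ℝ≥0, 0 < c ∧ ∀ w B, MeasurableSet B →
      c * P₀ (X ⁻¹' B) ≤ P₀ {ω | X ω ∈ B ∧ W ω = w} := by
  obtain ⟨c, hc, hae⟩ := h.overlap
  refine ⟨⟨c, hc.le⟩, hc, fun w B hB => ?_⟩
  set S := X ⁻¹' B with hS
  have hSm : MeasurableSet S := h.measurable_X hB
  have hT : MeasurableSet (W ⁻¹' {1}) := h.measurable_W (measurableSet_singleton 1)
  have h1 := setIntegral_condExp (μ := P₀) h.measurable_X.comap_le
    (f := (W ⁻¹' {1}).indicator fun _ => (1 : ℝ)) ((integrable_const 1).indicator hT)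
    (s := S) ⟨B, hB, rfl⟩
  have h2 : ∫ ω in S, (W ⁻¹' {1}).indicator (fun _ => (1 : ℝ)) ω ∂P₀
      = P₀.real (W ⁻¹' {1} ∩ S) := by
    rw [integral_indicator_const _ hT, measureReal_restrict_apply hT]
    simp
  have hlo : c * P₀.real S ≤ P₀.real (W ⁻¹' {1} ∩ S) := by
    rw [← h2, ← h1, mul_comm, ← smul_eq_mul, ← setIntegral_const]
    refine setIntegral_mono_ae (integrable_const _).integrableOn integrable_condExp.integrableOn ?_
    filter_upwards [hae] with ω hω using hω.1.le
  have hhi : P₀.real (W ⁻¹' {1} ∩ S) ≤ (1 - c) * P₀.real S := by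
    rw [← h2, ← h1, mul_comm, ← smul_eq_mul, ← setIntegral_const]
    refine setIntegral_mono_ae integrable_condExp.integrableOn (integrable_const _).integrableOn ?_
    filter_upwards [hae] with ω hω using hω.2.le
  have hsplit : P₀.real (S ∩ W ⁻¹' {1}) + P₀.real (S \ W ⁻¹' {1}) = P₀.real S :=
    measureReal_inter_add_sdiff hT
  have hreal : c * P₀.real S ≤ P₀.real {ω | X ω ∈ B ∧ W ω = w} := by
    have hw : w = 0 ∨ w = 1 := by omega
    rcases hw with rfl | rfl
    · have : {ω | X ω ∈ B ∧ W ω = 0} = S \ W ⁻¹' {1} := by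
        ext ω
        simp only [Set.mem_ofPred_eq, Set.mem_sdiff, hS, Set.mem_preimage, Set.mem_singleton_iff]
        refine and_congr_right fun _ => ?_
        omega
      rw [this]
      rw [Set.inter_comm] at hsplit
      linarith
    · have : {ω | X ω ∈ B ∧ W ω = 1} = W ⁻¹' {1} ∩ S := by
        ext ω; simp [hS, and_comm]
      rwa [this]
  have := ENNReal.ofReal_le_ofReal hreal
  rw [ENNReal.ofReal_mul hc.le, ofReal_measureReal, ofReal_measureReal] at this
  rwa [ENNReal.ofReal_eq_coe_nnreal hc.le] at this

/-- Under overlap, a property of the covariates that holds almost surely in one treatment arm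
holds almost surely. -/
theorem IsCausalModel.ae_of_ae_arm (h : IsCausalModel P₀ X W Ypot) {s : Set (Cov p)}
    (hs : MeasurableSet s) (w : Fin 2) (hae : ∀ᵐ ω ∂P₀, W ω = w → X ω ∈ s) :
    ∀ᵐ ω ∂P₀, X ω ∈ s := by
  obtain ⟨c, hc, hlow⟩ := h.exists_overlap
  have h0 : P₀ {ω | X ω ∈ sᶜ ∧ W ω = w} = 0 := by
    rw [ae_iff] at hae
    convert hae using 2
    ext ω
    simp [and_comm]
  have := hlow w sᶜ hs.compl
  rw [h0, nonpos_iff_eq_zero, mul_eq_zero] at this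
  rcases this with h1 | h1
  · exact absurd (ENNReal.coe_eq_zero.1 h1) hc.ne'
  · rw [ae_iff]; exact h1

/-- Unconfoundedness says that the conditional law of `Y(w)` given `(X, W)` does not depend on `W`;
integrating against this law gives the claim. -/
theorem IsCausalModel.condExp_potential (h : IsCausalModel P₀ X W Ypot) (w : Fin 2) :
    P₀[Ypot w | sigmaXW X W] =ᵐ[P₀] P₀[Ypot w | sigmaX X] := by
  have hind : CondIndepFun (sigmaX X) h.measurable_X.comap_le W (Ypot w) P₀ := by
    have hw : w = 0 ∨ w = 1 := by omega
    rcases hw with rfl | rfl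
    · exact (h.unconfounded.comp measurable_snd measurable_id).symm
    · exact (h.unconfounded.comp measurable_fst measurable_id).symm
  have h1 := (condIndepFun_iff_condDistrib_prod_ae_eq_prodMkRight (h.measurable_Ypot w)
    h.measurable_W h.measurable_X).1 hind
  have hXW := h.measurable_X.prodMk h.measurable_W
  have h2 := ae_of_ae_map hXW.aemeasurable h1
  filter_upwards [h2, condExp_ae_eq_integral_condDistrib' hXW (h.integrable_Ypot w),
    condExp_ae_eq_integral_condDistrib' h.measurable_X (h.integrable_Ypot w)] with ω e1 e2 e3
  rw [e2, e3, e1, Kernel.prodMkRight_apply]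

/-- The regression function of the observed outcome in the arm `w` is that of the potential
outcome `w`. -/
theorem IsCausalModel.condExp_potential_eq (h : IsCausalModel P₀ X W Ypot)
    (hint : Integrable (outcome W Ypot) P₀) {m : Fin 2 → Cov p → ℝ}
    (hm : ∀ w, Measurable (m w))
    (hreg : P₀[outcome W Ypot | sigmaXW X W] =ᵐ[P₀] fun ω => m (W ω) (X ω)) (w : Fin 2) :
    P₀[Ypot w | sigmaX X] =ᵐ[P₀] fun ω => m w (X ω) := by
  obtain ⟨g, hg, hgX⟩ : ∃ g : Cov p → ℝ, Measurable g ∧ P₀[Ypot w | sigmaX X] = g ∘ X :=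
    (stronglyMeasurable_condExp (m := sigmaX X)).measurable.exists_eq_measurable_comp
  have hA := measurableSet_sigmaXW_treatment (X := X) (W := W) w
  -- On `{W = w}`, an event of `σ(X, W)`, the observed and potential outcomes agree, hence so do
  -- their conditional expectations there. The resulting identity involves `X` only, so overlap
  -- extends it beyond the arm.
  have hEq : (W ⁻¹' {w}).indicator (outcome W Ypot) = (W ⁻¹' {w}).indicator (Ypot w) := by
    refine Set.indicator_congr fun ω hω => ?_
    rw [outcome, show W ω = w from hω]
  have h1 := condExp_indicator hint hA
  have h2 := condExp_indicator (h.integrable_Ypot w) hA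
  rw [hEq] at h1
  have hs : MeasurableSet {x | g x = m w x} := measurableSet_eq_fun hg (hm w)
  have := h.ae_of_ae_arm hs w ?_
  · filter_upwards [this] with ω hω
    rw [hgX]; exact hω
  · filter_upwards [h1, h2, h.condExp_potential w, hreg] with ω e1 e2 e3 e4 hω
    rw [e1, Set.indicator_of_mem (show ω ∈ W ⁻¹' {w} from hω),
      Set.indicator_of_mem (show ω ∈ W ⁻¹' {w} from hω), e4, e3, hgX, hω] at e2
    exact e2.symm

theorem IsCausalModel.advantage_eq (h : IsCausalModel P₀ X W Ypot)
    (hint : Integrable (outcome W Ypot) P₀) {m : Fin 2 → Cov p → ℝ}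
    (hm : ∀ w, Measurable (m w))
    (hreg : P₀[outcome W Ypot | sigmaXW X W] =ᵐ[P₀] fun ω => m (W ω) (X ω))
    {π : Policy p} (hπ : Measurable π) :
    advantage P₀ X Ypot π = ∫ y, policySign π y.1 * (m 1 y.1 - m 0 y.1)
      ∂P₀.map (fun ω => (X ω, W ω, outcome W Ypot ω)) := by
  have hZ : Measurable fun ω => (X ω, W ω, outcome W Ypot ω) :=
    h.measurable_X.prodMk (h.measurable_W.prodMk h.measurable_outcome)
  rw [integral_map hZ.aemeasurable]
  · refine integral_congr_ae ?_
    filter_upwards [h.condExp_potential_eq hint hm hreg 0, h.condExp_potential_eq hint hm hreg 1,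
      condExp_sub (h.integrable_Ypot 1) (h.integrable_Ypot 0) (sigmaX X)] with ω e0 e1 e2
    rw [cate, e2, Pi.sub_apply, e0, e1]
  · refine Measurable.aestronglyMeasurable ?_
    exact ((measurable_policySign hπ).comp measurable_fst).mul
      (((hm 1).comp measurable_fst).sub ((hm 0).comp measurable_fst))

end Model

/-! ### Consequences of the assumptions on covariates and outcomes. -/

section Regularity

variable {Ω₀ : Type*} [MeasurableSpace Ω₀] {P₀ : Measure Ω₀} {p : ℕ} {X : Ω₀ → Cov p}
  {W : Ω₀ → Fin 2} {Y : Ω₀ → ℝ} {X₀ : Set (Cov p)}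

theorem HasRegularCovariate.ae_mem (h : HasRegularCovariate P₀ X X₀) (hX : Measurable X) :
    ∀ᵐ ω ∂P₀, X ω ∈ X₀ := by
  obtain ⟨f, hf, hmap, h0, -⟩ := h.density
  refine ae_of_ae_map (p := fun x => x ∈ X₀) hX.aemeasurable ?_
  rw [hmap, ae_withDensity_iff hf]
  exact ae_of_all _ fun x hx => by_contra fun hn => hx (h0 x hn)

theorem HasRegularCovariate.measure_preimage_le (h : HasRegularCovariate P₀ X X₀)
    (hX : Measurable X) :
    ∃ b : ℝ≥0, ∀ B, MeasurableSet B → P₀ (X ⁻¹' B) ≤ b * volume B := by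
  obtain ⟨f, hf, hmap, h0, a, b, -, hab⟩ := h.density
  refine ⟨b, fun B hB => ?_⟩
  rw [← Measure.map_apply hX hB, hmap, withDensity_apply _ hB, ← setLIntegral_const]
  refine lintegral_mono fun x => ?_
  by_cases hx : x ∈ X₀
  · exact (hab x hx).2
  · rw [h0 x hx]; exact bot_le

theorem HasRegularCovariate.le_measure_preimage (h : HasRegularCovariate P₀ X X₀)
    (hX : Measurable X) :
    ∃ a : ℝ≥0, 0 < a ∧ ∀ B, MeasurableSet B → a * volume (B ∩ X₀) ≤ P₀ (X ⁻¹' B) := by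
  obtain ⟨f, hf, hmap, h0, a, b, ha, hab⟩ := h.density
  refine ⟨a, ha, fun B hB => ?_⟩
  rw [← Measure.map_apply hX hB, hmap, withDensity_apply _ hB, ← setLIntegral_const]
  refine (setLIntegral_mono' (hB.inter h.isCompact.measurableSet) fun x hx => (hab x hx.2).1).trans
    (lintegral_mono_set Set.inter_subset_left)

/-- A real function Lipschitz on `X₀` extends to the whole space with the same constant. The
extension is measurable, and nothing changes almost surely because `X` lies in `X₀`. -/
theorem HasRegularOutcome.exists_regression (h : HasRegularOutcome P₀ X W Y X₀)
    (hmem : ∀ᵐ ω ∂P₀, X ω ∈ X₀) :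
    ∃ m : Fin 2 → Cov p → ℝ, (∃ L : ℝ≥0, ∀ w, LipschitzWith L (m w)) ∧
      P₀[Y | sigmaXW X W] =ᵐ[P₀] fun ω => m (W ω) (X ω) := by
  obtain ⟨μ, hμ, hlip⟩ := h.lipschitz_mean
  choose L hL using hlip
  choose m hm hEq using fun w => (hL w).extend_real
  refine ⟨m, ⟨L 0 ⊔ L 1, fun w => (hm w).weaken ?_⟩, ?_⟩
  · have hw : w = 0 ∨ w = 1 := by omega
    rcases hw with rfl | rfl
    · exact le_sup_left
    · exact le_sup_right
  · filter_upwards [hμ, hmem] with ω h1 h2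
    rw [h1]; exact hEq (W ω) h2

theorem HasRegularOutcome.exists_condVar_le (h : HasRegularOutcome P₀ X W Y X₀)
    (hX₀ : IsCompact X₀) (hmem : ∀ᵐ ω ∂P₀, X ω ∈ X₀) :
    ∃ C : ℝ≥0, ∀ᵐ ω ∂P₀, condVar (sigmaXW X W) Y P₀ ω ≤ C := by
  obtain ⟨σ2, hσ, hlip⟩ := h.lipschitz_variance
  choose L hL using hlip
  choose B hB using fun w => hX₀.exists_bound_of_continuousOn (hL w).continuousOn
  refine ⟨(B 0).toNNReal ⊔ (B 1).toNNReal, ?_⟩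
  filter_upwards [hσ, hmem] with ω h1 h2
  rw [h1]
  have h3 := (Real.le_norm_self _).trans (hB (W ω) _ h2)
  refine h3.trans ((Real.le_coe_toNNReal _).trans (NNReal.coe_le_coe.2 ?_))
  have hw : W ω = 0 ∨ W ω = 1 := by omega
  rcases hw with hw | hw <;> rw [hw]
  · exact le_sup_left
  · exact le_sup_right

theorem measurable_residual {m : Fin 2 → Cov p → ℝ} (hm : ∀ w, Measurable (m w)) :
    Measurable fun z : Cov p × Fin 2 × ℝ => z.2.2 - m z.2.1 z.1 :=
  (measurable_snd.comp measurable_snd).sub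
    ((measurable_regression hm).comp (measurable_fst.prodMk (measurable_fst.comp measurable_snd)))

variable [IsProbabilityMeasure P₀]

theorem integral_residual_mul_eq_zero (hm : sigmaXW X W ≤ (inferInstance : MeasurableSpace Ω₀))
    (hY : Integrable Y P₀) {φ : Cov p × Fin 2 → ℝ} (hφ : Measurable φ)
    (hb : ∃ C, ∀ x, |φ x| ≤ C) :
    ∫ ω, (Y ω - (P₀[Y | sigmaXW X W]) ω) * φ (X ω, W ω) ∂P₀ = 0 := by
  obtain ⟨C, hC⟩ := hb
  set g : Ω₀ → ℝ := fun ω => φ (X ω, W ω) with hg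
  have hgm : StronglyMeasurable[sigmaXW X W] g :=
    (hφ.comp (comap_measurable (fun ω => (X ω, W ω)))).stronglyMeasurable
  have hbd : ∀ᵐ ω ∂P₀, ‖g ω‖ ≤ C := ae_of_all _ fun ω => hC _
  have hgm' : AEStronglyMeasurable g P₀ := (hgm.mono hm).aestronglyMeasurable
  have h1 := condExp_stronglyMeasurable_mul_of_bound hm hgm hY C hbd
  have h2 : ∫ ω, g ω * Y ω ∂P₀ = ∫ ω, g ω * (P₀[Y | sigmaXW X W]) ω ∂P₀ := by
    have := integral_condExp (μ := P₀) hm (f := g * Y)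
    rw [integral_congr_ae h1] at this
    exact this.symm
  have i1 : Integrable (fun ω => g ω * Y ω) P₀ := hY.bdd_mul hgm' hbd
  have i2 : Integrable (fun ω => g ω * (P₀[Y | sigmaXW X W]) ω) P₀ :=
    integrable_condExp.bdd_mul hgm' hbd
  calc ∫ ω, (Y ω - (P₀[Y | sigmaXW X W]) ω) * g ω ∂P₀
      = ∫ ω, (g ω * Y ω - g ω * (P₀[Y | sigmaXW X W]) ω) ∂P₀ :=
        integral_congr_ae (ae_of_all _ fun ω => by ring)
    _ = 0 := by rw [integral_sub i1 i2, h2, sub_self]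

/-- Weighting `P₀` by the squared residual and pushing it to the law of `(X, W)` gives a measure
whose mass on each set is an integral of the conditional variance, hence at most `C` times the
original. Comparing measures handles every nonnegative `φ`, unbounded ones included. -/
theorem lintegral_residual_sq_mul_le (hX : Measurable X) (hW : Measurable W)
    (hY : MemLp Y 2 P₀) (hYm : Measurable Y) {C : ℝ≥0}
    (hC : ∀ᵐ ω ∂P₀, condVar (sigmaXW X W) Y P₀ ω ≤ C)
    {φ : Cov p × Fin 2 → ℝ≥0∞} (hφ : Measurable φ) :
    ∫⁻ ω, ENNReal.ofReal ((Y ω - (P₀[Y | sigmaXW X W]) ω) ^ 2) * φ (X ω, W ω) ∂P₀ ≤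
      C * ∫⁻ ω, φ (X ω, W ω) ∂P₀ := by
  have hXW := hX.prodMk hW
  have hle : sigmaXW X W ≤ (inferInstance : MeasurableSpace Ω₀) := hXW.comap_le
  have hint : Integrable ((Y - P₀[Y | sigmaXW X W]) ^ 2) P₀ :=
    (hY.sub (hY.condExp one_le_two)).integrable_sq
  set d : Ω₀ → ℝ≥0∞ := fun ω => ENNReal.ofReal ((Y ω - (P₀[Y | sigmaXW X W]) ω) ^ 2) with hd
  have hdm : Measurable d :=
    ((hYm.sub (stronglyMeasurable_condExp.mono hle).measurable).pow_const 2).ennreal_ofReal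
  have hmeas : (P₀.withDensity d).map (fun ω => (X ω, W ω)) ≤
      C • P₀.map (fun ω => (X ω, W ω)) := by
    refine Measure.le_iff.2 fun A hA => ?_
    rw [Measure.map_apply hXW hA, withDensity_apply _ (hXW hA), Measure.smul_apply,
      Measure.map_apply hXW hA]
    have h0 := ofReal_integral_eq_lintegral_ofReal
      (hint.integrableOn (s := (fun ω => (X ω, W ω)) ⁻¹' A)) (ae_of_all _ fun ω => sq_nonneg _)
    simp only [Pi.pow_apply, Pi.sub_apply] at h0
    rw [hd, ← h0]
    have h1 := setIntegral_condVar (hm := hle) hint (s := (fun ω => (X ω, W ω)) ⁻¹' A)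
      ⟨A, hA, rfl⟩
    rw [← h1]
    have h2 : ∫ ω in (fun ω => (X ω, W ω)) ⁻¹' A, condVar (sigmaXW X W) Y P₀ ω ∂P₀ ≤
        C * P₀.real ((fun ω => (X ω, W ω)) ⁻¹' A) := by
      rw [mul_comm, ← smul_eq_mul, ← setIntegral_const]
      exact setIntegral_mono_ae integrable_condVar.integrableOn
        (integrable_const _).integrableOn hC
    refine (ENNReal.ofReal_le_ofReal h2).trans ?_
    rw [ENNReal.ofReal_mul C.coe_nonneg, ofReal_measureReal, ENNReal.ofReal_coe_nnreal]
    rfl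
  calc ∫⁻ ω, d ω * φ (X ω, W ω) ∂P₀
      = ∫⁻ y, φ y ∂(P₀.withDensity d).map (fun ω => (X ω, W ω)) := by
        rw [lintegral_map hφ hXW]
        exact (lintegral_withDensity_eq_lintegral_mul _ hdm (hφ.comp hXW)).symm
    _ ≤ ∫⁻ y, φ y ∂(C • P₀.map (fun ω => (X ω, W ω))) := lintegral_mono' hmeas le_rfl
    _ = C * ∫⁻ ω, φ (X ω, W ω) ∂P₀ := by
        rw [lintegral_smul_measure, lintegral_map hφ hXW]; rfl

end Regularity

/-! ### The observed data have a regular law. -/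

section Law

variable {Ω₀ : Type*} [MeasurableSpace Ω₀] [StandardBorelSpace Ω₀] {P₀ : Measure Ω₀}
  [IsProbabilityMeasure P₀] {p : ℕ} {X : Ω₀ → Cov p} {W : Ω₀ → Fin 2} {Ypot : Fin 2 → Ω₀ → ℝ}
  {X₀ : Set (Cov p)}

/-- The law of `(X, W, Y)` in a regular potential outcome model is regular. -/
theorem IsCausalModel.isRegularLaw (h : IsCausalModel P₀ X W Ypot)
    (hX : HasRegularCovariate P₀ X X₀) (hY : HasRegularOutcome P₀ X W (outcome W Ypot) X₀)
    {m : Fin 2 → Cov p → ℝ} (hm : ∃ L : ℝ≥0, ∀ w, LipschitzWith L (m w))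
    (hreg : P₀[outcome W Ypot | sigmaXW X W] =ᵐ[P₀] fun ω => m (W ω) (X ω)) :
    IsRegularLaw (P₀.map fun ω => (X ω, W ω, outcome W Ypot ω)) X₀ m := by
  have hXm := h.measurable_X
  have hYm := h.measurable_outcome
  have hZ : Measurable fun ω => (X ω, W ω, outcome W Ypot ω) :=
    hXm.prodMk (h.measurable_W.prodMk hYm)
  have hmem := hX.ae_mem hXm
  have hmm : ∀ w, Measurable (m w) := fun w => by
    obtain ⟨L, hL⟩ := hm
    exact (hL w).continuous.measurable
  have hY2 : MemLp (outcome W Ypot) 2 P₀ := hY.memLp_four.mono_exponent (by norm_num)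
  have hres := measurable_residual hmm
  refine ⟨hX.convex, hX.isCompact, ?_, ?_, ?_, hm, ?_, ?_, ?_⟩
  · exact (ae_map_iff hZ.aemeasurable (measurable_fst hX.isCompact.measurableSet)).2 hmem
  · obtain ⟨b, hb⟩ := hX.measure_preimage_le hXm
    refine ⟨b, fun B hB => ?_⟩
    rw [Measure.map_apply hZ (measurable_fst hB)]
    exact hb B hB
  · obtain ⟨c, hc, hcl⟩ := h.exists_overlap
    obtain ⟨a, ha, hal⟩ := hX.le_measure_preimage hXm
    refine ⟨c * a, mul_pos hc ha, fun w B hB => ?_⟩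
    have hs : MeasurableSet {z : Cov p × Fin 2 × ℝ | z.1 ∈ B ∧ z.2.1 = w} :=
      (measurable_fst hB).inter
        ((measurable_fst.comp measurable_snd) (measurableSet_singleton w))
    rw [Measure.map_apply hZ hs, ENNReal.coe_mul, mul_assoc]
    exact (mul_le_mul_right (hal B hB) _).trans (hcl w B hB)
  · rw [integrable_map_measure (hres.pow_const 2).aestronglyMeasurable hZ.aemeasurable]
    refine (hY2.sub (hY2.condExp (m := sigmaXW X W) one_le_two)).integrable_sq.congr ?_
    filter_upwards [hreg] with ω hω
    simp only [Function.comp_apply, Pi.sub_apply, hω]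
  · intro φ hφ hb
    rw [integral_map hZ.aemeasurable]
    · rw [← integral_residual_mul_eq_zero h.sigmaXW_le (hY2.integrable one_le_two) hφ hb]
      refine integral_congr_ae ?_
      filter_upwards [hreg] with ω hω
      rw [hω]
    · exact (hres.mul (hφ.comp (measurable_fst.prodMk
        (measurable_fst.comp measurable_snd)))).aestronglyMeasurable
  · obtain ⟨C, hC⟩ := hY.exists_condVar_le hX.isCompact hmem
    refine ⟨C, fun φ hφ => ?_⟩
    have hφ' : Measurable fun z : Cov p × Fin 2 × ℝ => φ (z.1, z.2.1) :=
      hφ.comp (measurable_fst.prodMk (measurable_fst.comp measurable_snd))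
    rw [lintegral_map hφ' hZ]
    refine le_trans (le_of_eq ?_)
      (lintegral_residual_sq_mul_le hXm h.measurable_W hY2 hYm hC hφ)
    refine (lintegral_map ((hres.pow_const 2).ennreal_ofReal.mul hφ') hZ).trans
      (lintegral_congr_ae ?_)
    filter_upwards [hreg] with ω hω
    simp only [Pi.mul_apply, hω]

end Law

/-! ### Transfer to the sample. -/

section Sample

variable {Ω₀ Ω : Type*} [MeasurableSpace Ω₀] [MeasurableSpace Ω] {p : ℕ}
  {P₀ : Measure Ω₀} {X : Ω₀ → Cov p} {W : Ω₀ → Fin 2} {Y : Ω₀ → ℝ} {P : Measure Ω}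
  {Xs : ℕ → Ω → Cov p} {Ws : ℕ → Ω → Fin 2} {Ys : ℕ → Ω → ℝ}

/-- The sample has the product law. The inequality, which is all that an upper bound on failure
probabilities needs, holds for arbitrary `s`, so the failure event need not be shown measurable. -/
theorem IsIIDSample.measure_le_pi (h : IsIIDSample P₀ X W Y P Xs Ws Ys) (n : ℕ)
    (s : Set (Fin n → Cov p × Fin 2 × ℝ)) :
    P {ω | (fun i : Fin n => (Xs i ω, Ws i ω, Ys i ω)) ∈ s} ≤
      (Measure.pi fun _ : Fin n => P₀.map fun ω => (X ω, W ω, Y ω)) s := by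
  have hm : ∀ i : Fin n, AEMeasurable (fun ω => (Xs i ω, Ws i ω, Ys i ω)) P := fun i =>
    (h.identDistrib i).aemeasurable_fst
  have hpi := (h.indep.precomp Fin.val_injective).map_fun_eq_pi_map hm
  simp only [(h.identDistrib _).map_eq] at hpi
  rw [← hpi]
  exact Measure.le_map_apply (aemeasurable_pi_lambda _ hm) s

end Sample

end

theorem corollary1
    {Ω₀ : Type*} [MeasurableSpace Ω₀] [StandardBorelSpace Ω₀]
    (P₀ : Measure Ω₀) [IsProbabilityMeasure P₀]
    {Ω : Type*} [MeasurableSpace Ω] (P : Measure Ω) [IsProbabilityMeasure P]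
    (p M : ℕ) (hp : 1 ≤ p) (hM : 1 ≤ M)
    (X : Ω₀ → Cov p) (W : Ω₀ → Fin 2) (Ypot : Fin 2 → Ω₀ → ℝ)
    (hmodel : IsCausalModel P₀ X W Ypot)
    (X₀ : Set (Cov p))
    (hX : HasRegularCovariate P₀ X X₀)
    (hY : HasRegularOutcome P₀ X W (outcome W Ypot) X₀)
    (Xs : ℕ → Ω → Cov p) (Ws : ℕ → Ω → Fin 2) (Ys : ℕ → Ω → ℝ)
    (hsample : IsIIDSample P₀ X W (outcome W Ypot) P Xs Ws Ys)
    (π : Policy p) (hπ : Measurable π) :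
    IsBigOInProb P
      (fun n ω => matchingEstimator M (fun i : Fin n => Xs i ω) (fun i : Fin n => Ws i ω)
        (fun i : Fin n => Ys i ω) π - advantage P₀ X Ypot π)
      (fun n => (n : ℝ) ^ (-(1 / (max 2 p : ℕ) : ℝ))) ∧
    (p ≤ 2 → IsBigOInProb P
      (fun n ω => matchingEstimator M (fun i : Fin n => Xs i ω) (fun i : Fin n => Ws i ω)
        (fun i : Fin n => Ys i ω) π - advantage P₀ X Ypot π)
      (fun n => (n : ℝ) ^ (-(1 / 2) : ℝ))) := by
  have hmain : IsBigOInProb P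
      (fun n ω => matchingEstimator M (fun i : Fin n => Xs i ω) (fun i : Fin n => Ws i ω)
        (fun i : Fin n => Ys i ω) π - advantage P₀ X Ypot π)
      (fun n => (n : ℝ) ^ (-(1 / (max 2 p : ℕ) : ℝ))) := by
    obtain ⟨m, hm, hreg⟩ := hY.exists_regression (hX.ae_mem hmodel.measurable_X)
    have hmm : ∀ w, Measurable (m w) := fun w => by
      obtain ⟨L, hL⟩ := hm
      exact (hL w).continuous.measurable
    have hint : Integrable (outcome W Ypot) P₀ := hY.memLp_four.integrable (by norm_num)
    have hlaw := hmodel.isRegularLaw hX hY hm hreg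
    have hZ : Measurable fun ω => (X ω, W ω, outcome W Ypot ω) :=
      hmodel.measurable_X.prodMk (hmodel.measurable_W.prodMk hmodel.measurable_outcome)
    have := Measure.isProbabilityMeasure_map (μ := P₀) hZ.aemeasurable
    intro ε hε
    obtain ⟨C, hC, hev⟩ := hlaw.matching_rate hp hM hπ hε
    refine ⟨C, hC, ?_⟩
    filter_upwards [hev] with n hn
    rw [← hmodel.advantage_eq hint hmm hreg hπ] at hn
    exact ENNReal.toReal_le_of_le_ofReal hε.le ((hsample.measure_le_pi n _).trans hn)
  refine ⟨hmain, fun h2 => ?_⟩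
  have h3 : max 2 p = 2 := max_eq_left h2
  rw [h3] at hmain
  exact_mod_cast hmain
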